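/- Let $\mathbb F$ be a field in which $2$ and $3$ are invertible. All vector spaces are $\mathbb Z$-graded by dimension (written $|x|$ for the dimension of a homogeneous element $x$), and subspaces, maps and filtrations are graded. A \emph{graded Lie algebra} is a graded vector space $L=\bigoplus_{i\in\mathbb Z}L_{(i)}$ with a bilinear bracket $L_{(i)}\times L_{(j)}\to L_{(i+j)}$ such that, for homogeneous $x,y,z$, $$[x,y]=-(-1)^{|x||y|}[y,x],\qquad [x,[y,z]]=[[x,y],z]+(-1)^{|x||y|}[y,[x,z]].$$ For a graded vector space $V$ let $\mathbb L V$ be the Lie subalgebra generated by $V$ in the tensor algebra $\mathbb T V$ with the bracket $[x,y]=xy-(-1)^{|x||y|}yx$; a graded Lie algebra is \emph{free} if it is isomorphic to some $\mathbb L W$. Let $L$ be a graded Lie algebra of finite type (each $L_{(i)}$ is finite-dimensional), with an increasing filtration $\{F_kL\}_{k\in\mathbb Z}$ by graded subspaces such that $[F_kL,F_lL]\subset F_{k+l}L$ and $\bigcup_kF_kL=L$. Put $L_0=F_0L$ and $V_1=F_1L/F_0L$, and let $\operatorname{gr}(L)=\bigoplus_kF_kL/F_{k-1}L$ be the associated graded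 Lie algebra, bigraded by dimension and by the degree $k$. Suppose that there is an isomorphism of bigraded Lie algebras $$\operatorname{gr}(L)\cong L_0\rtimes\mathbb L V_1$$ with the semi-direct product for some action of $L_0$ on $\mathbb L V_1$ by derivations, where $L_0$ has degree $0$ and $V_1$ has degree $1$ (so $\mathbb L V_1\cap V_1^{\otimes k}$ has degree $k$). Then every graded Lie subalgebra $J\subset L$ with $J\cap F_0L=0$ is a free Lie algebra. -/

import Mathlib

open scoped DirectSum

universe u v w

noncomputable section

/-! ### Graded vector spaces -/

/-- A `ℤ`-grading (by dimension) of the vector space `M`. -/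
structure DimGrading (F : Type u) (M : Type v) [Field F] [AddCommGroup M] [Module F M] where
  /-- the component of dimension `i` -/
  dim : ℤ → Submodule F M
  isInternal : DirectSum.IsInternal dim

theorem map_sign_smul {F : Type u} [Field F] {M : Type v} [AddCommGroup M] [Module F M]
    {N : Type w} [AddCommGroup N] [Module F N] (f : M →ₗ[F] N) (e : ℤˣ) (x : M) :
    f (e • x) = e • f x := by
  rw [Units.smul_def, Units.smul_def, map_zsmul]

theorem neg_sign_smul_add {N : Type w} [AddCommGroup N] (e : ℤˣ) (x y : N) :
    -(e • (x + y)) = -(e • x) + -(e • y) := by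
  rw [smul_add, neg_add]

theorem sign_smul_mem {F : Type u} [Field F] {M : Type v} [AddCommGroup M] [Module F M]
    {p : Submodule F M} (e : ℤˣ) {x : M} (hx : x ∈ p) : e • x ∈ p := by
  rw [Units.smul_def]
  exact zsmul_mem hx _

namespace DimGrading

variable {F : Type u} [Field F] {M : Type v} [AddCommGroup M] [Module F M]
  {N : Type w} [AddCommGroup N] [Module F N]

theorem iSup_dim (g : DimGrading F M) : ⨆ i, g.dim i = ⊤ := g.isInternal.submodule_iSup_eq_top

theorem le_of_dim_le (g : DimGrading F M) {p : Submodule F M} (h : ∀ i, g.dim i ≤ p) (x : M) :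
    x ∈ p := by
  have : (⊤ : Submodule F M) ≤ p := by rw [← g.iSup_dim]; exact iSup_le h
  exact this trivial

/-- Criterion for a family of subspaces to be a grading. -/
def ofProj (dim : ℤ → Submodule F M) (P : ℤ → M →ₗ[F] M)
    (h1 : ∀ i, ∀ x ∈ dim i, P i x = x) (h2 : ∀ i j, i ≠ j → ∀ x ∈ dim j, P i x = 0)
    (htop : ⨆ i, dim i = ⊤) : DimGrading F M where
  dim := dim
  isInternal := by
    refine DirectSum.isInternal_submodule_of_iSupIndep_of_iSup_eq_top ?_ htop
    intro i
    rw [Submodule.disjoint_def]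
    intro x hx hx'
    have hle : (⨆ j, ⨆ (_ : j ≠ i), dim j) ≤ LinearMap.ker (P i) :=
      iSup_le fun j => iSup_le fun hj => fun y hy => h2 i j (Ne.symm hj) y hy
    rw [← h1 i x hx]
    exact hle hx'

/-- The decomposition isomorphism `M ≅ ⨁ i, M_i`. -/
def decomp (g : DimGrading F M) : M ≃ₗ[F] ⨁ i, g.dim i :=
  (LinearEquiv.ofBijective (DirectSum.coeLinearMap g.dim) g.isInternal).symm

theorem decomp_of_mem (g : DimGrading F M) {i : ℤ} {x : M} (hx : x ∈ g.dim i) :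
    g.decomp x = DirectSum.lof F ℤ (fun i => g.dim i) i ⟨x, hx⟩ := by
  rw [decomp, LinearEquiv.symm_apply_eq]
  exact (DirectSum.coeLinearMap_lof g.dim i ⟨x, hx⟩).symm

/-- The projection of `M` onto its component of dimension `i`. -/
def proj (g : DimGrading F M) (i : ℤ) : M →ₗ[F] M :=
  (g.dim i).subtype ∘ₗ DirectSum.component F ℤ (fun i => g.dim i) i ∘ₗ g.decomp.toLinearMap

theorem proj_mem (g : DimGrading F M) (i : ℤ) (x : M) : g.proj i x ∈ g.dim i :=
  Subtype.prop _

theorem proj_of_mem (g : DimGrading F M) {i : ℤ} {x : M} (hx : x ∈ g.dim i) :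
    g.proj i x = x := by
  simp [proj, g.decomp_of_mem hx, DirectSum.component.lof_self]

theorem proj_of_mem_ne (g : DimGrading F M) {i j : ℤ} (hij : i ≠ j) {x : M} (hx : x ∈ g.dim j) :
    g.proj i x = 0 := by
  simp [proj, g.decomp_of_mem hx, DirectSum.component.of, hij.symm]

theorem exists_sum_proj (g : DimGrading F M) (x : M) :
    ∃ s : Finset ℤ, x = ∑ i ∈ s, g.proj i x := by
  classical
  refine ⟨(g.decomp x).support, ?_⟩
  have h : DirectSum.coeLinearMap g.dim (g.decomp x) = x :=
    (LinearEquiv.ofBijective (DirectSum.coeLinearMap g.dim) g.isInternal).apply_symm_apply x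
  conv_lhs => rw [← h, DirectSum.coeLinearMap_eq_dfinsuppSum]
  rfl

/-- A graded subspace: one that contains the homogeneous components of its elements. -/
def IsHomogeneous (g : DimGrading F M) (p : Submodule F M) : Prop :=
  ∀ x ∈ p, ∀ i, g.proj i x ∈ p

/-- Finite type: each component is finite-dimensional. -/
def IsFiniteType (g : DimGrading F M) : Prop :=
  ∀ i, FiniteDimensional F (g.dim i)

/-- The induced grading of a graded subspace. -/
def restrict (g : DimGrading F M) (p : Submodule F M) (hp : g.IsHomogeneous p) :
    DimGrading F p :=
  ofProj (fun i => (g.dim i).comap p.subtype)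
    (fun i => (g.proj i).restrict (fun x hx => hp x hx i))
    (fun _ x hx => Subtype.ext (g.proj_of_mem hx))
    (fun _ _ hij x hx => Subtype.ext (g.proj_of_mem_ne hij hx))
    (by
      rw [eq_top_iff]
      intro x _
      obtain ⟨s, hs⟩ := g.exists_sum_proj (x : M)
      have : x = ∑ i ∈ s, (⟨g.proj i x, hp x x.2 i⟩ : p) := by
        apply Subtype.ext
        rw [Submodule.coe_sum]
        exact hs
      rw [this]
      exact Submodule.sum_mem _ fun i _ => Submodule.mem_iSup_of_mem i (g.proj_mem i x))

/-- The induced grading of the quotient by a graded subspace. -/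
def quotient (g : DimGrading F M) (p : Submodule F M) (hp : g.IsHomogeneous p) :
    DimGrading F (M ⧸ p) :=
  ofProj (fun i => (g.dim i).map p.mkQ)
    (fun i => p.mapQ p (g.proj i) (fun x hx => hp x hx i))
    (by
      rintro i _ ⟨x, hx, rfl⟩
      simp [g.proj_of_mem hx])
    (by
      rintro i j hij _ ⟨x, hx, rfl⟩
      simp [g.proj_of_mem_ne hij hx])
    (by rw [← Submodule.map_iSup, g.iSup_dim, Submodule.map_top, Submodule.range_mkQ])

/-- The linear map which is multiplication by `(-1)^(n j)` on the component of dimension `j`. -/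
def twist (g : DimGrading F M) (n : ℤ) : M →ₗ[F] M :=
  DirectSum.toModule F ℤ M (fun j => (n * j).negOnePow • (g.dim j).subtype) ∘ₗ
    g.decomp.toLinearMap

theorem twist_of_mem (g : DimGrading F M) (n : ℤ) {j : ℤ} {x : M} (hx : x ∈ g.dim j) :
    g.twist n x = (n * j).negOnePow • x := by
  simp only [twist, LinearMap.comp_apply, LinearEquiv.coe_coe, g.decomp_of_mem hx,
    DirectSum.toModule_lof]
  rfl

/-- The transpose of a bilinear map `β` with the usual sign:
`(y, x) ↦ (-1)^(|x||y|) β(x, y)` for homogeneous `x` and `y`, extended bilinearly. -/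
def koszulFlip {P : Type*} [AddCommGroup P] [Module F P] (g : DimGrading F M)
    (h : DimGrading F N) (β : M →ₗ[F] N →ₗ[F] P) : N →ₗ[F] M →ₗ[F] P :=
  ((DirectSum.toModule F ℤ (N →ₗ[F] P)
    (fun i => (β ∘ₗ (g.dim i).subtype).compl₂ (h.twist i))) ∘ₗ g.decomp.toLinearMap).flip

theorem koszulFlip_of_mem {P : Type*} [AddCommGroup P] [Module F P] (g : DimGrading F M)
    (h : DimGrading F N) (β : M →ₗ[F] N →ₗ[F] P) {i j : ℤ} {x : M} {y : N}
    (hx : x ∈ g.dim i) (hy : y ∈ h.dim j) :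
    g.koszulFlip h β y x = (i * j).negOnePow • β x y := by
  simp only [koszulFlip, LinearMap.flip_apply, LinearMap.comp_apply, LinearEquiv.coe_coe,
    g.decomp_of_mem hx, DirectSum.toModule_lof, LinearMap.compl₂_apply, h.twist_of_mem i hy]
  rcases Int.units_eq_one_or (i * j).negOnePow with h | h <;> simp [h, Units.smul_def]

end DimGrading

/-! ### Graded Lie algebras -/

/-- A graded Lie algebra over `F` with underlying vector space `L`: the signs in
anti-commutativity and in the Jacobi identity are those of the dimension grading. (Mathlib's
`GradedLieAlgebra` is a grading of an ordinary Lie algebra, without signs.) -/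
structure GradedLieAlg (F : Type u) (L : Type v) [Field F] [AddCommGroup L] [Module F L]
    extends DimGrading F L where
  bracket : L →ₗ[F] L →ₗ[F] L
  bracket_mem : ∀ {i j : ℤ} {x y : L}, x ∈ dim i → y ∈ dim j → bracket x y ∈ dim (i + j)
  bracket_skew : ∀ {i j : ℤ} {x y : L}, x ∈ dim i → y ∈ dim j →
    bracket x y = -((i * j).negOnePow • bracket y x)
  jacobi : ∀ {i j k : ℤ} {x y z : L}, x ∈ dim i → y ∈ dim j → z ∈ dim k →
    bracket x (bracket y z) =
      bracket (bracket x y) z + (i * j).negOnePow • bracket y (bracket x z)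

namespace GradedLieAlg

variable {F : Type u} [Field F] {L : Type v} [AddCommGroup L] [Module F L]
  {M : Type w} [AddCommGroup M] [Module F M]

/-- `J` is a (graded) Lie subalgebra. -/
structure IsSubalgebra (A : GradedLieAlg F L) (J : Submodule F L) : Prop where
  homogeneous : A.IsHomogeneous J
  bracket_mem : ∀ x ∈ J, ∀ y ∈ J, A.bracket x y ∈ J

/-- A Lie subalgebra, as a graded Lie algebra. -/
def sub (A : GradedLieAlg F L) (J : Submodule F L) (hJ : A.IsSubalgebra J) :
    GradedLieAlg F J where
  toDimGrading := A.toDimGrading.restrict J hJ.homogeneous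
  bracket := LinearMap.mk₂ F (fun x y => ⟨A.bracket x y, hJ.bracket_mem x x.2 y y.2⟩)
    (fun _ _ _ => Subtype.ext (by simp)) (fun _ _ _ => Subtype.ext (by simp))
    (fun _ _ _ => Subtype.ext (by simp)) (fun _ _ _ => Subtype.ext (by simp))
  bracket_mem := fun hx hy => A.bracket_mem hx hy
  bracket_skew := fun hx hy => Subtype.ext (A.bracket_skew hx hy)
  jacobi := fun hx hy hz => Subtype.ext (A.jacobi hx hy hz)

/-- The Lie subalgebra generated by a subset. -/
def lieSpan (A : GradedLieAlg F L) (s : Set L) : Submodule F L :=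
  sInf {J | A.IsSubalgebra J ∧ s ⊆ J}

theorem lieSpan_isSubalgebra (A : GradedLieAlg F L) (s : Set L) :
    A.IsSubalgebra (A.lieSpan s) where
  homogeneous := by
    intro x hx i
    simp only [lieSpan, Submodule.mem_sInf] at hx ⊢
    exact fun J hJ => hJ.1.homogeneous x (hx J hJ) i
  bracket_mem := by
    intro x hx y hy
    simp only [lieSpan, Submodule.mem_sInf] at hx hy ⊢
    exact fun J hJ => hJ.1.bracket_mem x (hx J hJ) y (hy J hJ)

/-- Isomorphisms of graded Lie algebras. -/
structure Iso (A : GradedLieAlg F L) (B : GradedLieAlg F M) extends L ≃ₗ[F] M where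
  map_bracket : ∀ x y, toLinearEquiv (A.bracket x y) =
    B.bracket (toLinearEquiv x) (toLinearEquiv y)
  map_dim : ∀ i, ∀ x ∈ A.dim i, toLinearEquiv x ∈ B.dim i

/-- The commutator bracket `[x, y] = x y - (-1)^(|x||y|) y x` makes a graded associative algebra
into a graded Lie algebra. -/
def ofAlgebra {T : Type w} [Ring T] [Algebra F T] (g : DimGrading F T)
    (hmul : ∀ {i j : ℤ} {x y : T}, x ∈ g.dim i → y ∈ g.dim j → x * y ∈ g.dim (i + j)) :
    GradedLieAlg F T where
  toDimGrading := g
  bracket := LinearMap.mul F T - g.koszulFlip g (LinearMap.mul F T)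
  bracket_mem := by
    intro i j x y hx hy
    rw [LinearMap.sub_apply, LinearMap.sub_apply, g.koszulFlip_of_mem g _ hy hx]
    refine Submodule.sub_mem _ (hmul hx hy) ?_
    rw [Units.smul_def]
    exact zsmul_mem (add_comm j i ▸ hmul hy hx) _
  bracket_skew := by
    intro i j x y hx hy
    simp only [LinearMap.sub_apply, g.koszulFlip_of_mem g _ hy hx, g.koszulFlip_of_mem g _ hx hy,
      LinearMap.mul_apply', mul_comm j i]
    rcases Int.units_eq_one_or (i * j).negOnePow with h | h <;> simp [h, Units.smul_def]
  jacobi := by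
    intro i j k x y z hx hy hz
    simp only [LinearMap.sub_apply, map_sub, g.koszulFlip_of_mem g _ hy hx,
      g.koszulFlip_of_mem g _ hz hx, g.koszulFlip_of_mem g _ hz hy, LinearMap.mul_apply',
      g.koszulFlip_of_mem g _ (hmul hy hz) hx, g.koszulFlip_of_mem g _ hz (hmul hx hy),
      g.koszulFlip_of_mem g _ (hmul hx hz) hy, Units.smul_def, map_zsmul, LinearMap.smul_apply,
      g.koszulFlip_of_mem g _ (hmul hz hy) hx, g.koszulFlip_of_mem g _ hz (hmul hy hx),
      g.koszulFlip_of_mem g _ (hmul hz hx) hy, mul_add, add_mul, Int.negOnePow_add,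
      mul_comm j i, mul_comm k i, mul_comm k j]
    rcases Int.units_eq_one_or (i * j).negOnePow with h | h <;>
    rcases Int.units_eq_one_or (i * k).negOnePow with h' | h' <;>
    rcases Int.units_eq_one_or (j * k).negOnePow with h'' | h'' <;>
    simp [h, h', h'', mul_assoc] <;> abel

/-! ### Free Lie algebras -/

/-- The grading by dimension of the tensor algebra: products `v₁ ⋯ v_k` of homogeneous elements
have dimension `|v₁| + ⋯ + |v_k|`. -/
def tensorDim (g : DimGrading F M) (n : ℤ) : Submodule F (TensorAlgebra F M) :=
  Submodule.span F {a | ∃ l : List (ℤ × M), (∀ p ∈ l, p.2 ∈ g.dim p.1) ∧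
    (l.map Prod.fst).sum = n ∧ a = (l.map fun p => TensorAlgebra.ι F p.2).prod}

theorem tensorDim_mul (g : DimGrading F M) {i j : ℤ} {x y : TensorAlgebra F M}
    (hx : x ∈ tensorDim g i) (hy : y ∈ tensorDim g j) : x * y ∈ tensorDim g (i + j) := by
  have : tensorDim g i * tensorDim g j ≤ tensorDim g (i + j) := by
    rw [tensorDim, tensorDim, Submodule.span_mul_span]
    refine Submodule.span_mono ?_
    rintro _ ⟨_, ⟨l, hl, rfl, rfl⟩, _, ⟨l', hl', rfl, rfl⟩, rfl⟩
    refine ⟨l ++ l', ?_, by simp, by simp⟩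
    intro p hp
    rcases List.mem_append.1 hp with h | h
    exacts [hl p h, hl' p h]
  exact this (Submodule.mul_mem_mul hx hy)

theorem tensorDim_iSup (g : DimGrading F M) : ⨆ n, tensorDim g n = ⊤ := by
  rw [eq_top_iff]
  have hone : (1 : TensorAlgebra F M) ∈ tensorDim g 0 :=
    Submodule.subset_span ⟨[], by simp, by simp, by simp⟩
  intro a _
  induction a using TensorAlgebra.induction with
  | algebraMap r =>
    rw [Algebra.algebraMap_eq_smul_one]
    exact Submodule.smul_mem _ _ (Submodule.mem_iSup_of_mem 0 hone)
  | ι x =>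
    refine g.le_of_dim_le (p := (⨆ n, tensorDim g n).comap (TensorAlgebra.ι F)) ?_ x
    intro i y hy
    exact Submodule.mem_iSup_of_mem i
      (Submodule.subset_span ⟨[(i, y)], by simpa using hy, by simp, by simp⟩)
  | mul a b ha hb =>
    replace ha := ha trivial
    replace hb := hb trivial
    clear * - ha hb
    induction ha using Submodule.iSup_induction' with
    | mem i x hx =>
      induction hb using Submodule.iSup_induction' with
      | mem j y hy => exact Submodule.mem_iSup_of_mem (i + j) (tensorDim_mul g hx hy)
      | zero => simp
      | add y y' _ _ h h' => rw [mul_add]; exact Submodule.add_mem _ h h'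
    | zero => simp
    | add y y' _ _ h h' => rw [add_mul]; exact Submodule.add_mem _ h h'
  | add a b ha hb => exact Submodule.add_mem _ (ha trivial) (hb trivial)

/-- The algebra map `T(M) → T(M)[t, t⁻¹]` sending a homogeneous `v` in `M` to `v t^|v|`. -/
def tensorCoaction (g : DimGrading F M) :
    TensorAlgebra F M →ₐ[F] AddMonoidAlgebra (TensorAlgebra F M) ℤ :=
  TensorAlgebra.lift F
    ((DirectSum.toModule F ℤ (AddMonoidAlgebra (TensorAlgebra F M) ℤ)
      (fun i => (AddMonoidAlgebra.lsingle i : TensorAlgebra F M →ₗ[F] _) ∘ₗ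
        TensorAlgebra.ι F ∘ₗ (g.dim i).subtype)) ∘ₗ g.decomp.toLinearMap)

theorem tensorCoaction_of_mem (g : DimGrading F M) {n : ℤ} {x : TensorAlgebra F M}
    (hx : x ∈ tensorDim g n) : tensorCoaction g x = AddMonoidAlgebra.single n x := by
  have key (n : ℤ) : tensorDim g n ≤ LinearMap.ker
      ((tensorCoaction g).toLinearMap - AddMonoidAlgebra.lsingle n) := by
    rw [tensorDim, Submodule.span_le]
    rintro _ ⟨l, hl, rfl, rfl⟩
    rw [SetLike.mem_coe, LinearMap.mem_ker, LinearMap.sub_apply, sub_eq_zero,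
      AlgHom.toLinearMap_apply, AddMonoidAlgebra.lsingle_apply]
    induction l with
    | nil => rw [List.map_nil, List.prod_nil, map_one]; rfl
    | cons p l ih =>
      have hp : tensorCoaction g (TensorAlgebra.ι F p.2) =
          AddMonoidAlgebra.single p.1 (TensorAlgebra.ι F p.2) := by
        simp only [tensorCoaction, TensorAlgebra.lift_ι_apply, LinearMap.comp_apply,
          LinearEquiv.coe_coe, g.decomp_of_mem (hl p (by simp)), DirectSum.toModule_lof]
        rfl
      rw [List.map_cons, List.map_cons, List.prod_cons, List.sum_cons, map_mul, hp,
        ih (fun q hq => hl q (by simp [hq])), AddMonoidAlgebra.single_mul_single]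
  have := key n hx
  rwa [LinearMap.mem_ker, LinearMap.sub_apply, sub_eq_zero,
      AlgHom.toLinearMap_apply, AddMonoidAlgebra.lsingle_apply] at this

/-- The tensor algebra on a graded vector space is graded by dimension. -/
def tensorGrading (g : DimGrading F M) : DimGrading F (TensorAlgebra F M) :=
  DimGrading.ofProj (tensorDim g)
    (fun i => Finsupp.lapply i ∘ₗ (AddMonoidAlgebra.coeffLinearEquiv F).toLinearMap ∘ₗ
      (tensorCoaction g).toLinearMap)
    (fun i x hx => by
      have := tensorCoaction_of_mem g hx
      simp only [LinearMap.comp_apply, AlgHom.toLinearMap_apply, this]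
      exact Finsupp.single_eq_same)
    (fun i j hij x hx => by
      have := tensorCoaction_of_mem g hx
      simp only [LinearMap.comp_apply, AlgHom.toLinearMap_apply, this]
      exact Finsupp.single_eq_of_ne hij)
    (tensorDim_iSup g)

/-- The tensor algebra `T(M)` with the commutator bracket. -/
def tensorLie (g : DimGrading F M) : GradedLieAlg F (TensorAlgebra F M) :=
  ofAlgebra (tensorGrading g) (tensorDim_mul g)

/-- The Lie subalgebra of `T(M)` generated by `M`. -/
def freeLieSubmodule (g : DimGrading F M) : Submodule F (TensorAlgebra F M) :=
  (tensorLie g).lieSpan (Set.range (TensorAlgebra.ι F))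

/-- The free Lie algebra `𝕃M` on the graded vector space `M`. -/
def freeLie (g : DimGrading F M) : GradedLieAlg F (freeLieSubmodule g) :=
  (tensorLie g).sub _ ((tensorLie g).lieSpan_isSubalgebra _)

/-- The component of degree `k` (word length) of `𝕃M`, i.e. `𝕃M ∩ T^k(M)`. -/
def freeLieDegree (g : DimGrading F M) : ℤ → Submodule F (freeLieSubmodule g)
  | Int.ofNat k => (LinearMap.range (TensorAlgebra.ι F : M →ₗ[F] _) ^ k).comap
      (freeLieSubmodule g).subtype
  | Int.negSucc _ => ⊥

/-- A graded Lie algebra is free if it is isomorphic to `𝕃W` for a graded vector space `W`. -/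
def IsFree (A : GradedLieAlg F L) : Prop :=
  ∃ (W : Type v) (_ : AddCommGroup W) (_ : Module F W) (g : DimGrading F W),
    Nonempty (A.Iso (freeLie g))

/-! ### Semi-direct products -/

/-- An action of the graded Lie algebra `A` on the graded Lie algebra `B` by derivations: `B` is
an `A`-module, and the Jacobi identity holds for an element of `A` and two elements of `B`. -/
structure Action (A : GradedLieAlg F L) (B : GradedLieAlg F M) where
  act : L →ₗ[F] M →ₗ[F] M
  act_mem : ∀ {i j : ℤ} {x : L} {y : M}, x ∈ A.dim i → y ∈ B.dim j → act x y ∈ B.dim (i + j)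
  act_act : ∀ {i j : ℤ} {x₁ x₂ : L}, x₁ ∈ A.dim i → x₂ ∈ A.dim j → ∀ y : M,
    act x₁ (act x₂ y) = act (A.bracket x₁ x₂) y + (i * j).negOnePow • act x₂ (act x₁ y)
  act_bracket : ∀ {i j : ℤ} {x : L} {y : M}, x ∈ A.dim i → y ∈ B.dim j → ∀ z : M,
    act x (B.bracket y z) = B.bracket (act x y) z + (i * j).negOnePow • B.bracket y (act x z)

/-- The product grading of `L × M`. -/
def prodGrading (g : DimGrading F L) (h : DimGrading F M) : DimGrading F (L × M) :=
  DimGrading.ofProj (fun i => (g.dim i).prod (h.dim i))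
    (fun i => (g.proj i).prodMap (h.proj i))
    (fun _ x hx => Prod.ext (g.proj_of_mem hx.1) (h.proj_of_mem hx.2))
    (fun _ _ hij x hx => Prod.ext (g.proj_of_mem_ne hij hx.1) (h.proj_of_mem_ne hij hx.2))
    (by
      rw [eq_top_iff]
      rintro ⟨x, y⟩ -
      have h1 := g.le_of_dim_le (p := (⨆ i, (g.dim i).prod (h.dim i)).comap (LinearMap.inl F L M))
        (fun i x hx => Submodule.mem_iSup_of_mem i ⟨hx, Submodule.zero_mem _⟩) x
      have h2 := h.le_of_dim_le (p := (⨆ i, (g.dim i).prod (h.dim i)).comap (LinearMap.inr F L M))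
        (fun i x hx => Submodule.mem_iSup_of_mem i ⟨Submodule.zero_mem _, hx⟩) y
      have h3 := Submodule.add_mem _ (Submodule.mem_comap.1 h1) (Submodule.mem_comap.1 h2)
      simpa using h3)

/-- The bracket of the semi-direct product:
`[(a, x), (b, y)] = ([a, b], [x, y] + a · y - (-1)^(|b||x|) b · x)`. -/
def sdpBracket {A : GradedLieAlg F L} {B : GradedLieAlg F M} (ρ : Action A B) :
    L × M →ₗ[F] L × M →ₗ[F] L × M :=
  (A.bracket.compl₁₂ (LinearMap.fst F L M) (LinearMap.fst F L M)).compr₂ (LinearMap.inl F L M) +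
  (B.bracket.compl₁₂ (LinearMap.snd F L M) (LinearMap.snd F L M) +
    ρ.act.compl₁₂ (LinearMap.fst F L M) (LinearMap.snd F L M) -
    (A.koszulFlip B.toDimGrading ρ.act).compl₁₂
      (LinearMap.snd F L M) (LinearMap.fst F L M)).compr₂ (LinearMap.inr F L M)

theorem sdpBracket_of_mem {A : GradedLieAlg F L} {B : GradedLieAlg F M} (ρ : Action A B)
    {i j : ℤ} {p q : L × M} (hp : p.2 ∈ B.dim i) (hq : q.1 ∈ A.dim j) :
    sdpBracket ρ p q = (A.bracket p.1 q.1,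
      B.bracket p.2 q.2 + ρ.act p.1 q.2 - (i * j).negOnePow • ρ.act q.1 p.2) := by
  have := A.koszulFlip_of_mem B.toDimGrading ρ.act hq hp
  simp [sdpBracket, this, mul_comm i j]

/-- The semi-direct product `A ⋊ B`. -/
def sdp {A : GradedLieAlg F L} {B : GradedLieAlg F M} (ρ : Action A B) :
    GradedLieAlg F (L × M) where
  toDimGrading := prodGrading A.toDimGrading B.toDimGrading
  bracket := sdpBracket ρ
  bracket_mem := by
    intro i j p q hp hq
    rw [sdpBracket_of_mem ρ hp.2 hq.1]
    refine ⟨A.bracket_mem hp.1 hq.1, Submodule.sub_mem _ (Submodule.add_mem _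
      (B.bracket_mem hp.2 hq.2) (ρ.act_mem hp.1 hq.2)) ?_⟩
    rw [Units.smul_def]
    exact zsmul_mem (add_comm j i ▸ ρ.act_mem hq.1 hp.2) _
  bracket_skew := by
    intro i j p q hp hq
    rw [sdpBracket_of_mem ρ hp.2 hq.1, sdpBracket_of_mem ρ hq.2 hp.1,
      A.bracket_skew hp.1 hq.1, B.bracket_skew hp.2 hq.2, mul_comm j i]
    rcases Int.units_eq_one_or (i * j).negOnePow with h | h <;>
      ext <;> simp [h, Units.smul_def] <;> abel
  jacobi := by
    intro i j k p q r hp hq hr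
    have hqr := B.bracket_mem hq.2 hr.2
    have e1 : (sdpBracket ρ q r).1 = A.bracket q.1 r.1 := by rw [sdpBracket_of_mem ρ hq.2 hr.1]
    have m2 : (sdpBracket ρ p q).2 ∈ B.dim (i + j) := by
      rw [sdpBracket_of_mem ρ hp.2 hq.1]
      refine Submodule.sub_mem _ (Submodule.add_mem _
        (B.bracket_mem hp.2 hq.2) (ρ.act_mem hp.1 hq.2)) ?_
      rw [Units.smul_def]
      exact zsmul_mem (add_comm j i ▸ ρ.act_mem hq.1 hp.2) _
    have e3 : (sdpBracket ρ p r).1 = A.bracket p.1 r.1 := by rw [sdpBracket_of_mem ρ hp.2 hr.1]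
    rw [sdpBracket_of_mem ρ (q := sdpBracket ρ q r) hp.2
        (by rw [e1]; exact A.bracket_mem hq.1 hr.1),
      sdpBracket_of_mem ρ (p := sdpBracket ρ p q) m2 hr.1,
      sdpBracket_of_mem ρ (q := sdpBracket ρ p r) hq.2
        (by rw [e3]; exact A.bracket_mem hp.1 hr.1),
      sdpBracket_of_mem ρ hq.2 hr.1, sdpBracket_of_mem ρ hp.2 hq.1,
      sdpBracket_of_mem ρ hp.2 hr.1]
    refine Prod.ext (A.jacobi hp.1 hq.1 hr.1) ?_
    have b1 := B.jacobi hp.2 hq.2 hr.2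
    have f1 := ρ.act_bracket hp.1 hq.2 r.2
    have f2 := ρ.act_act hp.1 hq.1 r.2
    have f3 := ρ.act_act hq.1 hr.1 p.2
    have f4 := ρ.act_bracket hq.1 hp.2 r.2
    have f5 := ρ.act_bracket hr.1 hp.2 q.2
    have f6 := B.bracket_skew (ρ.act_mem hr.1 hp.2) hq.2
    have f7 := ρ.act_act hp.1 hr.1 q.2
    simp only [Prod.snd_add, Prod.smul_snd, map_add, map_sub, LinearMap.add_apply,
      LinearMap.sub_apply, Units.smul_def, map_zsmul, LinearMap.smul_apply, smul_add, smul_sub,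
      mul_add, add_mul, Int.negOnePow_add, mul_comm j i, mul_comm k i, mul_comm k j]
      at b1 f1 f2 f3 f4 f5 f6 f7 ⊢
    rcases Int.units_eq_one_or (i * j).negOnePow with h | h <;>
    rcases Int.units_eq_one_or (i * k).negOnePow with h' | h' <;>
    rcases Int.units_eq_one_or (j * k).negOnePow with h'' | h'' <;>
    simp only [h, h', h'', mul_one, Units.val_one, Units.val_neg, mul_neg,
      neg_neg, one_smul, neg_smul] at b1 f1 f2 f3 f4 f5 f6 f7 ⊢ <;>
    (simp only [b1, f1, f2, f3, f4, f5, f6, f7]; abel)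

/-- The component of degree `k` of `A ⋊ 𝕃M`, where `A` is in degree `0` and `M` in degree `1`. -/
def sdpDegree {A : GradedLieAlg F L} {g : DimGrading F M} (_ρ : Action A (freeLie g)) (k : ℤ) :
    Submodule F (L × freeLieSubmodule g) :=
  (if k = 0 then ⊤ else ⊥ : Submodule F L).prod (freeLieDegree g k)

/-! ### Filtrations and associated graded Lie algebras -/

/-- An increasing exhaustive filtration of a graded Lie algebra by graded subspaces, compatible
with the bracket. -/
structure Filtration (A : GradedLieAlg F L) where
  fil : ℤ → Submodule F L
  mono : Monotone fil
  homogeneous : ∀ k, A.IsHomogeneous (fil k)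
  bracket_mem : ∀ {k l : ℤ} {x y : L}, x ∈ fil k → y ∈ fil l → A.bracket x y ∈ fil (k + l)
  exhaustive : ∀ x : L, ∃ k, x ∈ fil k

namespace Filtration

variable {A : GradedLieAlg F L} (Φ : Filtration A)

theorem isSubalgebra_zero : A.IsSubalgebra (Φ.fil 0) where
  homogeneous := Φ.homogeneous 0
  bracket_mem := fun _ hx _ hy => Φ.bracket_mem (k := 0) (l := 0) hx hy

/-- The Lie subalgebra `F_0 L`. -/
def zeroLie : GradedLieAlg F (Φ.fil 0) := A.sub (Φ.fil 0) Φ.isSubalgebra_zero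

/-- `F_{k-1} L` as a subspace of `F_k L`. -/
def prev (k : ℤ) : Submodule F (Φ.fil k) := (Φ.fil (k - 1)).comap (Φ.fil k).subtype

/-- `gr_k L = F_k L / F_{k-1} L`. -/
abbrev Piece (k : ℤ) : Type v := Φ.fil k ⧸ Φ.prev k

/-- The grading by dimension of `F_k L / F_{k-1} L`. -/
def pieceGrading (k : ℤ) : DimGrading F (Φ.Piece k) :=
  (A.restrict (Φ.fil k) (Φ.homogeneous k)).quotient (Φ.prev k) (by
    intro x hx i
    have h : (((A.restrict (Φ.fil k) (Φ.homogeneous k)).proj i x : Φ.fil k) : L) =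
        A.proj i x := by
      refine (A.restrict (Φ.fil k) (Φ.homogeneous k)).le_of_dim_le
        (p := LinearMap.ker ((Φ.fil k).subtype ∘ₗ
          (A.restrict (Φ.fil k) (Φ.homogeneous k)).proj i -
            A.proj i ∘ₗ (Φ.fil k).subtype)) ?_ x |> fun h => sub_eq_zero.1 h
      intro j y hy
      have hy' : (y : L) ∈ A.dim j := hy
      rw [LinearMap.mem_ker, LinearMap.sub_apply, LinearMap.comp_apply, LinearMap.comp_apply,
        sub_eq_zero]
      by_cases hij : i = j
      · subst hij
        rw [DimGrading.proj_of_mem _ hy, Submodule.subtype_apply, A.proj_of_mem hy']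
      · rw [DimGrading.proj_of_mem_ne _ hij hy, Submodule.subtype_apply, Submodule.subtype_apply,
          A.proj_of_mem_ne hij hy']
        rfl
    change ((A.restrict (Φ.fil k) (Φ.homogeneous k)).proj i x : L) ∈ Φ.fil (k - 1)
    rw [h]
    exact Φ.homogeneous (k - 1) x hx i)

/-- `gr(L) = ⨁_k F_k L / F_{k-1} L`. -/
def Gr : Type v := ⨁ k : ℤ, Φ.Piece k

instance : AddCommGroup Φ.Gr := inferInstanceAs (AddCommGroup (⨁ k : ℤ, Φ.Piece k))

instance : Module F Φ.Gr := inferInstanceAs (Module F (⨁ k : ℤ, Φ.Piece k))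

/-- The inclusion `gr_k L → gr(L)`. -/
def ofPiece (k : ℤ) : Φ.Piece k →ₗ[F] Φ.Gr := DirectSum.lof F ℤ Φ.Piece k

/-- A family of linear maps on the `gr_k L` defines a linear map on `gr(L)`. -/
def liftGr {N : Type*} [AddCommGroup N] [Module F N] (f : ∀ k, Φ.Piece k →ₗ[F] N) :
    Φ.Gr →ₗ[F] N := DirectSum.toModule F ℤ N f

theorem liftGr_ofPiece {N : Type*} [AddCommGroup N] [Module F N] (f : ∀ k, Φ.Piece k →ₗ[F] N)
    (k : ℤ) (x : Φ.Piece k) : Φ.liftGr f (Φ.ofPiece k x) = f k x :=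
  DirectSum.toModule_lof F (φ := f) k x

theorem gr_induction {p : Submodule F Φ.Gr} (h : ∀ k y, Φ.ofPiece k y ∈ p) (z : Φ.Gr) :
    z ∈ p := by
  change ⨁ k : ℤ, Φ.Piece k at z
  induction z using DirectSum.induction_on with
  | zero => exact Submodule.zero_mem p
  | of k y => exact h k y
  | add z z' hz hz' => exact Submodule.add_mem p hz hz'

/-- The class in `gr_k L` of an element of `F_k L`. -/
def symb (k : ℤ) : Φ.fil k →ₗ[F] Φ.Gr :=
  Φ.ofPiece k ∘ₗ (Φ.prev k).mkQ

/-- The component of dimension `i` of `gr(L)`. -/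
def grDim (i : ℤ) : Submodule F Φ.Gr :=
  ⨆ k, ((Φ.pieceGrading k).dim i).map (Φ.ofPiece k)

/-- The component of degree `k` of `gr(L)`, that is, `gr_k L`. -/
def grDegree (k : ℤ) : Submodule F Φ.Gr := LinearMap.range (Φ.ofPiece k)

theorem grDim_induction {i : ℤ} {motive : Φ.Gr → Prop} {z : Φ.Gr} (hz : z ∈ Φ.grDim i)
    (symb : ∀ (k : ℤ) (x : L) (hx : x ∈ Φ.fil k), x ∈ A.dim i → motive (Φ.symb k ⟨x, hx⟩))
    (zero : motive 0) (add : ∀ z z', motive z → motive z' → motive (z + z')) : motive z := by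
  refine Submodule.iSup_induction _ (motive := motive) hz ?_ zero add
  rintro k _ ⟨_, ⟨x, hx, rfl⟩, rfl⟩
  exact symb k x x.2 hx

theorem symb_mem_grDim {i k : ℤ} {x : L} (hx : x ∈ Φ.fil k) (hi : x ∈ A.dim i) :
    Φ.symb k ⟨x, hx⟩ ∈ Φ.grDim i :=
  Submodule.mem_iSup_of_mem k ⟨_, ⟨⟨x, hx⟩, hi, rfl⟩, rfl⟩

/-- The grading by dimension of `gr(L)`. -/
def grGrading : DimGrading F Φ.Gr :=
  DimGrading.ofProj Φ.grDim
    (fun i => Φ.liftGr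
      (fun k => Φ.ofPiece k ∘ₗ (Φ.pieceGrading k).proj i))
    (by
      intro i x hx
      have : Φ.grDim i ≤ LinearMap.eqLocus (Φ.liftGr
          (fun k => Φ.ofPiece k ∘ₗ (Φ.pieceGrading k).proj i)) LinearMap.id := by
        refine iSup_le fun k => ?_
        rintro _ ⟨y, hy, rfl⟩
        rw [LinearMap.mem_eqLocus, liftGr_ofPiece, LinearMap.comp_apply,
          DimGrading.proj_of_mem _ hy]
        rfl
      exact this hx)
    (by
      intro i j hij x hx
      have : Φ.grDim j ≤ LinearMap.ker (Φ.liftGr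
          (fun k => Φ.ofPiece k ∘ₗ (Φ.pieceGrading k).proj i)) := by
        refine iSup_le fun k => ?_
        rintro _ ⟨y, hy, rfl⟩
        rw [LinearMap.mem_ker, liftGr_ofPiece, LinearMap.comp_apply,
          DimGrading.proj_of_mem_ne _ hij hy, map_zero]
      exact this hx)
    (by
      rw [eq_top_iff]
      intro z _
      refine Φ.gr_induction (fun k y => ?_) z
      exact (Φ.pieceGrading k).le_of_dim_le (p := (⨆ i, Φ.grDim i).comap (Φ.ofPiece k))
        (fun i y hy => Submodule.mem_iSup_of_mem i (Submodule.mem_iSup_of_mem k ⟨y, hy, rfl⟩)) y)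

/-- The bracket `F_k L × F_l L → gr_{k+l} L`. -/
def preBracket (k l : ℤ) : Φ.fil k →ₗ[F] Φ.fil l →ₗ[F] Φ.Piece (k + l) :=
  (LinearMap.mk₂ F (fun (x : Φ.fil k) (y : Φ.fil l) =>
      (⟨A.bracket x y, Φ.bracket_mem x.2 y.2⟩ : Φ.fil (k + l)))
    (fun _ _ _ => Subtype.ext (by simp)) (fun _ _ _ => Subtype.ext (by simp))
    (fun _ _ _ => Subtype.ext (by simp)) (fun _ _ _ => Subtype.ext (by simp))).compr₂
    (Φ.prev (k + l)).mkQ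

theorem preBracket_left (k l : ℤ) (x : Φ.fil k) (hx : x ∈ Φ.prev k) (y : Φ.fil l) :
    Φ.preBracket k l x y = 0 := by
  refine (Submodule.Quotient.mk_eq_zero _).2 ?_
  have h := Φ.bracket_mem (k := k - 1) hx y.2
  rwa [show k - 1 + l = k + l - 1 by ring] at h

theorem preBracket_right (k l : ℤ) (x : Φ.fil k) (y : Φ.fil l) (hy : y ∈ Φ.prev l) :
    Φ.preBracket k l x y = 0 := by
  refine (Submodule.Quotient.mk_eq_zero _).2 ?_
  have h := Φ.bracket_mem (l := l - 1) x.2 hy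
  rwa [show k + (l - 1) = k + l - 1 by ring] at h

/-- The bracket `gr_k L × gr_l L → gr_{k+l} L`. -/
def pieceBracket (k l : ℤ) : Φ.Piece k →ₗ[F] Φ.Piece l →ₗ[F] Φ.Piece (k + l) :=
  ((Φ.prev l).liftQ
    ((Φ.prev k).liftQ (Φ.preBracket k l)
      (fun x hx => LinearMap.ext fun y => Φ.preBracket_left k l x hx y)).flip
    (fun y hy => LinearMap.ext fun z => by
      induction z using Submodule.Quotient.induction_on with
      | H x => exact Φ.preBracket_right k l x y hy)).flip

/-- The bracket of `gr(L)`. -/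
def grBracket : Φ.Gr →ₗ[F] Φ.Gr →ₗ[F] Φ.Gr :=
  Φ.liftGr fun k =>
    (Φ.liftGr fun l =>
      ((Φ.pieceBracket k l).compr₂ (Φ.ofPiece (k + l))).flip).flip

theorem grBracket_symb {k l : ℤ} {x y : L} (hx : x ∈ Φ.fil k) (hy : y ∈ Φ.fil l) :
    Φ.grBracket (Φ.symb k ⟨x, hx⟩) (Φ.symb l ⟨y, hy⟩) =
      Φ.symb (k + l) ⟨A.bracket x y, Φ.bracket_mem hx hy⟩ := by
  simp only [grBracket, symb, LinearMap.comp_apply, liftGr_ofPiece, LinearMap.flip_apply]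
  rfl

theorem symb_congr {k l : ℤ} (h : k = l) {x y : L} (hxy : x = y) (hx : x ∈ Φ.fil k)
    (hy : y ∈ Φ.fil l) : Φ.symb k ⟨x, hx⟩ = Φ.symb l ⟨y, hy⟩ := by
  subst h hxy
  rfl

theorem symb_neg_sign {k : ℤ} (e : ℤˣ) {x : L} (hx : x ∈ Φ.fil k) :
    Φ.symb k ⟨-(e • x), neg_mem (sign_smul_mem e hx)⟩ = -(e • Φ.symb k ⟨x, hx⟩) := by
  have h := map_sign_smul (Φ.symb k) e ⟨x, hx⟩
  exact (map_neg (Φ.symb k) (e • ⟨x, hx⟩)).trans (congrArg (fun z => -z) h)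

theorem symb_add_sign {k : ℤ} (e : ℤˣ) {x y : L} (hx : x ∈ Φ.fil k) (hy : y ∈ Φ.fil k) :
    Φ.symb k ⟨x + e • y, add_mem hx (sign_smul_mem e hy)⟩ =
      Φ.symb k ⟨x, hx⟩ + e • Φ.symb k ⟨y, hy⟩ := by
  have h := map_sign_smul (Φ.symb k) e ⟨y, hy⟩
  exact (map_add (Φ.symb k) ⟨x, hx⟩ (e • ⟨y, hy⟩)).trans (congrArg (Φ.symb k ⟨x, hx⟩ + ·) h)

/-- The associated graded Lie algebra `gr(L)`. -/
def gr : GradedLieAlg F Φ.Gr where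
  toDimGrading := Φ.grGrading
  bracket := Φ.grBracket
  bracket_mem := by
    intro i j z w hz hw
    refine Φ.grDim_induction (motive := fun z => Φ.grBracket z w ∈ Φ.grDim (i + j)) hz
      (fun k x hx hi => ?_) (by simp)
      (fun z z' h h' => by simpa using Submodule.add_mem _ h h')
    refine Φ.grDim_induction (motive := fun w => Φ.grBracket (Φ.symb k ⟨x, hx⟩) w ∈ Φ.grDim (i + j)) hw
      (fun l y hy hj => ?_) (by simp)
      (fun z z' h h' => by simpa using Submodule.add_mem _ h h')
    rw [Φ.grBracket_symb hx hy]
    exact Φ.symb_mem_grDim _ (A.bracket_mem hi hj)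
  bracket_skew := by
    intro i j z w hz hw
    refine Φ.grDim_induction (motive := fun z => Φ.grBracket z w =
      -((i * j).negOnePow • Φ.grBracket w z)) hz (fun k x hx hi => ?_) (by simp)
      (fun z z' h h' => by
        rw [map_add, LinearMap.add_apply, h, h', map_add]
        exact (neg_sign_smul_add _ _ _).symm)
    refine Φ.grDim_induction (motive := fun w => Φ.grBracket (Φ.symb k ⟨x, hx⟩) w =
      -((i * j).negOnePow • Φ.grBracket w (Φ.symb k ⟨x, hx⟩))) hw (fun l y hy hj => ?_) (by simp)
      (fun z z' h h' => by
        rw [map_add, h, h', map_add, LinearMap.add_apply]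
        exact (neg_sign_smul_add _ _ _).symm)
    rw [Φ.grBracket_symb hx hy, Φ.grBracket_symb hy hx]
    refine (Φ.symb_congr (add_comm k l) (A.bracket_skew hi hj) _
      (neg_mem (sign_smul_mem _ (Φ.bracket_mem hy hx)))).trans ?_
    exact Φ.symb_neg_sign _ (Φ.bracket_mem hy hx)
  jacobi := by
    intro i j k z w v hz hw hv
    refine Φ.grDim_induction (motive := fun z => Φ.grBracket z (Φ.grBracket w v) =
      Φ.grBracket (Φ.grBracket z w) v +
        (i * j).negOnePow • Φ.grBracket w (Φ.grBracket z v)) hz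
      (fun a x hx hi => ?_) (by simp)
      (fun z z' h h' => by simp only [map_add, LinearMap.add_apply, h, h', smul_add]; abel)
    refine Φ.grDim_induction (motive := fun w => Φ.grBracket (Φ.symb a ⟨x, hx⟩) (Φ.grBracket w v) =
      Φ.grBracket (Φ.grBracket (Φ.symb a ⟨x, hx⟩) w) v +
        (i * j).negOnePow • Φ.grBracket w (Φ.grBracket (Φ.symb a ⟨x, hx⟩) v)) hw
      (fun b y hy hj => ?_) (by simp)
      (fun z z' h h' => by simp only [map_add, LinearMap.add_apply, h, h', smul_add]; abel)
    refine Φ.grDim_induction (motive := fun v => Φ.grBracket (Φ.symb a ⟨x, hx⟩)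
        (Φ.grBracket (Φ.symb b ⟨y, hy⟩) v) =
      Φ.grBracket (Φ.grBracket (Φ.symb a ⟨x, hx⟩) (Φ.symb b ⟨y, hy⟩)) v +
        (i * j).negOnePow • Φ.grBracket (Φ.symb b ⟨y, hy⟩)
          (Φ.grBracket (Φ.symb a ⟨x, hx⟩) v)) hv
      (fun c t ht hk => ?_) (by simp)
      (fun z z' h h' => by simp only [map_add, h, h', smul_add]; abel)
    have hxyt := Φ.bracket_mem hx (Φ.bracket_mem hy ht)
    have hxy_t := Φ.bracket_mem (Φ.bracket_mem hx hy) ht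
    have hyxt := Φ.bracket_mem hy (Φ.bracket_mem hx ht)
    have e : b + (a + c) = a + b + c := by ring
    rw [Φ.grBracket_symb hy ht, Φ.grBracket_symb hx (Φ.bracket_mem hy ht),
      Φ.grBracket_symb hx hy, Φ.grBracket_symb (Φ.bracket_mem hx hy) ht,
      Φ.grBracket_symb hx ht, Φ.grBracket_symb hy (Φ.bracket_mem hx ht),
      Φ.symb_congr e rfl hyxt (e ▸ hyxt)]
    refine (Φ.symb_congr (add_assoc a b c).symm (A.jacobi hi hj hk) _
      (add_mem hxy_t (sign_smul_mem _ (e ▸ hyxt)))).trans ?_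
    exact Φ.symb_add_sign _ hxy_t (e ▸ hyxt)

end Filtration

end GradedLieAlg
end

/-!
A graded Lie subalgebra `J` that meets `F_0 L` trivially inherits the filtration of `L`. The
symbols of its elements have positive degree, so they embed the associated graded Lie algebra
of `J` into the free Lie algebra `𝕃V₁`, as a subalgebra that is graded by dimension and by word
length (`Filtration.exists_freeSymbol_sub`). It remains to show that a Lie algebra with such
symbols is free (`FreeSymbol.isFree`). All arguments take place in tensor algebras; neither
enveloping algebras nor the Poincaré-Birkhoff-Witt theorem are needed.

Let `T` be the tensor algebra on `V = V₁` and `T_+` its augmentation ideal. A family in `T` is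
called right-independent if it is linearly independent over `Tᵐᵒᵖ`, that is, if it is a basis of
a free right ideal. The main property of a bigraded Lie subalgebra `J` of `𝕃V` is

  `J ⊓ J * T_+ ≤ [J, J]`  (`inf_mul_augIdeal_le_derived`).

It is clear when `J` is generated by a right-independent family, as is `𝕃V` itself
(`IsRightFree.inf_mul_ker_le`). In general `J` is approximated from above. One may work inside
`𝕃V'` with `V'` finite-dimensional, and then descend from `𝕃V'` by a sequence of graded ideals of
codimension one, until a subalgebra is reached that agrees with `J` up to a given length. Every
step preserves generation by a right-independent family (`IsRightFree.inf_ker`). This is Lie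
algebra elimination: removing a generator `y` of even dimension replaces each other generator `x`
by all iterated brackets `[y, [y, ..., [y, x]]]`, while removing `y` of odd dimension replaces the
generators by the elements `x`, `[y, x]` and `[y, y]`; here `2` has to be invertible.

The main property implies that elements of `J` that are linearly independent modulo `[J, J]` are
right-independent (`linearIndependent_mulOpposite_of_mkQ`), and therefore generate a free
associative algebra (`injective_of_linearIndependent_mulOpposite`).

Return to a Lie algebra `A` with symbols in `𝕃V`. Choose elements `w` of `A` whose symbols form a
basis of the indecomposables of the associated graded Lie algebra, and let `W` be their span. Let
`Γ` be the Lie subalgebra of `A × T(W)` generated by the pairs `(w, w)`. It projects onto `A` and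
onto `𝕃W`, so it suffices that both projections are injective on `Γ`.

* If `(z, 0) ∈ Γ` then `z = 0` (`eq_zero_of_mem_graph`). Since the adjoint representation of `A`
  extends to an action of `T(W)` on `A`, such a `z` is central. If there are at least two
  generators, the center is zero by right-independence of their symbols. If there is at most one
  generator `u`, then `Γ` is at most two-dimensional because `[u, [u, u]] = 0`; here `3` has to be
  invertible.
* If `(0, a) ∈ Γ` then `a = 0` (`eq_zero_of_mem_graph_of_fst`). As `Γ` is the sum of its subspaces
  of pairs `(z, a)` of weight `n`, for which the image of `a` under the injective map
  `T(W) → T` is the symbol of `z`, this follows by induction on the weight from the first point.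
-/

/-! ### Homogeneous subspaces and Lie spans -/

namespace DimGrading

variable {F : Type u} [Field F] {M : Type v} [AddCommGroup M] [Module F M]

theorem mem_of_proj_mem (g : DimGrading F M) {p : Submodule F M} {x : M}
    (h : ∀ i, g.proj i x ∈ p) : x ∈ p := by
  obtain ⟨s, hs⟩ := g.exists_sum_proj x
  rw [hs]
  exact Submodule.sum_mem _ fun i _ => h i

theorem ext_of_mem_dim (g : DimGrading F M) {N : Type w} [AddCommGroup N] [Module F N]
    {f f' : M →ₗ[F] N} (h : ∀ i, ∀ x ∈ g.dim i, f x = f' x) : f = f' := by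
  ext x
  exact g.le_of_dim_le (p := LinearMap.eqLocus f f') (fun i y hy => h i y hy) x

theorem isHomogeneous_span (g : DimGrading F M) {s : Set M} (hs : ∀ x ∈ s, ∃ d, x ∈ g.dim d) :
    g.IsHomogeneous (Submodule.span F s) := by
  intro x hx i
  induction hx using Submodule.span_induction with
  | mem x hx =>
    obtain ⟨d, hd⟩ := hs x hx
    by_cases h : i = d
    · subst h
      rw [g.proj_of_mem hd]
      exact Submodule.subset_span hx
    · rw [g.proj_of_mem_ne h hd]
      exact Submodule.zero_mem _
  | zero => rw [map_zero]; exact Submodule.zero_mem _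
  | add x y _ _ hx hy => rw [map_add]; exact Submodule.add_mem _ hx hy
  | smul c x _ hx => rw [map_smul]; exact Submodule.smul_mem _ _ hx

theorem IsHomogeneous.le_span {g : DimGrading F M} {p : Submodule F M} (hp : g.IsHomogeneous p) :
    p ≤ Submodule.span F {x | x ∈ p ∧ ∃ d, x ∈ g.dim d} := fun x hx =>
  g.mem_of_proj_mem fun i => Submodule.subset_span ⟨hp x hx i, i, g.proj_mem i x⟩

theorem isHomogeneous_of_le_span (g : DimGrading F M) {p : Submodule F M}
    (hp : p ≤ Submodule.span F {x | x ∈ p ∧ ∃ d, x ∈ g.dim d}) : g.IsHomogeneous p := by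
  have h : p = Submodule.span F {x | x ∈ p ∧ ∃ d, x ∈ g.dim d} :=
    le_antisymm hp (Submodule.span_le.2 fun x hx => hx.1)
  rw [h]
  exact g.isHomogeneous_span fun x hx => hx.2

theorem IsHomogeneous.inf {g : DimGrading F M} {p q : Submodule F M} (hp : g.IsHomogeneous p)
    (hq : g.IsHomogeneous q) : g.IsHomogeneous (p ⊓ q) :=
  fun x hx i => ⟨hp x hx.1 i, hq x hx.2 i⟩

theorem IsHomogeneous.iSup {g : DimGrading F M} {ι : Sort*} {p : ι → Submodule F M}
    (hp : ∀ i, g.IsHomogeneous (p i)) : g.IsHomogeneous (⨆ i, p i) := by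
  intro x hx d
  have : (⨆ i, p i) ≤ (⨆ i, p i).comap (g.proj d) :=
    iSup_le fun i y hy => le_iSup p i (hp i y hy d)
  exact this hx

theorem proj_map_of_map_dim (g : DimGrading F M) {N : Type w} [AddCommGroup N] [Module F N]
    (h : DimGrading F N) (f : M →ₗ[F] N) (hf : ∀ i, ∀ x ∈ g.dim i, f x ∈ h.dim i) (i : ℤ) (x : M) :
    h.proj i (f x) = f (g.proj i x) := by
  have : h.proj i ∘ₗ f = f ∘ₗ g.proj i := by
    refine g.ext_of_mem_dim fun j y hy => ?_
    simp only [LinearMap.comp_apply]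
    by_cases hij : i = j
    · subst hij
      rw [g.proj_of_mem hy, h.proj_of_mem (hf _ _ hy)]
    · rw [g.proj_of_mem_ne hij hy, h.proj_of_mem_ne hij (hf _ _ hy), map_zero]
  exact LinearMap.congr_fun this x

theorem IsHomogeneous.map {g : DimGrading F M} {N : Type w} [AddCommGroup N] [Module F N]
    {h : DimGrading F N} {f : M →ₗ[F] N} (hf : ∀ i, ∀ x ∈ g.dim i, f x ∈ h.dim i)
    {p : Submodule F M} (hp : g.IsHomogeneous p) : h.IsHomogeneous (p.map f) := by
  rintro _ ⟨x, hx, rfl⟩ i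
  rw [proj_map_of_map_dim g h f hf]
  exact ⟨_, hp x hx i, rfl⟩

theorem IsHomogeneous.comap {g : DimGrading F M} {N : Type w} [AddCommGroup N] [Module F N]
    {h : DimGrading F N} {f : M →ₗ[F] N} (hf : ∀ i, ∀ x ∈ g.dim i, f x ∈ h.dim i)
    {p : Submodule F N} (hp : h.IsHomogeneous p) : g.IsHomogeneous (p.comap f) := by
  intro x hx i
  rw [Submodule.mem_comap, ← proj_map_of_map_dim g h f hf]
  exact hp _ hx i

end DimGrading

namespace GradedLieAlg

variable {F : Type u} [Field F] {L : Type v} [AddCommGroup L] [Module F L]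

theorem subset_lieSpan (A : GradedLieAlg F L) (s : Set L) : s ⊆ A.lieSpan s := by
  intro x hx
  simp only [lieSpan, SetLike.mem_coe, Submodule.mem_sInf]
  exact fun J hJ => hJ.2 hx

theorem lieSpan_le (A : GradedLieAlg F L) {s : Set L} {J : Submodule F L} (hJ : A.IsSubalgebra J)
    (hs : s ⊆ J) : A.lieSpan s ≤ J :=
  sInf_le ⟨hJ, hs⟩

theorem lieSpan_mono (A : GradedLieAlg F L) {s t : Set L} (h : s ⊆ t) :
    A.lieSpan s ≤ A.lieSpan t :=
  A.lieSpan_le (A.lieSpan_isSubalgebra t) (h.trans (A.subset_lieSpan t))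

theorem IsSubalgebra.inf {A : GradedLieAlg F L} {J K : Submodule F L} (hJ : A.IsSubalgebra J)
    (hK : A.IsSubalgebra K) : A.IsSubalgebra (J ⊓ K) where
  homogeneous := hJ.homogeneous.inf hK.homogeneous
  bracket_mem x hx y hy := ⟨hJ.bracket_mem x hx.1 y hy.1, hK.bracket_mem x hx.2 y hy.2⟩

/-- The Lie span of a set of homogeneous elements is contained in every subspace that contains
the set and is closed under brackets of homogeneous elements; this subspace need not be graded. -/
theorem lieSpan_le_of_homogeneous (A : GradedLieAlg F L) {s : Set L} {K : Submodule F L}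
    (hs : ∀ x ∈ s, ∃ d, x ∈ A.dim d) (hsK : s ⊆ K)
    (hK : ∀ {i j : ℤ} {x y : L}, x ∈ A.dim i → y ∈ A.dim j → x ∈ K → y ∈ K →
      A.bracket x y ∈ K) : A.lieSpan s ≤ K := by
  set t : Set L := {x | x ∈ K ∧ ∃ d, x ∈ A.dim d} with ht
  refine (A.lieSpan_le (J := Submodule.span F t) ⟨A.isHomogeneous_span fun x hx => hx.2, ?_⟩
    fun x hx => Submodule.subset_span ⟨hsK hx, hs x hx⟩).trans
    (Submodule.span_le.2 fun x hx => hx.1)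
  intro x hx y hy
  have := Submodule.apply_mem_map₂ A.bracket hx hy
  rw [Submodule.map₂_span_span] at this
  refine Submodule.span_mono ?_ this
  rintro _ ⟨a, ⟨ha, i, hi⟩, b, ⟨hb, j, hj⟩, rfl⟩
  exact ⟨hK hi hj ha hb, i + j, A.bracket_mem hi hj⟩

/-- The derived subspace `[S, S]`, spanned by the brackets of elements of `S`. -/
def derived (A : GradedLieAlg F L) (S : Submodule F L) : Submodule F L :=
  Submodule.map₂ A.bracket S S

theorem bracket_mem_derived (A : GradedLieAlg F L) {S : Submodule F L} {x y : L} (hx : x ∈ S)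
    (hy : y ∈ S) : A.bracket x y ∈ A.derived S :=
  Submodule.apply_mem_map₂ _ hx hy

theorem derived_le_of_homogeneous (A : GradedLieAlg F L) {S K : Submodule F L}
    (hS : A.IsHomogeneous S)
    (h : ∀ {i j : ℤ} {x y : L}, x ∈ A.dim i → y ∈ A.dim j → x ∈ S → y ∈ S →
      A.bracket x y ∈ K) : A.derived S ≤ K := by
  refine (Submodule.map₂_le_map₂ hS.le_span hS.le_span).trans ?_
  rw [Submodule.map₂_span_span, Submodule.span_le]
  rintro _ ⟨x, ⟨hx, i, hi⟩, y, ⟨hy, j, hj⟩, rfl⟩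
  exact h hi hj hx hy

theorem derived_mono (A : GradedLieAlg F L) {S S' : Submodule F L} (h : S ≤ S') :
    A.derived S ≤ A.derived S' :=
  Submodule.map₂_le_map₂ h h

theorem IsSubalgebra.derived_le {A : GradedLieAlg F L} {S : Submodule F L}
    (hS : A.IsSubalgebra S) : A.derived S ≤ S :=
  Submodule.map₂_le.2 hS.bracket_mem

theorem lieSpan_le_span_sup_derived (A : GradedLieAlg F L) {s : Set L}
    (hs : ∀ x ∈ s, ∃ d, x ∈ A.dim d) :
    A.lieSpan s ≤ Submodule.span F s ⊔ A.derived (A.lieSpan s) := by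
  have hle : Submodule.span F s ⊔ A.derived (A.lieSpan s) ≤ A.lieSpan s :=
    sup_le (Submodule.span_le.2 (A.subset_lieSpan s)) (A.lieSpan_isSubalgebra s).derived_le
  refine A.lieSpan_le_of_homogeneous hs (fun x hx =>
    Submodule.mem_sup_left (Submodule.subset_span hx)) ?_
  intro i j x y _ _ hx hy
  exact Submodule.mem_sup_right (A.bracket_mem_derived (hle hx) (hle hy))

theorem ofAlgebra_bracket {T : Type w} [Ring T] [Algebra F T] (g : DimGrading F T)
    (hmul : ∀ {i j : ℤ} {x y : T}, x ∈ g.dim i → y ∈ g.dim j → x * y ∈ g.dim (i + j))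
    {i j : ℤ} {x y : T} (hx : x ∈ g.dim i) (hy : y ∈ g.dim j) :
    (ofAlgebra g hmul).bracket x y = x * y - (i * j).negOnePow • (y * x) := by
  have h : (ofAlgebra g hmul).bracket = LinearMap.mul F T - g.koszulFlip g (LinearMap.mul F T) :=
    rfl
  rw [h, LinearMap.sub_apply, LinearMap.sub_apply, g.koszulFlip_of_mem g _ hy hx, mul_comm j i]
  rfl

end GradedLieAlg

/-! ### Right-independent families -/

section RightIndependent

open MulOpposite

theorem Finsupp.linearCombination_sumElim_apply {R M α β : Type*} [Semiring R] [AddCommMonoid M]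
    [Module R M] (v : α ⊕ β → M) (l : α →₀ R) (l' : β →₀ R) :
    Finsupp.linearCombination R v (l.sumElim l') =
      Finsupp.linearCombination R (v ∘ Sum.inl) l + Finsupp.linearCombination R (v ∘ Sum.inr) l' :=
  Finsupp.sum_sumElim _ _ _

variable {T : Type w} [Ring T] {I : Type*}

/-- If `x` is right-independent over `T`, then `T` contains the direct sum of the right ideal
generated by the `x i` with `i ≠ i₀` and of the right ideal generated by `x i₀`. -/
theorem LinearIndependent.eq_zero_of_add_mul_eq_zero {x : I → T} (hx : LinearIndependent Tᵐᵒᵖ x)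
    (i₀ : I) (m : {i // i ≠ i₀} →₀ Tᵐᵒᵖ) (t : T)
    (h : Finsupp.linearCombination Tᵐᵒᵖ (fun i : {i // i ≠ i₀} => x i) m + x i₀ * t = 0) :
    m = 0 ∧ t = 0 := by
  classical
  have h1 : Finsupp.linearCombination Tᵐᵒᵖ x
      (m.embDomain (Function.Embedding.subtype _) + Finsupp.single i₀ (op t)) = 0 := by
    rw [map_add, Finsupp.linearCombination_embDomain, Finsupp.linearCombination_single,
      op_smul_eq_mul]
    exact h
  have h2 := linearIndependent_iff.1 hx _ h1
  have h3 (i : {i // i ≠ i₀}) : m i = 0 := by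
    have := DFunLike.congr_fun h2 (i : I)
    rw [Finsupp.add_apply, Finsupp.single_eq_of_ne i.2, add_zero] at this
    exact (Finsupp.embDomain_apply_self (Function.Embedding.subtype _) m i).symm.trans this
  have h4 : m = 0 := Finsupp.ext h3
  refine ⟨h4, ?_⟩
  have := DFunLike.congr_fun h2 i₀
  simpa [h4] using this

/-- The iterated commutators `[y, [y, ..., [y, z]]]`. -/
def adPow (y : T) (n : ℕ) (z : T) : T := (fun z => y * z - z * y)^[n] z

theorem adPow_zero (y z : T) : adPow y 0 z = z := rfl

theorem adPow_succ (y z : T) (n : ℕ) :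
    adPow y (n + 1) z = y * adPow y n z - adPow y n z * y := by
  simp only [adPow, Function.iterate_succ_apply']

/-- The right ideal `X + y X + ⋯ + y ^ (n - 1) X`. -/
def mulPowSum (y : T) (X : Submodule Tᵐᵒᵖ T) : ℕ → Submodule Tᵐᵒᵖ T
  | 0 => ⊥
  | n + 1 => X ⊔ (mulPowSum y X n).map (DistribSMul.toLinearMap Tᵐᵒᵖ T y)

theorem mem_mulPowSum_succ {y : T} {X : Submodule Tᵐᵒᵖ T} {n : ℕ} {t : T} :
    t ∈ mulPowSum y X (n + 1) ↔ ∃ a ∈ X, ∃ b ∈ mulPowSum y X n, a + y * b = t := by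
  simp [mulPowSum, Submodule.mem_sup]

theorem mul_mem_mulPowSum {y : T} {X : Submodule Tᵐᵒᵖ T} {n : ℕ} {t : T}
    (ht : t ∈ mulPowSum y X n) : y * t ∈ mulPowSum y X (n + 1) :=
  mem_mulPowSum_succ.2 ⟨0, X.zero_mem, t, ht, zero_add _⟩

theorem mulPowSum_mono (y : T) (X : Submodule Tᵐᵒᵖ T) : Monotone (mulPowSum y X) := by
  refine monotone_nat_of_le_succ fun n => ?_
  induction n with
  | zero => exact bot_le
  | succ n ih => exact sup_le_sup_left (Submodule.map_mono ih) X

theorem pow_mul_mem_mulPowSum {y : T} {X : Submodule Tᵐᵒᵖ T} (n : ℕ) {a : T} (ha : a ∈ X) :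
    y ^ n * a ∈ mulPowSum y X (n + 1) := by
  induction n with
  | zero => exact mem_mulPowSum_succ.2 ⟨a, ha, 0, Submodule.zero_mem _, by simp⟩
  | succ n ih =>
    rw [pow_succ', mul_assoc]
    exact mul_mem_mulPowSum ih

section

variable {x : I → T} {y : T}

theorem adPow_linearCombination_succ (n : ℕ) (m : I →₀ Tᵐᵒᵖ) :
    Finsupp.linearCombination Tᵐᵒᵖ (fun i => adPow y (n + 1) (x i)) m =
      y * Finsupp.linearCombination Tᵐᵒᵖ (fun i => adPow y n (x i)) m -
        Finsupp.linearCombination Tᵐᵒᵖ (fun i => adPow y n (x i))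
          (m.mapRange (· * op y) (zero_mul _)) := by
  induction m using Finsupp.induction_linear with
  | zero => simp
  | add m m' h h' =>
    rw [Finsupp.mapRange_add (by intros; exact add_mul _ _ _), map_add, map_add, map_add, h, h',
      mul_add]
    abel
  | single i c =>
    induction c using MulOpposite.rec' with
    | h c =>
      rw [Finsupp.mapRange_single, ← op_mul]
      simp only [Finsupp.linearCombination_single, op_smul_eq_mul, adPow_succ, sub_mul, mul_assoc]

/-- `[y, [y, ..., [y, z]]]` equals `y ^ n z` up to terms with fewer factors `y` on the left. -/
theorem adPow_sub_pow_mul_mem (n : ℕ) (m : I →₀ Tᵐᵒᵖ) :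
    Finsupp.linearCombination Tᵐᵒᵖ (fun i => adPow y n (x i)) m -
      y ^ n * Finsupp.linearCombination Tᵐᵒᵖ x m ∈
      mulPowSum y (LinearMap.range (Finsupp.linearCombination Tᵐᵒᵖ x)) n := by
  induction n generalizing m with
  | zero => simp [adPow_zero]
  | succ n ih =>
    set m' : I →₀ Tᵐᵒᵖ := m.mapRange (· * op y) (zero_mul _) with hm'
    have h1 := mul_mem_mulPowSum (ih m)
    have h2 := mulPowSum_mono y _ (Nat.le_succ n) (ih m')
    have h3 : y ^ n * Finsupp.linearCombination Tᵐᵒᵖ x m' ∈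
        mulPowSum y (LinearMap.range (Finsupp.linearCombination Tᵐᵒᵖ x)) (n + 1) :=
      pow_mul_mem_mulPowSum n ⟨m', rfl⟩
    have := Submodule.sub_mem _ h1 (Submodule.add_mem _ h2 h3)
    rw [adPow_linearCombination_succ]
    convert this using 1
    rw [pow_succ']
    noncomm_ring

theorem eq_zero_of_pow_mul_add_eq_zero
    (h : ∀ (m : I →₀ Tᵐᵒᵖ) (t : T), Finsupp.linearCombination Tᵐᵒᵖ x m + y * t = 0 →
    m = 0 ∧ t = 0)
    (n : ℕ) (m : I →₀ Tᵐᵒᵖ) (t : T)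
    (ht : t ∈ mulPowSum y (LinearMap.range (Finsupp.linearCombination Tᵐᵒᵖ x)) n)
    (h0 : y ^ n * Finsupp.linearCombination Tᵐᵒᵖ x m + t = 0) : m = 0 := by
  induction n generalizing t with
  | zero =>
    obtain rfl : t = 0 := ht
    exact (h m 0 (by simpa using h0)).1
  | succ n ih =>
    obtain ⟨_, ⟨a, rfl⟩, b, hb, rfl⟩ := mem_mulPowSum_succ.1 ht
    refine ih b hb (h a _ ?_).2
    rw [← h0, pow_succ']
    noncomm_ring

/-- Elimination of a generator, even case: if `x` together with `y` is right-independent, then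
so are the iterated commutators `[y, [y, ..., [y, x i]]]`. -/
theorem linearIndependent_adPow
    (h : ∀ (m : I →₀ Tᵐᵒᵖ) (t : T), Finsupp.linearCombination Tᵐᵒᵖ x m + y * t = 0 →
    m = 0 ∧ t = 0) :
    LinearIndependent Tᵐᵒᵖ (fun p : ℕ × I => adPow y p.1 (x p.2)) := by
  classical
  rw [linearIndependent_iff]
  intro l hl
  have h1 : l.curry.sum (fun n m =>
      Finsupp.linearCombination Tᵐᵒᵖ (fun i => adPow y n (x i)) m) = 0 := by
    rw [← hl, Finsupp.linearCombination_apply]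
    simp only [Finsupp.linearCombination_apply]
    exact Finsupp.sum_curry_index l (fun n i c => c • adPow y n (x i))
  suffices hz : l.curry = 0 by
    ext p
    rw [← Prod.mk.eta (p := p), ← Finsupp.curry_apply, hz]
    rfl
  by_contra hne
  have hs : l.curry.support.Nonempty := Finsupp.support_nonempty_iff.2 hne
  obtain ⟨n, hn, hmax⟩ : ∃ n ∈ l.curry.support, ∀ k ∈ l.curry.support, k ≤ n :=
    ⟨_, Finset.max'_mem _ hs, fun k hk => Finset.le_max' _ k hk⟩
  refine Finsupp.mem_support_iff.1 hn ?_
  rw [Finsupp.sum, ← Finset.add_sum_erase _ _ hn] at h1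
  refine eq_zero_of_pow_mul_add_eq_zero h n _ _
    (Submodule.add_mem _ (adPow_sub_pow_mul_mem n (l.curry n))
      (Submodule.sum_mem (t := l.curry.support.erase n)
      (f := fun k => Finsupp.linearCombination Tᵐᵒᵖ (fun i => adPow y k (x i)) (l.curry k)) _
      fun k hk => ?_)) (by rw [← h1]; abel)
  have hkn : k < n := lt_of_le_of_ne (hmax k (Finset.mem_of_mem_erase hk))
    (Finset.ne_of_mem_erase hk)
  have e := Submodule.add_mem _
    (mulPowSum_mono y _ hkn.le (adPow_sub_pow_mul_mem (x := x) k (l.curry k)))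
    (mulPowSum_mono y _ (Nat.succ_le_of_lt hkn)
      (pow_mul_mem_mulPowSum (y := y) (X := LinearMap.range (Finsupp.linearCombination Tᵐᵒᵖ x)) k
        ⟨l.curry k, rfl⟩))
  rwa [sub_add_cancel] at e

/-- Elimination of a generator, odd case: if `x` together with `y` is right-independent, then so
are the elements `x i`, `y x i - x i u i` and `c y²` for a unit `c`. -/
theorem linearIndependent_elim_odd
    (h : ∀ (m : I →₀ Tᵐᵒᵖ) (t : T), Finsupp.linearCombination Tᵐᵒᵖ x m + y * t = 0 →
    m = 0 ∧ t = 0)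
    (u : I → T) (c : T) (hc : IsUnit c) :
    LinearIndependent Tᵐᵒᵖ (Sum.elim (Sum.elim x (fun i => y * x i - x i * u i))
      (fun _ : Unit => y * y * c)) := by
  rw [linearIndependent_iff]
  intro l hl
  obtain ⟨⟨l', l₃⟩, rfl⟩ :=
    (Finsupp.sumFinsuppEquivProdFinsupp (α := I ⊕ I) (β := Unit)).symm.surjective l
  obtain ⟨⟨l₁, l₂⟩, rfl⟩ :=
    (Finsupp.sumFinsuppEquivProdFinsupp (α := I) (β := I)).symm.surjective l'
  change Finsupp.linearCombination Tᵐᵒᵖ _ ((l₁.sumElim l₂).sumElim l₃) = 0 at hl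
  change (l₁.sumElim l₂).sumElim l₃ = 0
  rw [Finsupp.linearCombination_sumElim_apply, Finsupp.linearCombination_sumElim_apply] at hl
  obtain ⟨s, rfl⟩ : ∃ s, l₃ = Finsupp.single () (op s) :=
    ⟨unop (l₃ ()), by ext; simp⟩
  have hm : ∃ m : I →₀ Tᵐᵒᵖ, Finsupp.linearCombination Tᵐᵒᵖ (fun i => y * x i - x i * u i) l₂ =
      y * Finsupp.linearCombination Tᵐᵒᵖ x l₂ + Finsupp.linearCombination Tᵐᵒᵖ x m := by
    clear hl
    induction l₂ using Finsupp.induction_linear with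
    | zero => exact ⟨0, by simp⟩
    | add a b ha hb =>
      obtain ⟨m, hm⟩ := ha
      obtain ⟨m', hm'⟩ := hb
      refine ⟨m + m', ?_⟩
      rw [map_add, map_add, map_add, hm, hm', mul_add]
      abel
    | single i c =>
      refine ⟨Finsupp.single i (-op (u i * unop c)), ?_⟩
      simp only [Finsupp.linearCombination_single, MulOpposite.smul_eq_mul_unop, unop_neg, unop_op]
      noncomm_ring
  obtain ⟨m, hm⟩ := hm
  have e1 := h (l₁ + m) (Finsupp.linearCombination Tᵐᵒᵖ x l₂ + y * (c * s)) (by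
    rw [← hl]
    simp only [Sum.elim_comp_inl, Sum.elim_comp_inr, hm, Finsupp.linearCombination_single,
      op_smul_eq_mul, map_add]
    noncomm_ring)
  obtain ⟨rfl, e2⟩ := h l₂ _ e1.2
  obtain rfl := hc.mul_right_eq_zero.1 e2
  have e3 := h l₁ 0 (by simpa using hl)
  rw [e3.1]
  simp

end

end RightIndependent

/-! ### Elimination of a generator -/

namespace GradedLieAlg

section

variable {F : Type u} [Field F] {L : Type v} [AddCommGroup L] [Module F L]

theorem bracket_mem_lieSpan_of_forall (A : GradedLieAlg F L) {s : Set L} {y : L} {d : ℤ}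
    (hs : ∀ x ∈ s, ∃ d, x ∈ A.dim d) (hy : y ∈ A.dim d)
    (hys : ∀ x ∈ s, A.bracket y x ∈ A.lieSpan s) {z : L} (hz : z ∈ A.lieSpan s) :
    A.bracket y z ∈ A.lieSpan s := by
  have hG := A.lieSpan_isSubalgebra s
  have : A.lieSpan s ≤ A.lieSpan s ⊓ (A.lieSpan s).comap (A.bracket y) := by
    refine A.lieSpan_le_of_homogeneous hs (fun x hx => ⟨A.subset_lieSpan s hx, hys x hx⟩) ?_
    rintro i j a b ha hb ⟨haG, haK⟩ ⟨hbG, hbK⟩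
    refine ⟨hG.bracket_mem _ haG _ hbG, ?_⟩
    rw [SetLike.mem_coe, Submodule.mem_comap, A.jacobi hy ha hb]
    exact add_mem (hG.bracket_mem _ haK _ hbG) (sign_smul_mem _ (hG.bracket_mem _ haG _ hbK))
  exact (this hz).2

theorem bracket_mem_of_flip (A : GradedLieAlg F L) {G : Submodule F L} (hG : A.IsHomogeneous G)
    {y : L} {d : ℤ} (hy : y ∈ A.dim d) (h : ∀ z ∈ G, A.bracket y z ∈ G) {z : L} (hz : z ∈ G) :
    A.bracket z y ∈ G := by
  have : G ≤ G.comap (A.bracket.flip y) := by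
    refine hG.le_span.trans (Submodule.span_le.2 ?_)
    rintro x ⟨hx, i, hi⟩
    simp only [Submodule.comap_coe, Set.mem_preimage, LinearMap.flip_apply, SetLike.mem_coe]
    rw [A.bracket_skew hi hy]
    exact neg_mem (sign_smul_mem _ (h x hx))
  exact this hz

/-- If `y` normalizes the Lie algebra generated by `s` and `[y, y]` belongs to it, then the Lie
algebra generated by `y` and `s` is obtained by adding the line spanned by `y`. -/
theorem lieSpan_insert_le (A : GradedLieAlg F L) {s : Set L} {y : L} {d : ℤ}
    (hs : ∀ x ∈ s, ∃ d, x ∈ A.dim d) (hy : y ∈ A.dim d)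
    (hys : ∀ x ∈ s, A.bracket y x ∈ A.lieSpan s) (hyy : A.bracket y y ∈ A.lieSpan s) :
    A.lieSpan (insert y s) ≤ A.lieSpan s ⊔ Submodule.span F {y} := by
  have hG := A.lieSpan_isSubalgebra s
  refine A.lieSpan_le_of_homogeneous ?_ ?_ ?_
  · rintro x (rfl | hx)
    exacts [⟨d, hy⟩, hs x hx]
  · rintro x (rfl | hx)
    exacts [Submodule.mem_sup_right (Submodule.mem_span_singleton_self _),
      Submodule.mem_sup_left (A.subset_lieSpan s hx)]
  · intro i j a b _ _ ha hb
    obtain ⟨p, hp, _, hq, rfl⟩ := Submodule.mem_sup.1 ha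
    obtain ⟨c, rfl⟩ := Submodule.mem_span_singleton.1 hq
    obtain ⟨p', hp', _, hq', rfl⟩ := Submodule.mem_sup.1 hb
    obtain ⟨c', rfl⟩ := Submodule.mem_span_singleton.1 hq'
    refine Submodule.mem_sup_left ?_
    have hstab : ∀ z ∈ A.lieSpan s, A.bracket y z ∈ A.lieSpan s :=
      fun z hz => A.bracket_mem_lieSpan_of_forall hs hy hys hz
    simp only [map_add, LinearMap.add_apply, map_smul, LinearMap.smul_apply]
    refine add_mem (add_mem (hG.bracket_mem _ hp _ hp') (Submodule.smul_mem _ _ (hstab _ hp')))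
      (Submodule.smul_mem _ _ (add_mem ?_ (Submodule.smul_mem _ _ hyy)))
    exact A.bracket_mem_of_flip hG.homogeneous hy hstab hp

theorem lieSpan_eq_inf_ker (A : GradedLieAlg F L) {S : Submodule F L} {s : Set L} {y : L} {d : ℤ}
    (hs : ∀ x ∈ s, ∃ d, x ∈ A.dim d) (hy : y ∈ A.dim d)
    (hys : ∀ x ∈ s, A.bracket y x ∈ A.lieSpan s) (hyy : A.bracket y y ∈ A.lieSpan s)
    (hS : S ≤ A.lieSpan (insert y s)) (φ : L →ₗ[F] F) (hφy : φ y ≠ 0)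
    (hSφ : A.IsSubalgebra (S ⊓ LinearMap.ker φ)) (hsS : s ⊆ (S ⊓ LinearMap.ker φ : Submodule F L)) :
    A.lieSpan s = S ⊓ LinearMap.ker φ := by
  have hle := A.lieSpan_le hSφ hsS
  refine le_antisymm hle ?_
  rintro z ⟨hz, hzφ⟩
  obtain ⟨p, hp, _, hq, rfl⟩ := Submodule.mem_sup.1 (A.lieSpan_insert_le hs hy hys hyy (hS hz))
  obtain ⟨c, rfl⟩ := Submodule.mem_span_singleton.1 hq
  have h1 : φ p = 0 := (hle hp).2
  rw [SetLike.mem_coe, LinearMap.mem_ker, map_add, h1, zero_add, map_smul, smul_eq_mul,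
    mul_eq_zero] at hzφ
  rw [hzφ.resolve_right hφy, zero_smul, add_zero]
  exact hp

end

variable {F : Type u} [Field F] {T : Type w} [Ring T] [Algebra F T] (g : DimGrading F T)
  (hmul : ∀ {i j : ℤ} {x y : T}, x ∈ g.dim i → y ∈ g.dim j → x * y ∈ g.dim (i + j))

/-- The Lie subalgebra `S` of the associative algebra `T` is generated by homogeneous elements
that are right-independent over `T`. -/
def IsRightFree (S : Submodule F T) : Prop :=
  ∃ (I : Type) (x : I → T), (∀ i, ∃ d, x i ∈ g.dim d) ∧ LinearIndependent Tᵐᵒᵖ x ∧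
    (ofAlgebra g hmul).lieSpan (Set.range x) = S

section

variable {g} {I : Type} {x : I → T} {y : T} {d : ℤ} {S : Submodule F T} {φ : T →ₗ[F] F}

theorem isRightFree_inf_ker_of_even (hd : Even d)
    (hx : ∀ i, ∃ d, x i ∈ g.dim d) (hy : y ∈ g.dim d)
    (h : ∀ (m : I →₀ Tᵐᵒᵖ) (t : T), Finsupp.linearCombination Tᵐᵒᵖ x m + y * t = 0 →
      m = 0 ∧ t = 0)
    (hS : (ofAlgebra g hmul).IsSubalgebra S)
    (hSle : S ≤ (ofAlgebra g hmul).lieSpan (insert y (Set.range x)))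
    (hyS : y ∈ S) (hφy : φ y ≠ 0) (hxS : ∀ i, x i ∈ S ⊓ LinearMap.ker φ)
    (hφ : (ofAlgebra g hmul).derived S ≤ LinearMap.ker φ)
    (hSφ : (ofAlgebra g hmul).IsSubalgebra (S ⊓ LinearMap.ker φ)) :
    IsRightFree g hmul (S ⊓ LinearMap.ker φ) := by
  have hbr {j : ℤ} {z : T} (hz : z ∈ g.dim j) :
      (ofAlgebra g hmul).bracket y z = y * z - z * y := by
    rw [ofAlgebra_bracket g hmul hy hz, Int.negOnePow_even _ (hd.mul_right j), one_smul]
  have hhom : ∀ (n : ℕ) (i : I), ∃ e, adPow y n (x i) ∈ g.dim e := by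
    intro n i
    induction n with
    | zero => exact hx i
    | succ n ih =>
      obtain ⟨e, he⟩ := ih
      exact ⟨d + e, by rw [adPow_succ, ← hbr he]; exact (ofAlgebra g hmul).bracket_mem hy he⟩
  have hsucc (n : ℕ) (i : I) : (ofAlgebra g hmul).bracket y (adPow y n (x i)) =
      adPow y (n + 1) (x i) := by
    obtain ⟨e, he⟩ := hhom n i
    rw [adPow_succ, hbr he]
  have hmemS : ∀ (n : ℕ) (i : I), adPow y n (x i) ∈ S ⊓ LinearMap.ker φ := by
    intro n i
    induction n with
    | zero => exact hxS i
    | succ n ih =>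
      rw [← hsucc]
      exact ⟨hS.bracket_mem _ hyS _ ih.1, hφ (bracket_mem_derived _ hyS ih.1)⟩
  refine ⟨ℕ × I, fun p => adPow y p.1 (x p.2), fun p => hhom _ _, linearIndependent_adPow h, ?_⟩
  refine (ofAlgebra g hmul).lieSpan_eq_inf_ker ?_ hy ?_ ?_ ?_ φ hφy hSφ ?_
  · rintro _ ⟨p, rfl⟩
    exact hhom _ _
  · rintro _ ⟨⟨n, i⟩, rfl⟩
    rw [hsucc]
    exact subset_lieSpan _ _ ⟨(n + 1, i), rfl⟩
  · rw [hbr hy, sub_self]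
    exact Submodule.zero_mem _
  · refine hSle.trans (lieSpan_mono _ (Set.insert_subset_insert ?_))
    rintro _ ⟨i, rfl⟩
    exact ⟨(0, i), rfl⟩
  · rintro _ ⟨p, rfl⟩
    exact hmemS _ _

theorem isRightFree_inf_ker_of_odd (h2 : (2 : F) ≠ 0) (hd : Odd d)
    (hx : ∀ i, ∃ d, x i ∈ g.dim d) (hy : y ∈ g.dim d)
    (h : ∀ (m : I →₀ Tᵐᵒᵖ) (t : T), Finsupp.linearCombination Tᵐᵒᵖ x m + y * t = 0 →
      m = 0 ∧ t = 0)
    (hS : (ofAlgebra g hmul).IsSubalgebra S)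
    (hSle : S ≤ (ofAlgebra g hmul).lieSpan (insert y (Set.range x)))
    (hyS : y ∈ S) (hφy : φ y ≠ 0) (hxS : ∀ i, x i ∈ S ⊓ LinearMap.ker φ)
    (hφ : (ofAlgebra g hmul).derived S ≤ LinearMap.ker φ)
    (hSφ : (ofAlgebra g hmul).IsSubalgebra (S ⊓ LinearMap.ker φ)) :
    IsRightFree g hmul (S ⊓ LinearMap.ker φ) := by
  set Λ := ofAlgebra g hmul with hΛ
  choose e he using hx
  have hdd : (d * d).negOnePow = -1 := Int.negOnePow_odd _ (hd.mul hd)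
  have hyy : Λ.bracket y y = y * y * 2 := by
    rw [hΛ, ofAlgebra_bracket g hmul hy hy, hdd, mul_two]
    simp
  have hyx (i : I) : Λ.bracket y (x i) = y * x i - x i * ((d * e i).negOnePow • y) := by
    rw [hΛ, ofAlgebra_bracket g hmul hy (he i), Units.smul_def, Units.smul_def, mul_smul_comm]
  have h2T : IsUnit (2 : T) := by
    have := (IsUnit.mk0 (2 : F) h2).map (algebraMap F T)
    rwa [map_ofNat] at this
  set z : (I ⊕ I) ⊕ Unit → T := Sum.elim (Sum.elim x
    (fun i => y * x i - x i * ((d * e i).negOnePow • y))) (fun _ => y * y * 2) with hz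
  have hzhom : ∀ p, ∃ d, z p ∈ g.dim d := by
    rintro ((i | i) | _)
    · exact ⟨_, he i⟩
    · refine ⟨d + e i, ?_⟩
      change y * x i - x i * ((d * e i).negOnePow • y) ∈ _
      rw [← hyx]
      exact Λ.bracket_mem hy (he i)
    · refine ⟨d + d, ?_⟩
      change y * y * 2 ∈ _
      rw [← hyy]
      exact Λ.bracket_mem hy hy
  have hzs (p) : z p ∈ Λ.lieSpan (Set.range z) := subset_lieSpan _ _ ⟨p, rfl⟩
  have hyyG : Λ.bracket y y ∈ Λ.lieSpan (Set.range z) := hyy ▸ hzs (Sum.inr ())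
  have hyxG (i : I) : Λ.bracket y (x i) ∈ Λ.lieSpan (Set.range z) :=
    hyx i ▸ hzs (Sum.inl (Sum.inr i))
  refine ⟨(I ⊕ I) ⊕ Unit, z, hzhom, linearIndependent_elim_odd h _ _ h2T, ?_⟩
  refine Λ.lieSpan_eq_inf_ker ?_ hy ?_ hyyG ?_ φ hφy hSφ ?_
  · rintro _ ⟨p, rfl⟩
    exact hzhom p
  · rintro _ ⟨(i | i) | _, rfl⟩
    · exact hyxG i
    · -- By the Jacobi identity, `2 [y, [y, x]] = [[y, y], x]`.
      change Λ.bracket y (y * x i - x i * ((d * e i).negOnePow • y)) ∈ _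
      rw [← hyx]
      have hj := Λ.jacobi hy hy (he i)
      rw [hdd, Units.neg_smul, one_smul, eq_add_neg_iff_add_eq, ← two_smul F] at hj
      have hm : (2 : F) • Λ.bracket y (Λ.bracket y (x i)) ∈ Λ.lieSpan (Set.range z) := by
        rw [hj]
        exact (Λ.lieSpan_isSubalgebra _).bracket_mem _ hyyG _ (hzs (Sum.inl (Sum.inl i)))
      exact (Submodule.smul_mem_iff _ h2).1 hm
    · change Λ.bracket y (y * y * 2) ∈ _
      have h4 : y * y * 2 ∈ g.dim (d + d) := hyy ▸ Λ.bracket_mem hy hy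
      rw [hΛ, ofAlgebra_bracket g hmul hy h4,
        Int.negOnePow_even _ ((Even.add_self d).mul_left d), one_smul, mul_two,
        show y * (y * y + y * y) - (y * y + y * y) * y = 0 by noncomm_ring]
      exact Submodule.zero_mem _
  · refine hSle.trans (lieSpan_mono _ (Set.insert_subset_insert ?_))
    rintro _ ⟨i, rfl⟩
    exact ⟨Sum.inl (Sum.inl i), rfl⟩
  · rintro _ ⟨(i | i) | _, rfl⟩
    · exact hxS i
    · change y * x i - x i * ((d * e i).negOnePow • y) ∈ _
      rw [← hyx]
      exact ⟨hS.bracket_mem _ hyS _ (hxS i).1, hφ (bracket_mem_derived _ hyS (hxS i).1)⟩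
    · change y * y * 2 ∈ _
      rw [← hyy]
      exact ⟨hS.bracket_mem _ hyS _ hyS, hφ (bracket_mem_derived _ hyS hyS)⟩

/-- Elimination: the property of being generated by a right-independent family passes to graded
ideals of codimension one, given as the kernel of a functional `φ` concentrated in
dimension `d`. -/
theorem IsRightFree.inf_ker (h2 : (2 : F) ≠ 0) (hfree : IsRightFree g hmul S)
    (hφS : ¬ S ≤ LinearMap.ker φ) (hφ : (ofAlgebra g hmul).derived S ≤ LinearMap.ker φ)
    (hφd : ∀ e, ∀ z ∈ g.dim e, e ≠ d → φ z = 0)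
    (hSφ : (ofAlgebra g hmul).IsSubalgebra (S ⊓ LinearMap.ker φ)) :
    IsRightFree g hmul (S ⊓ LinearMap.ker φ) := by
  classical
  obtain ⟨I, x, hx, hind, rfl⟩ := hfree
  set S := (ofAlgebra g hmul).lieSpan (Set.range x) with hS
  have hhom : ∀ z ∈ Set.range x, ∃ d, z ∈ (ofAlgebra g hmul).dim d := by
    rintro _ ⟨i, rfl⟩
    exact hx i
  have hxS (i : I) : x i ∈ S := subset_lieSpan _ _ ⟨i, rfl⟩
  obtain ⟨i₀, hi₀⟩ : ∃ i, φ (x i) ≠ 0 := by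
    by_contra! hc
    refine hφS ((lieSpan_le_span_sup_derived _ hhom).trans
      (sup_le (Submodule.span_le.2 ?_) hφ))
    rintro _ ⟨i, rfl⟩
    exact hc i
  have hdim : ∀ i, φ (x i) ≠ 0 → x i ∈ g.dim d := by
    intro i hi
    obtain ⟨e, he⟩ := hx i
    by_cases hed : e = d
    · exact hed ▸ he
    · exact absurd (hφd e _ he hed) hi
  set y := x i₀ with hy
  -- Subtract multiples of `y` to move the other generators into the kernel of `φ`.
  set c : I → F := fun i => if i = i₀ then 0 else -(φ (x i) / φ y) with hc
  set x' : I → T := fun i => x i + MulOpposite.op (algebraMap F T (c i)) • y with hx'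
  have hx'c (i : I) : x' i = x i + c i • y := by
    simp only [hx', op_smul_eq_mul]
    rw [← Algebra.commutes, ← Algebra.smul_def]
  have hind' : LinearIndependent Tᵐᵒᵖ x' :=
    (linearIndependent_add_smul_iff (c := fun i => MulOpposite.op (algebraMap F T (c i)))
      (i := i₀) (by simp [hc])).2 hind
  have hy' : x' i₀ = y := by simp [hx'c, hc, hy]
  have hkey := hind'.eq_zero_of_add_mul_eq_zero i₀
  rw [hy'] at hkey
  have hx'hom : ∀ i : {i // i ≠ i₀}, ∃ d, x' i ∈ g.dim d := by
    rintro ⟨i, hi⟩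
    by_cases h0 : φ (x i) = 0
    · obtain ⟨e, he⟩ := hx i
      exact ⟨e, by simpa [hx'c, hc, h0] using he⟩
    · refine ⟨d, ?_⟩
      rw [hx'c]
      exact add_mem (hdim i h0) (Submodule.smul_mem _ _ (hdim i₀ hi₀))
  have hx'S : ∀ i : {i // i ≠ i₀}, x' i ∈ S ⊓ LinearMap.ker φ := by
    rintro ⟨i, hi⟩
    rw [hx'c]
    refine ⟨add_mem (hxS i) (Submodule.smul_mem _ _ (hxS i₀)), ?_⟩
    rw [SetLike.mem_coe, LinearMap.mem_ker, map_add, map_smul, smul_eq_mul]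
    simp only [hc, if_neg hi]
    field_simp
    ring
  have hSle : S ≤ (ofAlgebra g hmul).lieSpan
      (insert y (Set.range fun i : {i // i ≠ i₀} => x' i)) := by
    refine lieSpan_le _ (lieSpan_isSubalgebra _ _) ?_
    rintro _ ⟨i, rfl⟩
    have hyG := subset_lieSpan (ofAlgebra g hmul)
      (insert y (Set.range fun i : {i // i ≠ i₀} => x' i)) (Set.mem_insert _ _)
    by_cases hi : i = i₀
    · rw [hi]
      exact hyG
    · have h1 := subset_lieSpan (ofAlgebra g hmul)
        (insert y (Set.range fun i : {i // i ≠ i₀} => x' i))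
        (Set.mem_insert_of_mem _ ⟨⟨i, hi⟩, rfl⟩)
      have : x i = x' i - c i • y := by rw [hx'c]; abel
      rw [this]
      exact sub_mem h1 (Submodule.smul_mem _ _ hyG)
  rcases Int.even_or_odd d with hd | hd
  · exact isRightFree_inf_ker_of_even hmul hd hx'hom (hdim i₀ hi₀) hkey
      (lieSpan_isSubalgebra _ _) hSle (hxS i₀) hi₀ hx'S hφ hSφ
  · exact isRightFree_inf_ker_of_odd hmul h2 hd hx'hom (hdim i₀ hi₀) hkey
      (lieSpan_isSubalgebra _ _) hSle (hxS i₀) hi₀ hx'S hφ hSφ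

end

theorem lieSpan_le_span_mulOpposite {s : Set T} (hs : ∀ z ∈ s, ∃ d, z ∈ g.dim d) :
    (ofAlgebra g hmul).lieSpan s ≤ (Submodule.span Tᵐᵒᵖ s).restrictScalars F := by
  refine lieSpan_le_of_homogeneous _ hs Submodule.subset_span ?_
  intro i j a b ha hb haK hbK
  rw [ofAlgebra_bracket g hmul ha hb]
  exact sub_mem (Submodule.smul_mem (Submodule.span Tᵐᵒᵖ s) (MulOpposite.op b) haK)
    (sign_smul_mem _ (Submodule.smul_mem (Submodule.span Tᵐᵒᵖ s) (MulOpposite.op a) hbK))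

/-- The generators of a Lie algebra generated by a right-independent family are independent
modulo the right submodule `S · ker ε`: an element of `S` in this submodule is decomposable. -/
theorem IsRightFree.inf_mul_ker_le {S : Submodule F T} (hfree : IsRightFree g hmul S)
    (ε : T →ₐ[F] F) (hε : S ≤ LinearMap.ker ε.toLinearMap) :
    S ⊓ S * LinearMap.ker ε.toLinearMap ≤ (ofAlgebra g hmul).derived S := by
  classical
  obtain ⟨I, x, hx, hind, rfl⟩ := hfree
  set Λ := ofAlgebra g hmul with hΛ
  set S := Λ.lieSpan (Set.range x) with hS
  have hhom : ∀ z ∈ Set.range x, ∃ d, z ∈ Λ.dim d := by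
    rintro _ ⟨i, rfl⟩
    exact hx i
  have hSK := lieSpan_le_span_mulOpposite g hmul hhom
  have hprod : ∀ s ∈ S * LinearMap.ker ε.toLinearMap, ∃ m : I →₀ Tᵐᵒᵖ,
      Finsupp.linearCombination Tᵐᵒᵖ x m = s ∧ ∀ i, ε (m i).unop = 0 := by
    intro s hs
    induction hs using Submodule.mul_induction_on' with
    | mem_mul_mem j hj a ha =>
      obtain ⟨m, rfl⟩ := Finsupp.mem_span_range_iff_exists_finsupp.1 (hSK hj)
      refine ⟨MulOpposite.op a • m, ?_, fun i => ?_⟩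
      · rw [map_smul, op_smul_eq_mul]
        rfl
      · have ha' : ε a = 0 := ha
        simp [ha']
    | add s _ s' _ h h' =>
      obtain ⟨m, rfl, hm⟩ := h
      obtain ⟨m', rfl, hm'⟩ := h'
      exact ⟨m + m', map_add _ _ _, fun i => by simp [hm, hm']⟩
  have hder : Λ.derived S ≤ S * LinearMap.ker ε.toLinearMap := by
    refine Λ.derived_le_of_homogeneous (Λ.lieSpan_isSubalgebra _).homogeneous ?_
    intro i j a b ha hb haS hbS
    rw [hΛ, ofAlgebra_bracket g hmul ha hb]
    exact sub_mem (Submodule.mul_mem_mul haS (hε hbS))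
      (sign_smul_mem _ (Submodule.mul_mem_mul hbS (hε haS)))
  rintro s ⟨hsS, hs⟩
  obtain ⟨r, hr, t, ht, rfl⟩ := Submodule.mem_sup.1 (Λ.lieSpan_le_span_sup_derived hhom hsS)
  obtain ⟨c, rfl⟩ := Finsupp.mem_span_range_iff_exists_finsupp.1 hr
  obtain ⟨m, hm, hmε⟩ := hprod (c.sum fun i a => a • x i) (by
    simpa using sub_mem hs (hder ht))
  -- Compare the two expressions of the linear part in terms of the right-independent family.
  set m' : I →₀ Tᵐᵒᵖ := c.mapRange (fun a => MulOpposite.op (algebraMap F T a)) (by simp) with hm'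
  have hm'' : Finsupp.linearCombination Tᵐᵒᵖ x m' = c.sum fun i a => a • x i := by
    rw [Finsupp.linearCombination_apply, hm', Finsupp.sum_mapRange_index (by simp)]
    refine Finsupp.sum_congr fun i _ => ?_
    rw [op_smul_eq_mul, ← Algebra.commutes, ← Algebra.smul_def]
  have hmm := hind (hm.trans hm''.symm)
  have hc : c = 0 := by
    ext i
    have := hmε i
    rw [hmm, hm', Finsupp.mapRange_apply, MulOpposite.unop_op, AlgHom.commutes] at this
    exact this
  rw [hc, Finsupp.sum_zero_index, zero_add]
  exact ht

end GradedLieAlg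

/-! ### The tensor algebra: word length, augmentation and right independence of the generators -/

namespace GradedLieAlg

open TensorAlgebra (ι)

variable {F : Type u} [Field F] {V : Type v} [AddCommGroup V] [Module F V]

/-- The component `V^{⊗ n}` of the tensor algebra, spanned by the words of length `n`. -/
abbrev wordSpan (F : Type u) [Field F] (V : Type v) [AddCommGroup V] [Module F V] (n : ℕ) :
    Submodule F (TensorAlgebra F V) :=
  LinearMap.range (ι F : V →ₗ[F] TensorAlgebra F V) ^ n

/-- The projection of the tensor algebra to its component `V^{⊗ n}`. -/
def lengthProj (F : Type u) [Field F] (V : Type v) [AddCommGroup V] [Module F V] (n : ℕ) :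
    TensorAlgebra F V →ₗ[F] TensorAlgebra F V :=
  GradedAlgebra.proj (wordSpan F V) n

theorem lengthProj_mem (n : ℕ) (x : TensorAlgebra F V) : lengthProj F V n x ∈ wordSpan F V n :=
  Subtype.prop _

theorem lengthProj_of_mem {n : ℕ} {x : TensorAlgebra F V} (hx : x ∈ wordSpan F V n) :
    lengthProj F V n x = x :=
  DirectSum.decompose_of_mem_same (wordSpan F V) hx

theorem lengthProj_of_mem_ne {n m : ℕ} {x : TensorAlgebra F V} (hx : x ∈ wordSpan F V m)
    (h : m ≠ n) : lengthProj F V n x = 0 :=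
  DirectSum.decompose_of_mem_ne (wordSpan F V) hx h

theorem exists_sum_lengthProj (x : TensorAlgebra F V) :
    ∃ s : Finset ℕ, x = ∑ n ∈ s, lengthProj F V n x := by
  classical
  exact ⟨_, (DirectSum.sum_support_decompose (wordSpan F V) x).symm⟩

theorem lengthProj_mem_tensorDim (g : DimGrading F V) (n : ℕ) (d : ℤ) (x : TensorAlgebra F V)
    (hx : x ∈ tensorDim g d) : lengthProj F V n x ∈ tensorDim g d := by
  have : tensorDim g d ≤ (tensorDim g d).comap (lengthProj F V n) := by
    rw [tensorDim, Submodule.span_le]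
    rintro _ ⟨l, hl, hd, rfl⟩
    have hlen : (l.map fun p => ι F p.2).prod ∈ wordSpan F V l.length := by
      clear hl hd
      induction l with
      | nil => simp
      | cons p l ih =>
        rw [List.map_cons, List.prod_cons, List.length_cons, wordSpan, pow_succ']
        exact Submodule.mul_mem_mul ⟨_, rfl⟩ ih
    rw [SetLike.mem_coe, Submodule.mem_comap]
    by_cases h : l.length = n
    · subst h
      rw [lengthProj_of_mem hlen]
      exact Submodule.subset_span ⟨l, hl, hd, rfl⟩
    · rw [lengthProj_of_mem_ne hlen h]
      exact Submodule.zero_mem _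
  exact this hx

theorem proj_lengthProj (g : DimGrading F V) (d : ℤ) (n : ℕ) (x : TensorAlgebra F V) :
    (tensorGrading g).proj d (lengthProj F V n x) = lengthProj F V n ((tensorGrading g).proj d x) :=
  DimGrading.proj_map_of_map_dim (tensorGrading g) (tensorGrading g) (lengthProj F V n)
    (fun i x hx => lengthProj_mem_tensorDim g n i x hx) d x

theorem isHomogeneous_wordSpan (g : DimGrading F V) (n : ℕ) :
    (tensorGrading g).IsHomogeneous (wordSpan F V n) := by
  intro x hx d
  rw [← lengthProj_of_mem hx, proj_lengthProj]
  exact lengthProj_mem _ _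

theorem ι_mem_tensorDim (g : DimGrading F V) {d : ℤ} {x : V} (hx : x ∈ g.dim d) :
    ι F x ∈ tensorDim g d :=
  Submodule.subset_span ⟨[(d, x)], by simpa using hx, by simp, by simp⟩

theorem tensorLie_bracket (g : DimGrading F V) {i j : ℤ} {x y : TensorAlgebra F V}
    (hx : x ∈ tensorDim g i) (hy : y ∈ tensorDim g j) :
    (tensorLie g).bracket x y = x * y - (i * j).negOnePow • (y * x) :=
  ofAlgebra_bracket (tensorGrading g) (tensorDim_mul g) hx hy

theorem bracket_mem_wordSpan (g : DimGrading F V) {p q : ℕ} {x y : TensorAlgebra F V}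
    (hx : x ∈ wordSpan F V p) (hy : y ∈ wordSpan F V q) :
    (tensorLie g).bracket x y ∈ wordSpan F V (p + q) := by
  have h := Submodule.map₂_le_map₂ (f := (tensorLie g).bracket)
    (isHomogeneous_wordSpan g p).le_span (isHomogeneous_wordSpan g q).le_span
  refine (h.trans ?_) (Submodule.apply_mem_map₂ _ hx hy)
  rw [Submodule.map₂_span_span, Submodule.span_le]
  rintro _ ⟨a, ⟨ha, i, hi⟩, b, ⟨hb, j, hj⟩, rfl⟩
  simp only [SetLike.mem_coe]
  rw [tensorLie_bracket g hi hj]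
  refine sub_mem ?_ (sign_smul_mem _ ?_)
  · rw [wordSpan, pow_add]
    exact Submodule.mul_mem_mul ha hb
  · rw [wordSpan, add_comm, pow_add]
    exact Submodule.mul_mem_mul hb ha

/-- The augmentation ideal of the tensor algebra, as a subspace. -/
abbrev augIdeal (F : Type u) [Field F] (V : Type v) [AddCommGroup V] [Module F V] :
    Submodule F (TensorAlgebra F V) :=
  LinearMap.ker (TensorAlgebra.algebraMapInv (R := F) (M := V)).toLinearMap

theorem ι_mem_augIdeal (x : V) : ι F x ∈ augIdeal F V := by
  simp [TensorAlgebra.algebraMapInv]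

theorem eq_zero_of_mem_wordSpan_zero {x : TensorAlgebra F V} (hx : x ∈ wordSpan F V 0)
    (hx' : x ∈ augIdeal F V) : x = 0 := by
  rw [wordSpan, pow_zero, Submodule.mem_one] at hx
  obtain ⟨r, rfl⟩ := hx
  rw [LinearMap.mem_ker, AlgHom.toLinearMap_apply, AlgHom.commutes] at hx'
  have hr : r = 0 := hx'
  rw [hr, map_zero]

theorem exists_homogeneous_basis (g : DimGrading F V) :
    ∃ (B : Type v) (b : Module.Basis B F V), ∀ i, ∃ d, b i ∈ g.dim d :=
  ⟨_, g.isInternal.collectedBasis fun i => Module.Basis.ofVectorSpace F (g.dim i),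
    fun a => ⟨a.1, g.isInternal.collectedBasis_mem _ a⟩⟩

theorem freeLieSubmodule_eq (g : DimGrading F V) {B : Type*} {b : B → V}
    (hb : Submodule.span F (Set.range b) = ⊤) :
    freeLieSubmodule g = (tensorLie g).lieSpan (Set.range (ι F ∘ b)) := by
  refine le_antisymm (lieSpan_le _ (lieSpan_isSubalgebra _ _) ?_) (lieSpan_mono _ ?_)
  · rintro _ ⟨x, rfl⟩
    have : (⊤ : Submodule F V) ≤
        ((tensorLie g).lieSpan (Set.range (ι F ∘ b))).comap (ι F) := by
      rw [← hb, Submodule.span_le]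
      rintro _ ⟨i, rfl⟩
      exact subset_lieSpan _ _ ⟨i, rfl⟩
    exact this trivial
  · rintro _ ⟨i, rfl⟩
    exact ⟨b i, rfl⟩

theorem lieSpan_le_augIdeal (g : DimGrading F V) {s : Set (TensorAlgebra F V)}
    (hs : ∀ x ∈ s, ∃ d, x ∈ tensorDim g d) (hs' : s ⊆ augIdeal F V) :
    (tensorLie g).lieSpan s ≤ augIdeal F V := by
  refine lieSpan_le_of_homogeneous _ hs hs' ?_
  intro i j x y hx hy hxε hyε
  rw [tensorLie_bracket g hx hy]
  rw [LinearMap.mem_ker, AlgHom.toLinearMap_apply] at hxε hyε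
  refine sub_mem ?_ (sign_smul_mem _ ?_) <;>
  · rw [LinearMap.mem_ker, AlgHom.toLinearMap_apply, map_mul, hxε, hyε, mul_zero]

theorem freeLieSubmodule_le_augIdeal (g : DimGrading F V) :
    freeLieSubmodule g ≤ augIdeal F V := by
  obtain ⟨B, b, hb⟩ := exists_homogeneous_basis g
  rw [freeLieSubmodule_eq g b.span_eq]
  refine lieSpan_le_augIdeal g ?_ ?_
  · rintro _ ⟨i, rfl⟩
    exact (hb i).imp fun d hd => ι_mem_tensorDim g hd
  · rintro _ ⟨i, rfl⟩
    exact ι_mem_augIdeal _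

/-- A functional `f` on `V` induces an operator on the tensor algebra which removes the first
letter `v` of a word and multiplies by `f v`. -/
theorem exists_removeFirst (f : V →ₗ[F] F) :
    ∃ D : TensorAlgebra F V →ₗ[F] TensorAlgebra F V, ∀ v a, D (ι F v * a) = f v • a := by
  let μ : TensorAlgebra F V →ₐ[F] Matrix (Fin 2) (Fin 2) (TensorAlgebra F V) :=
    TensorAlgebra.lift F
      { toFun v := !![0, algebraMap F _ (f v); 0, ι F v]
        map_add' v w := by ext i j; fin_cases i <;> fin_cases j <;> simp
        map_smul' c v := by ext i j; fin_cases i <;> fin_cases j <;> simp [Algebra.smul_def] }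
  have hμ (v : V) : μ (ι F v) = !![0, algebraMap F _ (f v); 0, ι F v] :=
    TensorAlgebra.lift_ι_apply _ _
  have key (a : TensorAlgebra F V) : μ a 1 0 = 0 ∧ μ a 1 1 = a := by
    induction a using TensorAlgebra.induction with
    | algebraMap r => simp [AlgHom.commutes, Matrix.algebraMap_matrix_apply]
    | ι x => simp [hμ]
    | mul a b ha hb => simp [Matrix.mul_apply, ha, hb]
    | add a b ha hb => simp [ha, hb]
  refine ⟨{ toFun a := μ a 0 1, map_add' := by simp, map_smul' := by simp }, fun v a => ?_⟩
  simp [Matrix.mul_apply, hμ, key, Algebra.smul_def]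

/-- A functional `f` on `V` induces an operator on the tensor algebra which removes the last
letter `v` of a word and multiplies by `f v`. -/
theorem exists_removeLast (f : V →ₗ[F] F) :
    ∃ D : TensorAlgebra F V →ₗ[F] TensorAlgebra F V, ∀ v a, D (a * ι F v) = f v • a := by
  let μ : TensorAlgebra F V →ₐ[F] Matrix (Fin 2) (Fin 2) (TensorAlgebra F V) :=
    TensorAlgebra.lift F
      { toFun v := !![ι F v, algebraMap F _ (f v); 0, 0]
        map_add' v w := by ext i j; fin_cases i <;> fin_cases j <;> simp
        map_smul' c v := by ext i j; fin_cases i <;> fin_cases j <;> simp [Algebra.smul_def] }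
  have hμ (v : V) : μ (ι F v) = !![ι F v, algebraMap F _ (f v); 0, 0] :=
    TensorAlgebra.lift_ι_apply _ _
  have key (a : TensorAlgebra F V) : μ a 1 0 = 0 ∧ μ a 0 0 = a := by
    induction a using TensorAlgebra.induction with
    | algebraMap r => simp [AlgHom.commutes, Matrix.algebraMap_matrix_apply]
    | ι x => simp [hμ]
    | mul a b ha hb => simp [Matrix.mul_apply, ha, hb]
    | add a b ha hb => simp [ha, hb]
  refine ⟨{ toFun a := μ a 0 1, map_add' := by simp, map_smul' := by simp }, fun v a => ?_⟩
  simp [Matrix.mul_apply, hμ, key, Algebra.smul_def, Algebra.commutes]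

theorem linearIndependent_mulOpposite_ι {B : Type*} (b : Module.Basis B F V) :
    LinearIndependent (TensorAlgebra F V)ᵐᵒᵖ (ι F ∘ b) := by
  rw [linearIndependent_iff]
  intro l hl
  ext i
  obtain ⟨D, hD⟩ := exists_removeFirst (b.coord i)
  have key (l : B →₀ (TensorAlgebra F V)ᵐᵒᵖ) :
      D (Finsupp.linearCombination _ (ι F ∘ b) l) = (l i).unop := by
    induction l using Finsupp.induction_linear with
    | zero => simp
    | add l l' h h' => rw [map_add, map_add, h, h', Finsupp.add_apply, MulOpposite.unop_add]
    | single j c =>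
      classical
      simp only [Finsupp.linearCombination_single, MulOpposite.smul_eq_mul_unop,
        Function.comp_apply, hD, Module.Basis.coord_apply, Module.Basis.repr_self,
        Finsupp.single_apply]
      split_ifs <;> simp
  have := key l
  rw [hl, map_zero] at this
  exact MulOpposite.unop_injective this.symm

theorem linearIndependent_ι {B : Type*} (b : Module.Basis B F V) :
    LinearIndependent (TensorAlgebra F V) (ι F ∘ b) := by
  rw [linearIndependent_iff]
  intro l hl
  ext i
  obtain ⟨D, hD⟩ := exists_removeLast (b.coord i)
  have key (l : B →₀ TensorAlgebra F V) :
      D (Finsupp.linearCombination _ (ι F ∘ b) l) = l i := by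
    induction l using Finsupp.induction_linear with
    | zero => simp
    | add l l' h h' => rw [map_add, map_add, h, h', Finsupp.add_apply]
    | single j c =>
      classical
      simp only [Finsupp.linearCombination_single, smul_eq_mul,
        Function.comp_apply, hD, Module.Basis.coord_apply, Module.Basis.repr_self,
        Finsupp.single_apply]
      split_ifs <;> simp
  have := key l
  rw [hl, map_zero] at this
  exact this.symm

end GradedLieAlg

/-! ### Decomposable elements of subalgebras of a free Lie algebra -/

namespace GradedLieAlg

open TensorAlgebra (ι)

variable {F : Type u} [Field F] {V : Type v} [AddCommGroup V] [Module F V]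

/-- `S` is graded by word length. -/
def IsLengthGraded (S : Submodule F (TensorAlgebra F V)) : Prop :=
  ∀ x ∈ S, ∀ n, lengthProj F V n x ∈ S

theorem IsLengthGraded.le_iSup {S : Submodule F (TensorAlgebra F V)} (hS : IsLengthGraded S) :
    S ≤ ⨆ n, S ⊓ wordSpan F V n := by
  intro x hx
  obtain ⟨s, hs⟩ := exists_sum_lengthProj x
  rw [hs]
  exact Submodule.sum_mem _ fun n _ => Submodule.mem_iSup_of_mem n ⟨hS x hx n, lengthProj_mem n x⟩

theorem isLengthGraded_of_le_iSup {S : Submodule F (TensorAlgebra F V)}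
    (hS : S ≤ ⨆ n, S ⊓ wordSpan F V n) : IsLengthGraded S := by
  intro x hx n
  have : (⨆ k, S ⊓ wordSpan F V k) ≤ S.comap (lengthProj F V n) := by
    refine iSup_le fun k y hy => ?_
    rw [Submodule.mem_comap]
    by_cases h : k = n
    · subst h
      rw [lengthProj_of_mem hy.2]
      exact hy.1
    · rw [lengthProj_of_mem_ne hy.2 h]
      exact Submodule.zero_mem _
  exact this (hS hx)

theorem IsLengthGraded.inf {S S' : Submodule F (TensorAlgebra F V)} (hS : IsLengthGraded S)
    (hS' : IsLengthGraded S') : IsLengthGraded (S ⊓ S') :=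
  fun x hx n => ⟨hS x hx.1 n, hS' x hx.2 n⟩

theorem isLengthGraded_lieSpan (g : DimGrading F V) {s : Set (TensorAlgebra F V)}
    (hs : ∀ x ∈ s, ∃ d, x ∈ tensorDim g d) (hs' : ∀ x ∈ s, ∃ n, x ∈ wordSpan F V n) :
    IsLengthGraded ((tensorLie g).lieSpan s) := by
  refine isLengthGraded_of_le_iSup (lieSpan_le_of_homogeneous _ hs ?_ ?_)
  · intro x hx
    obtain ⟨n, hn⟩ := hs' x hx
    exact Submodule.mem_iSup_of_mem n ⟨subset_lieSpan _ _ hx, hn⟩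
  · intro i j x y _ _ hx hy
    refine (Submodule.map₂_le.2 ?_) (Submodule.apply_mem_map₂ (tensorLie g).bracket hx hy)
    clear * -
    intro x hx y hy
    induction hx using Submodule.iSup_induction' with
    | mem p a ha =>
      induction hy using Submodule.iSup_induction' with
      | mem q b hb =>
        exact Submodule.mem_iSup_of_mem (p + q)
          ⟨(lieSpan_isSubalgebra _ _).bracket_mem _ ha.1 _ hb.1, bracket_mem_wordSpan g ha.2 hb.2⟩
      | zero => rw [map_zero]; exact Submodule.zero_mem _
      | add b b' _ _ h h' => rw [map_add]; exact Submodule.add_mem _ h h'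
    | zero => rw [map_zero, LinearMap.zero_apply]; exact Submodule.zero_mem _
    | add a a' _ _ h h' => rw [map_add, LinearMap.add_apply]; exact Submodule.add_mem _ h h'

theorem finiteDimensional_lieSpan_inf (g : DimGrading F V) {s : Set (TensorAlgebra F V)}
    (hs : ∀ x ∈ s, ∃ d, x ∈ tensorDim g d) (hs' : s ⊆ wordSpan F V 1) (hfin : s.Finite) (n : ℕ) :
    FiniteDimensional F ↥((tensorLie g).lieSpan s ⊓ wordSpan F V n) := by
  set R : Submodule F (TensorAlgebra F V) := Submodule.span F s with hR
  have hRle (k : ℕ) : R ^ k ≤ wordSpan F V k := by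
    refine pow_le_pow_left' ?_ k
    rw [hR, Submodule.span_le]
    simpa [wordSpan] using hs'
  have hle : (tensorLie g).lieSpan s ≤ ⨆ k : ℕ, R ^ k := by
    refine lieSpan_le_of_homogeneous _ hs ?_ ?_
    · intro x hx
      refine Submodule.mem_iSup_of_mem 1 ?_
      rw [pow_one]
      exact Submodule.subset_span hx
    · intro i j x y hx hy hxK hyK
      have hmul : (⨆ k : ℕ, R ^ k) * (⨆ k : ℕ, R ^ k) ≤ ⨆ k : ℕ, R ^ k := by
        rw [Submodule.iSup_mul]
        refine iSup_le fun p => ?_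
        rw [Submodule.mul_iSup]
        refine iSup_le fun q => ?_
        rw [← pow_add]
        exact le_iSup (fun k : ℕ => R ^ k) (p + q)
      rw [tensorLie_bracket g hx hy]
      exact sub_mem (hmul (Submodule.mul_mem_mul hxK hyK))
        (sign_smul_mem _ (hmul (Submodule.mul_mem_mul hyK hxK)))
  have hle' : (tensorLie g).lieSpan s ⊓ wordSpan F V n ≤ R ^ n := by
    rintro x ⟨hx, hxn⟩
    have : (⨆ k : ℕ, R ^ k) ≤ (R ^ n).comap (lengthProj F V n) := by
      refine iSup_le fun k y hy => ?_
      rw [Submodule.mem_comap]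
      by_cases h : k = n
      · subst h
        rwa [lengthProj_of_mem (hRle k hy)]
      · rw [lengthProj_of_mem_ne (hRle k hy) h]
        exact Submodule.zero_mem _
    have h := this (hle hx)
    rwa [Submodule.mem_comap, lengthProj_of_mem hxn] at h
  have : FiniteDimensional F ↥(R ^ n) :=
    Module.Finite.iff_fg.2 ((Submodule.fg_span hfin).pow n)
  exact Submodule.finiteDimensional_of_le hle'

/-- A bigraded Lie subalgebra of the tensor algebra, without elements of length zero and
finite-dimensional in each length, that is generated by a right-independent family. -/
structure IsLengthGradedFree (g : DimGrading F V) (S : Submodule F (TensorAlgebra F V)) :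
    Prop where
  isSubalgebra : (tensorLie g).IsSubalgebra S
  isLengthGraded : IsLengthGraded S
  isRightFree : IsRightFree (tensorGrading g) (tensorDim_mul g) S
  le_augIdeal : S ≤ augIdeal F V
  finite : ∀ n, FiniteDimensional F ↥(S ⊓ wordSpan F V n)

theorem isLengthGradedFree_lieSpan (g : DimGrading F V) {B : Type*} (b : Module.Basis B F V)
    (hb : ∀ i, ∃ d, b i ∈ g.dim d) (X : Finset B) :
    IsLengthGradedFree g ((tensorLie g).lieSpan ((ι F ∘ b) '' X)) := by
  have hs : ∀ x ∈ (ι F ∘ b) '' (X : Set B), ∃ d, x ∈ tensorDim g d := by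
    rintro _ ⟨i, -, rfl⟩
    exact (hb i).imp fun d hd => ι_mem_tensorDim g hd
  have hs' : (ι F ∘ b) '' (X : Set B) ⊆ wordSpan F V 1 := by
    rintro _ ⟨i, -, rfl⟩
    simp [wordSpan]
  refine ⟨lieSpan_isSubalgebra _ _, isLengthGraded_lieSpan g hs fun x hx => ⟨1, hs' hx⟩, ?_,
    lieSpan_le_augIdeal g hs ?_,
    finiteDimensional_lieSpan_inf g hs hs' (X.finite_toSet.image _)⟩
  · refine ⟨Fin X.card, fun i => ι F (b (X.equivFin.symm i)), fun i => ?_, ?_, ?_⟩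
    · exact (hb _).imp fun d hd => ι_mem_tensorDim g hd
    · exact (linearIndependent_mulOpposite_ι b).comp (fun i => (X.equivFin.symm i : B))
        (Subtype.val_injective.comp X.equivFin.symm.injective)
    · change (tensorLie g).lieSpan _ = _
      congr 1
      ext x
      constructor
      · rintro ⟨i, rfl⟩
        exact ⟨_, (X.equivFin.symm i).2, rfl⟩
      · rintro ⟨i, hi, rfl⟩
        exact ⟨X.equivFin ⟨i, hi⟩, by simp⟩
  · rintro _ ⟨i, -, rfl⟩
    exact ι_mem_augIdeal _

/-- The part of length `m` of `[S, S]` is spanned by the brackets of elements of `S` of smaller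
lengths, because `S` has no elements of length zero. -/
theorem lengthProj_derived_mem (g : DimGrading F V) {S K : Submodule F (TensorAlgebra F V)}
    (hS : IsLengthGraded S) (hSε : S ≤ augIdeal F V) (m : ℕ)
    (hK : ∀ p q, p + q = m → p < m → q < m → ∀ a ∈ S ⊓ wordSpan F V p, ∀ b ∈ S ⊓ wordSpan F V q,
      (tensorLie g).bracket a b ∈ K)
    {x : TensorAlgebra F V} (hx : x ∈ (tensorLie g).derived S) : lengthProj F V m x ∈ K := by
  have : (tensorLie g).derived S ≤ K.comap (lengthProj F V m) := by
    refine Submodule.map₂_le.2 fun a ha b hb => ?_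
    replace ha := hS.le_iSup ha
    replace hb := hS.le_iSup hb
    induction ha using Submodule.iSup_induction' with
    | mem p a ha =>
      induction hb using Submodule.iSup_induction' with
      | mem q b hb =>
        rw [Submodule.mem_comap]
        have hab := bracket_mem_wordSpan g ha.2 hb.2
        by_cases hpq : p + q = m
        · subst hpq
          rw [lengthProj_of_mem hab]
          rcases Nat.eq_zero_or_pos p with rfl | hp
          · rw [eq_zero_of_mem_wordSpan_zero ha.2 (hSε ha.1), map_zero, LinearMap.zero_apply]
            exact Submodule.zero_mem _
          rcases Nat.eq_zero_or_pos q with rfl | hq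
          · rw [eq_zero_of_mem_wordSpan_zero hb.2 (hSε hb.1), map_zero]
            exact Submodule.zero_mem _
          exact hK p q rfl (by omega) (by omega) a ha b hb
        · rw [lengthProj_of_mem_ne hab hpq]
          exact Submodule.zero_mem _
      | zero => rw [map_zero]; exact Submodule.zero_mem _
      | add b b' _ _ h h' => rw [map_add]; exact Submodule.add_mem _ h h'
    | zero => rw [map_zero, LinearMap.zero_apply]; exact Submodule.zero_mem _
    | add a a' _ _ h h' => rw [map_add, LinearMap.add_apply]; exact Submodule.add_mem _ h h'
  exact this hx

/-- If `S` contains `J` and agrees with it in lengths less than `m` but not in length `m`, then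
`S` can be replaced by an ideal of codimension one that contains `J`. -/
theorem IsLengthGradedFree.exists_lt (h2 : (2 : F) ≠ 0) {g : DimGrading F V}
    {S J : Submodule F (TensorAlgebra F V)} (hS : IsLengthGradedFree g S) (hJS : J ≤ S)
    (hJ : (tensorLie g).IsSubalgebra J) (hJlen : IsLengthGraded J) (m : ℕ)
    (hSJ : ∀ n < m, S ⊓ wordSpan F V n ≤ J) (hm : ¬ S ⊓ wordSpan F V m ≤ J) :
    ∃ S', IsLengthGradedFree g S' ∧ J ≤ S' ∧ S' ≤ S ∧
      S' ⊓ wordSpan F V m < S ⊓ wordSpan F V m := by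
  obtain ⟨x, hx, hxJ⟩ := SetLike.not_le_iff_exists.1 hm
  obtain ⟨d, hd⟩ : ∃ d, (tensorGrading g).proj d x ∉ J := by
    by_contra! hc
    exact hxJ ((tensorGrading g).mem_of_proj_mem hc)
  set x' := (tensorGrading g).proj d x with hx'
  have hx'S : x' ∈ S ⊓ wordSpan F V m :=
    ⟨hS.isSubalgebra.homogeneous x hx.1 d, isHomogeneous_wordSpan g m x hx.2 d⟩
  have hx'd : x' ∈ (tensorGrading g).dim d := (tensorGrading g).proj_mem d x
  obtain ⟨f, hfx, hfJ⟩ := Submodule.exists_le_ker_of_notMem hd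
  -- A functional concentrated in length `m` and dimension `d`, which vanishes on `J`.
  set φ : TensorAlgebra F V →ₗ[F] F := f ∘ₗ (tensorGrading g).proj d ∘ₗ lengthProj F V m with hφ
  have hφ_apply (z) : φ z = f ((tensorGrading g).proj d (lengthProj F V m z)) := rfl
  have hφJ : J ≤ LinearMap.ker φ := fun z hz =>
    hfJ (hJ.homogeneous _ (hJlen z hz m) d)
  have hφx : φ x' ≠ 0 := by
    rw [hφ_apply, lengthProj_of_mem hx'S.2, (tensorGrading g).proj_of_mem hx'd]
    exact hfx
  have hφder : (tensorLie g).derived S ≤ LinearMap.ker φ := fun z hz =>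
    hfJ (hJ.homogeneous _ (lengthProj_derived_mem g hS.isLengthGraded hS.le_augIdeal m
      (fun p q _ hp hq a ha b hb => hJ.bracket_mem _ (hSJ p hp ha) _ (hSJ q hq hb)) hz) d)
  have hφd : ∀ e, ∀ z ∈ (tensorGrading g).dim e, e ≠ d → φ z = 0 := by
    intro e z hz hed
    rw [hφ_apply, proj_lengthProj, (tensorGrading g).proj_of_mem_ne hed.symm hz, map_zero, map_zero]
  have hφlen : ∀ n, ∀ z ∈ wordSpan F V n, n ≠ m → φ z = 0 := by
    intro n z hz hn
    rw [hφ_apply, lengthProj_of_mem_ne hz hn, map_zero, map_zero]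
  have hsub : (tensorLie g).IsSubalgebra (S ⊓ LinearMap.ker φ) := by
    refine ⟨?_, fun a ha b hb => ⟨hS.isSubalgebra.bracket_mem _ ha.1 _ hb.1,
      hφder (bracket_mem_derived _ ha.1 hb.1)⟩⟩
    refine hS.isSubalgebra.homogeneous.inf fun z hz e => ?_
    by_cases hed : e = d
    · subst hed
      rw [LinearMap.mem_ker, hφ_apply] at hz ⊢
      change f ((tensorGrading g).proj e (lengthProj F V m ((tensorGrading g).proj e z))) = 0
      rw [← proj_lengthProj, (tensorGrading g).proj_of_mem ((tensorGrading g).proj_mem e _)]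
      exact hz
    · exact hφd e _ ((tensorGrading g).proj_mem e z) hed
  have hlen : IsLengthGraded (S ⊓ LinearMap.ker φ) := by
    refine hS.isLengthGraded.inf fun z hz n => ?_
    by_cases hn : n = m
    · subst hn
      rw [LinearMap.mem_ker, hφ_apply] at hz ⊢
      rw [lengthProj_of_mem (lengthProj_mem n z)]
      exact hz
    · exact hφlen n _ (lengthProj_mem n z) hn
  have hφS : ¬ S ≤ LinearMap.ker φ := fun h => hφx (h hx'S.1)
  refine ⟨S ⊓ LinearMap.ker φ, ⟨hsub, hlen, hS.isRightFree.inf_ker _ h2 hφS hφder hφd hsub,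
    inf_le_left.trans hS.le_augIdeal, fun n => ?_⟩, le_inf hJS hφJ, inf_le_left, ?_⟩
  · have := hS.finite n
    exact Submodule.finiteDimensional_of_le (inf_le_inf_right (wordSpan F V n) inf_le_left)
  · exact lt_of_le_of_ne (inf_le_inf_right _ inf_le_left) fun h => hφx ((h ▸ hx'S).1.2)

/-- A subalgebra `J` of `S` can be approximated from above: there is a subalgebra generated by a
right-independent family that contains `J` and agrees with it in all lengths less than `N`. In
each length the approximation ends because `S` is finite-dimensional there. -/
theorem IsLengthGradedFree.exists_agree (h2 : (2 : F) ≠ 0) {g : DimGrading F V}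
    {S J : Submodule F (TensorAlgebra F V)} (hS : IsLengthGradedFree g S) (hJS : J ≤ S)
    (hJ : (tensorLie g).IsSubalgebra J) (hJlen : IsLengthGraded J) (N : ℕ) :
    ∃ S', IsLengthGradedFree g S' ∧ J ≤ S' ∧ ∀ n < N, S' ⊓ wordSpan F V n ≤ J := by
  induction N with
  | zero => exact ⟨S, hS, hJS, by simp⟩
  | succ m ih =>
    by_contra hc
    obtain ⟨S₀, h₀, h₀J, h₀m⟩ := ih
    have key : ∀ (k : ℕ) (S' : Submodule F (TensorAlgebra F V)), IsLengthGradedFree g S' →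
        J ≤ S' → (∀ n < m, S' ⊓ wordSpan F V n ≤ J) →
        Module.finrank F ↥(S' ⊓ wordSpan F V m) = k → False := by
      intro k
      induction k using Nat.strong_induction_on with
      | _ k ihk =>
        intro S' h' hJ' hm' hk
        have hnot : ¬ S' ⊓ wordSpan F V m ≤ J := fun hle => hc ⟨S', h', hJ', fun n hn => by
          rcases Nat.lt_succ_iff_lt_or_eq.1 hn with h | rfl
          exacts [hm' n h, hle]⟩
        obtain ⟨S'', h'', hJ'', hle, hlt⟩ := h'.exists_lt h2 hJ' hJ hJlen m hm' hnot
        have := h'.finite m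
        exact ihk _ (hk ▸ Submodule.finrank_lt_finrank_of_lt hlt) S'' h'' hJ''
          (fun n hn => (inf_le_inf_right _ hle).trans (hm' n hn)) rfl
    exact key _ S₀ h₀ h₀J h₀m rfl

/-- The approximation of `J` from above shows that an element of `J ⊓ J * (T V)_+` is decomposable
in a subalgebra that agrees with `J` in all lengths that matter. -/
theorem inf_mul_augIdeal_le_derived_of_le (h2 : (2 : F) ≠ 0) {g : DimGrading F V}
    {S J : Submodule F (TensorAlgebra F V)} (hS : IsLengthGradedFree g S) (hJS : J ≤ S)
    (hJ : (tensorLie g).IsSubalgebra J) (hJlen : IsLengthGraded J) :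
    J ⊓ J * augIdeal F V ≤ (tensorLie g).derived J := by
  rintro x ⟨hxJ, hx⟩
  obtain ⟨s, hs⟩ := exists_sum_lengthProj x
  obtain ⟨S', hS', hJS', hagree⟩ := hS.exists_agree h2 hJS hJ hJlen (s.sup id + 1)
  have hxS' : x ∈ (tensorLie g).derived S' :=
    hS'.isRightFree.inf_mul_ker_le _ _ TensorAlgebra.algebraMapInv hS'.le_augIdeal
      ⟨hJS' hxJ, mul_le_mul' hJS' le_rfl hx⟩
  rw [hs]
  refine Submodule.sum_mem _ fun n hn => ?_
  have hns : n ≤ s.sup id := Finset.le_sup (f := id) hn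
  exact lengthProj_derived_mem g hS'.isLengthGraded hS'.le_augIdeal n
    (fun p q _ hp hq a ha b hb => bracket_mem_derived _ (hagree p (by omega) ha)
      (hagree q (by omega) hb)) hxS'

/-- The key property of a bigraded subalgebra `J` of a free Lie algebra `𝕃V`: an element of `J`
that lies in the right ideal `J · (T V)_+` is decomposable in `J`. -/
theorem inf_mul_augIdeal_le_derived (h2 : (2 : F) ≠ 0) (g : DimGrading F V)
    {J : Submodule F (TensorAlgebra F V)} (hJ : (tensorLie g).IsSubalgebra J)
    (hJlen : IsLengthGraded J) (hJfree : J ≤ freeLieSubmodule g) :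
    J ⊓ J * augIdeal F V ≤ (tensorLie g).derived J := by
  classical
  obtain ⟨B, b, hb⟩ := exists_homogeneous_basis g
  set S : Finset B → Submodule F (TensorAlgebra F V) :=
    fun X => (tensorLie g).lieSpan ((ι F ∘ b) '' X) with hS
  have hmono : Monotone S := fun X Y hXY =>
    lieSpan_mono _ (Set.image_mono (Finset.coe_subset.2 hXY))
  have hcover : freeLieSubmodule g ≤ ⨆ X, S X := by
    rw [freeLieSubmodule_eq g b.span_eq]
    refine lieSpan_le_of_homogeneous _ ?_ ?_ ?_
    · rintro _ ⟨i, rfl⟩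
      exact (hb i).imp fun d hd => ι_mem_tensorDim g hd
    · rintro _ ⟨i, rfl⟩
      exact Submodule.mem_iSup_of_mem {i} (subset_lieSpan _ _ ⟨i, by simp, rfl⟩)
    · intro i j x y _ _ hx hy
      obtain ⟨X, hX⟩ := (Submodule.mem_iSup_of_directed _ hmono.directed_le).1 hx
      obtain ⟨Y, hY⟩ := (Submodule.mem_iSup_of_directed _ hmono.directed_le).1 hy
      exact Submodule.mem_iSup_of_mem (X ∪ Y) ((lieSpan_isSubalgebra _ _).bracket_mem _
        (hmono Finset.subset_union_left hX) _ (hmono Finset.subset_union_right hY))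
  have hmem : ∀ x ∈ J, ∃ X, x ∈ S X := fun x hx =>
    (Submodule.mem_iSup_of_directed _ hmono.directed_le).1 (hcover (hJfree hx))
  have hmul : ∀ x ∈ J * augIdeal F V, ∃ X, x ∈ (J ⊓ S X) * augIdeal F V := by
    intro x hx
    induction hx using Submodule.mul_induction_on' with
    | mem_mul_mem j hj a ha =>
      obtain ⟨X, hX⟩ := hmem j hj
      exact ⟨X, Submodule.mul_mem_mul ⟨hj, hX⟩ ha⟩
    | add x _ y _ hx hy =>
      obtain ⟨X, hX⟩ := hx
      obtain ⟨Y, hY⟩ := hy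
      exact ⟨X ∪ Y, add_mem
        (mul_le_mul' (inf_le_inf_left J (hmono Finset.subset_union_left)) le_rfl hX)
        (mul_le_mul' (inf_le_inf_left J (hmono Finset.subset_union_right)) le_rfl hY)⟩
  rintro x ⟨hxJ, hx⟩
  obtain ⟨X, hX⟩ := hmem x hxJ
  obtain ⟨Y, hY⟩ := hmul x hx
  have hZ := isLengthGradedFree_lieSpan g b hb (X ∪ Y)
  refine derived_mono _ inf_le_left (inf_mul_augIdeal_le_derived_of_le (J := J ⊓ S (X ∪ Y)) h2 hZ
    inf_le_right (hJ.inf hZ.isSubalgebra) (hJlen.inf hZ.isLengthGraded) ⟨⟨hxJ, ?_⟩, ?_⟩)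
  · exact hmono Finset.subset_union_left hX
  · exact mul_le_mul' (inf_le_inf_left J (hmono Finset.subset_union_right)) le_rfl hY

end GradedLieAlg

/-! ### Right independence of minimal generators, and injectivity on tensor algebras -/

namespace GradedLieAlg

open TensorAlgebra (ι)

variable {F : Type u} [Field F] {V : Type v} [AddCommGroup V] [Module F V]

/-- The span of the words of length less than `N`. -/
def wordSpanLT (F : Type u) [Field F] (V : Type v) [AddCommGroup V] [Module F V] (N : ℕ) :
    Submodule F (TensorAlgebra F V) :=
  ⨆ n : Fin N, wordSpan F V n

theorem wordSpanLT_zero : wordSpanLT F V 0 = ⊥ :=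
  iSup_of_empty _

theorem wordSpanLT_succ_le (N : ℕ) : wordSpanLT F V (N + 1) ≤
    1 ⊔ wordSpanLT F V N * LinearMap.range (ι F : V →ₗ[F] TensorAlgebra F V) := by
  refine iSup_le fun ⟨n, hn⟩ => ?_
  cases n with
  | zero => exact le_sup_of_le_left (by simp [wordSpan])
  | succ n =>
    refine le_sup_of_le_right ?_
    rw [wordSpan, pow_succ]
    exact mul_le_mul' (le_iSup (fun n : Fin N => wordSpan F V n) ⟨n, by omega⟩) le_rfl

theorem wordSpanLT_succ_le' (N : ℕ) : wordSpanLT F V (N + 1) ≤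
    1 ⊔ LinearMap.range (ι F : V →ₗ[F] TensorAlgebra F V) * wordSpanLT F V N := by
  refine iSup_le fun ⟨n, hn⟩ => ?_
  cases n with
  | zero => exact le_sup_of_le_left (by simp [wordSpan])
  | succ n =>
    refine le_sup_of_le_right ?_
    rw [wordSpan, pow_succ']
    exact mul_le_mul' le_rfl (le_iSup (fun n : Fin N => wordSpan F V n) ⟨n, by omega⟩)

theorem wordSpanLT_mono : Monotone (wordSpanLT F V) := fun _ _ h =>
  iSup_le fun n => le_iSup (fun n : Fin _ => wordSpan F V n) (Fin.castLE h n)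

theorem exists_mem_wordSpanLT (a : TensorAlgebra F V) : ∃ N, a ∈ wordSpanLT F V N := by
  obtain ⟨s, hs⟩ := exists_sum_lengthProj a
  refine ⟨s.sup id + 1, ?_⟩
  rw [hs]
  refine Submodule.sum_mem _ fun n hn => ?_
  have hns : n ≤ s.sup id := Finset.le_sup (f := id) hn
  exact Submodule.mem_iSup_of_mem (⟨n, by omega⟩ : Fin (s.sup id + 1)) (lengthProj_mem n a)

/-- A tensor of length at most `N` is a constant plus a combination of tensors of length less than
`N`, multiplied on the right by basis vectors. -/
theorem exists_eq_add_linearCombination {B : Type*} (b : Module.Basis B F V) {N : ℕ}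
    {a : TensorAlgebra F V} (ha : a ∈ wordSpanLT F V (N + 1)) :
    ∃ (c : F) (β : B →₀ TensorAlgebra F V), (∀ v, β v ∈ wordSpanLT F V N) ∧
      a = algebraMap F _ c + Finsupp.linearCombination _ (ι F ∘ b) β := by
  obtain ⟨c, hc, r, hr, rfl⟩ := Submodule.mem_sup.1 (wordSpanLT_succ_le N ha)
  obtain ⟨c, rfl⟩ := Submodule.mem_one.1 hc
  suffices h : ∃ β : B →₀ TensorAlgebra F V, (∀ v, β v ∈ wordSpanLT F V N) ∧
      r = Finsupp.linearCombination _ (ι F ∘ b) β by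
    obtain ⟨β, hβ, rfl⟩ := h
    exact ⟨c, β, hβ, rfl⟩
  clear ha hc
  induction hr using Submodule.mul_induction_on' with
  | mem_mul_mem e he x hx =>
    obtain ⟨v, rfl⟩ := hx
    refine ⟨(b.repr v).mapRange (fun t => t • e) (zero_smul _ _), fun i => ?_, ?_⟩
    · rw [Finsupp.mapRange_apply]
      exact Submodule.smul_mem _ _ he
    · conv_lhs => rw [← b.linearCombination_repr v]
      rw [Finsupp.linearCombination_apply, Finsupp.linearCombination_apply,
        Finsupp.sum_mapRange_index (by simp), map_finsuppSum, Finsupp.mul_sum]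
      refine Finsupp.sum_congr fun i _ => ?_
      simp
  | add x _ y _ hx hy =>
    obtain ⟨β, hβ, rfl⟩ := hx
    obtain ⟨β', hβ', rfl⟩ := hy
    exact ⟨β + β', fun v => add_mem (hβ v) (hβ' v), (map_add _ _ _).symm⟩

/-- If the elements of `J` that lie in `J · (T V)_+` belong to `D`, then elements of `J` that are
linearly independent modulo `D` are right-independent over the tensor algebra: peel off the
coefficients letter by letter from the right. -/
theorem linearIndependent_mulOpposite_of_mkQ {J D : Submodule F (TensorAlgebra F V)}
    (hJ : J ⊓ J * augIdeal F V ≤ D) {κ : Type*} {x : κ → TensorAlgebra F V}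
    (hxJ : ∀ i, x i ∈ J) (hx : LinearIndependent F (D.mkQ ∘ x)) :
    LinearIndependent (TensorAlgebra F V)ᵐᵒᵖ x := by
  let b := Module.Basis.ofVectorSpace F V
  rw [linearIndependent_iff']
  intro s l hl
  suffices key : ∀ (N : ℕ) (a : κ → TensorAlgebra F V), (∀ i ∈ s, a i ∈ wordSpanLT F V N) →
      ∑ i ∈ s, x i * a i = 0 → ∀ i ∈ s, a i = 0 by
    choose N hN using fun i => exists_mem_wordSpanLT (l i).unop
    intro i hi
    refine MulOpposite.unop_injective (key (s.sup N) (fun i => (l i).unop) (fun i hi => ?_) ?_ i hi)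
    · exact wordSpanLT_mono (Finset.le_sup hi) (hN i)
    · rw [← hl]
      exact Finset.sum_congr rfl fun i _ => (MulOpposite.smul_eq_mul_unop _ _).symm
  intro N
  induction N with
  | zero =>
    intro a ha _ i hi
    have := ha i hi
    rwa [wordSpanLT_zero] at this
  | succ N ih =>
    intro a ha hsum
    have hdec : ∀ i, ∃ (c : F) (β : _ →₀ TensorAlgebra F V), i ∈ s →
        (∀ v, β v ∈ wordSpanLT F V N) ∧
          a i = algebraMap F _ c + Finsupp.linearCombination _ (ι F ∘ b) β := by
      intro i
      by_cases hi : i ∈ s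
      · obtain ⟨c, β, h⟩ := exists_eq_add_linearCombination b (ha i hi)
        exact ⟨c, β, fun _ => h⟩
      · exact ⟨0, 0, fun h => absurd h hi⟩
    choose c β hcβ using hdec
    have hsplit : ∑ i ∈ s, c i • x i +
        ∑ i ∈ s, x i * Finsupp.linearCombination _ (ι F ∘ b) (β i) = 0 := by
      rw [← hsum, ← Finset.sum_add_distrib]
      refine Finset.sum_congr rfl fun i hi => ?_
      rw [(hcβ i hi).2, mul_add, ← Algebra.commutes, ← Algebra.smul_def]
    have haug (i) : Finsupp.linearCombination _ (ι F ∘ b) (β i) ∈ augIdeal F V := by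
      rw [Finsupp.linearCombination_apply]
      refine Submodule.sum_mem (t := (β i).support) _ fun v _ => ?_
      have := ι_mem_augIdeal (F := F) (b v)
      rw [LinearMap.mem_ker, AlgHom.toLinearMap_apply] at this ⊢
      simp only [smul_eq_mul, map_mul, Function.comp_apply, this, mul_zero]
    have hc : ∀ i ∈ s, c i = 0 := by
      have hD : ∑ i ∈ s, c i • x i ∈ D := by
        refine hJ ⟨Submodule.sum_mem _ fun i _ => Submodule.smul_mem _ _ (hxJ i), ?_⟩
        rw [eq_neg_of_add_eq_zero_left hsplit]
        exact neg_mem (Submodule.sum_mem _ fun i _ => Submodule.mul_mem_mul (hxJ i) (haug i))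
      refine linearIndependent_iff'.1 hx s c ?_
      rw [← (Submodule.Quotient.mk_eq_zero D).2 hD, ← Submodule.mkQ_apply, map_sum]
      exact Finset.sum_congr rfl fun i _ => (map_smul D.mkQ _ _).symm
    have hβ0 : ∑ i ∈ s, x i • β i = 0 := by
      refine linearIndependent_ι b ?_
      have h0 : ∑ i ∈ s, c i • x i = 0 :=
        Finset.sum_eq_zero fun i hi => by rw [hc i hi, zero_smul]
      rw [h0, zero_add] at hsplit
      rw [map_sum, map_zero, ← hsplit]
      exact Finset.sum_congr rfl fun i _ => map_smul _ _ _
    have hβ : ∀ v, ∀ i ∈ s, β i v = 0 := fun v =>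
      ih (fun i => β i v) (fun i hi => (hcβ i hi).1 v) (by
        have := DFunLike.congr_fun hβ0 v
        rw [Finsupp.finsetSum_apply] at this
        exact this)
    intro i hi
    have hβi : β i = 0 := Finsupp.ext fun v => hβ v i hi
    rw [(hcβ i hi).2, hc i hi, hβi, map_zero, map_zero, add_zero]

/-- A right-independent family in the augmentation ideal generates a free associative algebra. -/
theorem injective_of_linearIndependent_mulOpposite {W : Type w} [AddCommGroup W] [Module F W]
    {κ : Type*} (b : Module.Basis κ F W) {x : κ → TensorAlgebra F V}
    (hx : LinearIndependent (TensorAlgebra F V)ᵐᵒᵖ x) (hxε : ∀ i, x i ∈ augIdeal F V)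
    (η : TensorAlgebra F W →ₐ[F] TensorAlgebra F V) (hη : ∀ i, η (ι F (b i)) = x i) :
    Function.Injective η := by
  rw [injective_iff_map_eq_zero]
  intro a ha
  obtain ⟨N, hN⟩ := exists_mem_wordSpanLT a
  induction N generalizing a with
  | zero => rwa [wordSpanLT_zero] at hN
  | succ N ih =>
    obtain ⟨c, hc, r, hr, rfl⟩ := Submodule.mem_sup.1 (wordSpanLT_succ_le' N hN)
    obtain ⟨c, rfl⟩ := Submodule.mem_one.1 hc
    have hr' : ∃ β : κ →₀ TensorAlgebra F W, (∀ i, β i ∈ wordSpanLT F W N) ∧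
        r = β.sum fun i t => ι F (b i) * t := by
      clear ha hN hc
      induction hr using Submodule.mul_induction_on' with
      | mem_mul_mem y hy e he =>
        obtain ⟨v, rfl⟩ := hy
        refine ⟨(b.repr v).mapRange (fun t => t • e) (zero_smul _ _), fun i => ?_, ?_⟩
        · rw [Finsupp.mapRange_apply]
          exact Submodule.smul_mem _ _ he
        · conv_lhs => rw [← b.linearCombination_repr v]
          rw [Finsupp.linearCombination_apply, Finsupp.sum_mapRange_index (by simp),
            map_finsuppSum, Finsupp.sum_mul]
          refine Finsupp.sum_congr fun i _ => ?_
          simp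
      | add y _ z _ hy hz =>
        obtain ⟨β, hβ, rfl⟩ := hy
        obtain ⟨β', hβ', rfl⟩ := hz
        classical
        exact ⟨β + β', fun v => add_mem (hβ v) (hβ' v),
          (Finsupp.sum_add_index' (by simp) (by intros; exact mul_add _ _ _)).symm⟩
    obtain ⟨β, hβ, rfl⟩ := hr'
    have e1 : algebraMap F (TensorAlgebra F V) c + β.sum (fun i t => x i * η t) = 0 := by
      rw [← ha, map_add, AlgHom.commutes, map_finsuppSum]
      simp only [map_mul, hη]
    have hc0 : c = 0 := by
      have e2 := congrArg (TensorAlgebra.algebraMapInv (R := F) (M := V)) e1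
      rw [map_add, AlgHom.commutes, map_finsuppSum, map_zero, Finsupp.sum,
        Finset.sum_eq_zero, add_zero] at e2
      · exact e2
      · intro i _
        have := hxε i
        rw [LinearMap.mem_ker, AlgHom.toLinearMap_apply] at this
        rw [map_mul, this, zero_mul]
    rw [hc0, map_zero, zero_add] at e1
    have e3 := linearIndependent_iff'.1 hx β.support (fun i => MulOpposite.op (η (β i))) e1
    have hβ0 : β = 0 := by
      ext i
      by_cases hi : i ∈ β.support
      · exact ih (β i) (MulOpposite.op_injective (e3 i hi)) (hβ i)
      · simpa using hi
    rw [hc0, hβ0, map_zero, zero_add, Finsupp.sum_zero_index]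

end GradedLieAlg

/-! ### Filtered Lie algebras with symbols in a free Lie algebra -/

namespace GradedLieAlg

open TensorAlgebra (ι)

variable {F : Type u} [Field F] {L : Type v} [AddCommGroup L] [Module F L]
  {V : Type w} [AddCommGroup V] [Module F V]

/-- A positive exhaustive filtration of the graded Lie algebra `A`, together with an injective
morphism of bigraded Lie algebras from the associated graded Lie algebra to the free Lie algebra
`𝕃V`. The morphism is encoded by the maps `symb n`, which are relevant only on `fil n`, where
the kernel is `fil (n - 1)`. -/
structure FreeSymbol (A : GradedLieAlg F L) (g : DimGrading F V) where
  fil : ℕ → Submodule F L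
  mono : Monotone fil
  fil_zero : fil 0 = ⊥
  exhaustive : ∀ x, ∃ n, x ∈ fil n
  homogeneous : ∀ n, A.IsHomogeneous (fil n)
  bracket_mem : ∀ {p q : ℕ} {x y : L}, x ∈ fil p → y ∈ fil q → A.bracket x y ∈ fil (p + q)
  symb : ℕ → L →ₗ[F] TensorAlgebra F V
  symb_mem_wordSpan : ∀ {n : ℕ} {x : L}, x ∈ fil n → symb n x ∈ wordSpan F V n
  symb_mem_freeLie : ∀ {n : ℕ} {x : L}, x ∈ fil n → symb n x ∈ freeLieSubmodule g
  symb_mem_dim : ∀ {n : ℕ} {x : L} {d : ℤ}, x ∈ fil n → x ∈ A.dim d → symb n x ∈ tensorDim g d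
  symb_bracket : ∀ {p q : ℕ} {x y : L}, x ∈ fil p → y ∈ fil q →
    symb (p + q) (A.bracket x y) = (tensorLie g).bracket (symb p x) (symb q y)
  symb_of_mem : ∀ {n : ℕ} {x : L}, x ∈ fil n → symb (n + 1) x = 0
  mem_of_symb : ∀ {n : ℕ} {x : L}, x ∈ fil (n + 1) → symb (n + 1) x = 0 → x ∈ fil n

namespace FreeSymbol

variable {A : GradedLieAlg F L} {g : DimGrading F V} (σ : FreeSymbol A g)

/-- The subspace of `𝕃V` that corresponds to the associated graded Lie algebra. -/
def image : Submodule F (TensorAlgebra F V) := ⨆ n, (σ.fil n).map (σ.symb n)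

theorem symb_mem_image {n : ℕ} {x : L} (hx : x ∈ σ.fil n) : σ.symb n x ∈ σ.image :=
  Submodule.mem_iSup_of_mem n ⟨x, hx, rfl⟩

theorem symb_of_lt {m n : ℕ} (h : m < n) {x : L} (hx : x ∈ σ.fil m) : σ.symb n x = 0 := by
  obtain ⟨n, rfl⟩ := Nat.exists_eq_add_one_of_ne_zero (Nat.ne_zero_of_lt h)
  exact σ.symb_of_mem (σ.mono (Nat.lt_succ_iff.1 h) hx)

theorem map_symb_le_span (n : ℕ) : (σ.fil n).map (σ.symb n) ≤
    Submodule.span F {t | ∃ d, ∃ x ∈ σ.fil n, x ∈ A.dim d ∧ σ.symb n x = t} := by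
  refine (Submodule.map_mono (σ.homogeneous n).le_span).trans ?_
  rw [Submodule.map_span, Submodule.span_le]
  rintro _ ⟨x, ⟨hx, d, hd⟩, rfl⟩
  exact Submodule.subset_span ⟨d, x, hx, hd, rfl⟩

theorem image_isSubalgebra : (tensorLie g).IsSubalgebra σ.image where
  homogeneous := by
    refine DimGrading.IsHomogeneous.iSup fun n => DimGrading.isHomogeneous_of_le_span _ ?_
    refine (σ.map_symb_le_span n).trans (Submodule.span_mono ?_)
    rintro _ ⟨d, x, hx, hd, rfl⟩
    exact ⟨⟨x, hx, rfl⟩, d, σ.symb_mem_dim hx hd⟩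
  bracket_mem := by
    intro s hs t ht
    induction hs using Submodule.iSup_induction' with
    | mem p s hs =>
      obtain ⟨x, hx, rfl⟩ := hs
      induction ht using Submodule.iSup_induction' with
      | mem q t ht =>
        obtain ⟨y, hy, rfl⟩ := ht
        rw [← σ.symb_bracket hx hy]
        exact σ.symb_mem_image (σ.bracket_mem hx hy)
      | zero => rw [map_zero]; exact Submodule.zero_mem _
      | add t t' _ _ h h' => rw [map_add]; exact Submodule.add_mem _ h h'
    | zero => rw [map_zero, LinearMap.zero_apply]; exact Submodule.zero_mem _
    | add s s' _ _ h h' => rw [map_add, LinearMap.add_apply]; exact Submodule.add_mem _ h h'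

theorem isLengthGraded_image : IsLengthGraded σ.image := by
  refine isLengthGraded_of_le_iSup (iSup_mono fun n => ?_)
  rintro _ ⟨x, hx, rfl⟩
  exact ⟨σ.symb_mem_image hx, σ.symb_mem_wordSpan hx⟩

theorem image_le_freeLie : σ.image ≤ freeLieSubmodule g := by
  refine iSup_le fun n => ?_
  rintro _ ⟨x, hx, rfl⟩
  exact σ.symb_mem_freeLie hx

theorem image_inf_wordSpan_le (n : ℕ) :
    σ.image ⊓ wordSpan F V n ≤ (σ.fil n).map (σ.symb n) := by
  rintro t ⟨ht, htn⟩
  have : σ.image ≤ ((σ.fil n).map (σ.symb n)).comap (lengthProj F V n) := by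
    refine iSup_le fun k => ?_
    rintro _ ⟨x, hx, rfl⟩
    rw [Submodule.mem_comap]
    by_cases h : k = n
    · subst h
      rw [lengthProj_of_mem (σ.symb_mem_wordSpan hx)]
      exact ⟨x, hx, rfl⟩
    · rw [lengthProj_of_mem_ne (σ.symb_mem_wordSpan hx) h]
      exact Submodule.zero_mem _
  have h := this ht
  rwa [Submodule.mem_comap, lengthProj_of_mem htn] at h

/-- A minimal system of homogeneous generators: elements of `A` whose symbols form a basis of a
complement of the decomposable elements in the associated graded Lie algebra. -/
structure Generators (κ : Type*) where
  weight : κ → ℕ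
  gen : κ → L
  mem_fil : ∀ i, gen i ∈ σ.fil (weight i)
  mem_dim : ∀ i, ∃ d, gen i ∈ A.dim d
  linearIndependent : LinearIndependent F
    (((tensorLie g).derived σ.image).mkQ ∘ fun i => σ.symb (weight i) (gen i))
  image_le : σ.image ≤ Submodule.span F (Set.range fun i => σ.symb (weight i) (gen i)) ⊔
    (tensorLie g).derived σ.image

theorem exists_generators : ∃ κ : Type v, Nonempty (σ.Generators κ) := by
  set D := (tensorLie g).derived σ.image with hD
  let I := {p : ℕ × ℤ × L // p.2.2 ∈ σ.fil p.1 ∧ p.2.2 ∈ A.dim p.2.1}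
  let s : I → TensorAlgebra F V := fun p => σ.symb p.1.1 p.1.2.2
  obtain ⟨κ, a, -, hspan, hind⟩ := exists_linearIndependent' F (D.mkQ ∘ s)
  refine ⟨κ, ⟨⟨fun i => (a i).1.1, fun i => (a i).1.2.2, fun i => (a i).2.1,
    fun i => ⟨_, (a i).2.2⟩, hind, ?_⟩⟩⟩
  have hs : σ.image ≤ Submodule.span F (Set.range s) := by
    refine iSup_le fun n => (σ.map_symb_le_span n).trans (Submodule.span_mono ?_)
    rintro _ ⟨d, x, hx, hd, rfl⟩
    exact ⟨⟨(n, d, x), hx, hd⟩, rfl⟩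
  have h1 : (Submodule.span F (Set.range s)).map D.mkQ =
      (Submodule.span F (Set.range (s ∘ a))).map D.mkQ := by
    rw [Submodule.map_span, Submodule.map_span, ← Set.range_comp, ← Set.range_comp, ← hspan]
    rfl
  calc σ.image ≤ ((Submodule.span F (Set.range s)).map D.mkQ).comap D.mkQ :=
        hs.trans (Submodule.le_comap_map _ _)
    _ = Submodule.span F (Set.range (s ∘ a)) ⊔ D := by
        rw [h1, Submodule.comap_map_mkQ, sup_comm]

namespace Generators

variable {σ} {κ : Type*} (γ : σ.Generators κ)

/-- The symbols of the generators. -/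
def symbol (i : κ) : TensorAlgebra F V := σ.symb (γ.weight i) (γ.gen i)

theorem symbol_mem_image (i : κ) : γ.symbol i ∈ σ.image := σ.symb_mem_image (γ.mem_fil i)

theorem symbol_mem_wordSpan (i : κ) : γ.symbol i ∈ wordSpan F V (γ.weight i) :=
  σ.symb_mem_wordSpan (γ.mem_fil i)

theorem symbol_mem_dim (i : κ) : ∃ d, γ.symbol i ∈ tensorDim g d :=
  (γ.mem_dim i).imp fun _ hd => σ.symb_mem_dim (γ.mem_fil i) hd

theorem symbol_mem_augIdeal (i : κ) : γ.symbol i ∈ augIdeal F V :=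
  freeLieSubmodule_le_augIdeal g (σ.image_le_freeLie (γ.symbol_mem_image i))

theorem linearIndependent_symbol : LinearIndependent F γ.symbol :=
  LinearIndependent.of_comp _ γ.linearIndependent

theorem linearIndependent_mulOpposite_symbol (h2 : (2 : F) ≠ 0) :
    LinearIndependent (TensorAlgebra F V)ᵐᵒᵖ γ.symbol :=
  linearIndependent_mulOpposite_of_mkQ (inf_mul_augIdeal_le_derived h2 g σ.image_isSubalgebra
    σ.isLengthGraded_image σ.image_le_freeLie) γ.symbol_mem_image γ.linearIndependent

/-- Graded Nakayama lemma: the symbols generate the associated graded Lie algebra. -/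
theorem map_symb_le (Y : ℕ → Submodule F (TensorAlgebra F V))
    (hγ : ∀ i, γ.symbol i ∈ Y (γ.weight i))
    (hY : ∀ {p q : ℕ} {s t : TensorAlgebra F V}, s ∈ Y p → t ∈ Y q →
      (tensorLie g).bracket s t ∈ Y (p + q)) (n : ℕ) :
    (σ.fil n).map (σ.symb n) ≤ Y n := by
  induction n using Nat.strong_induction_on with
  | _ n ih =>
    rintro _ ⟨x, hx, rfl⟩
    obtain ⟨r, hr, t, ht, hrt⟩ := Submodule.mem_sup.1 (γ.image_le (σ.symb_mem_image hx))
    have hr' : Submodule.span F (Set.range γ.symbol) ≤ (Y n).comap (lengthProj F V n) := by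
      rw [Submodule.span_le]
      rintro _ ⟨i, rfl⟩
      rw [SetLike.mem_coe, Submodule.mem_comap]
      by_cases h : γ.weight i = n
      · subst h
        rw [lengthProj_of_mem (γ.symbol_mem_wordSpan i)]
        exact hγ i
      · rw [lengthProj_of_mem_ne (γ.symbol_mem_wordSpan i) h]
        exact Submodule.zero_mem _
    have ht' : lengthProj F V n t ∈ Y n := by
      refine lengthProj_derived_mem g σ.isLengthGraded_image
        (σ.image_le_freeLie.trans (freeLieSubmodule_le_augIdeal g)) n ?_ ht
      rintro p q rfl hp hq a ha b hb
      exact hY (ih p hp (σ.image_inf_wordSpan_le p ha)) (ih q hq (σ.image_inf_wordSpan_le q hb))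
    rw [← lengthProj_of_mem (σ.symb_mem_wordSpan hx), ← hrt, map_add]
    exact add_mem (hr' hr) ht'

theorem lieSpan_gen_eq_top : A.lieSpan (Set.range γ.gen) = ⊤ := by
  set G := A.lieSpan (Set.range γ.gen) with hG
  have h1 := γ.map_symb_le (fun n => (G ⊓ σ.fil n).map (σ.symb n))
    (fun i => ⟨_, ⟨subset_lieSpan _ _ ⟨i, rfl⟩, γ.mem_fil i⟩, rfl⟩) (by
      rintro p q _ _ ⟨x, hx, rfl⟩ ⟨y, hy, rfl⟩
      exact ⟨_, ⟨(lieSpan_isSubalgebra _ _).bracket_mem _ hx.1 _ hy.1, σ.bracket_mem hx.2 hy.2⟩,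
        σ.symb_bracket hx.2 hy.2⟩)
  have h2 (n : ℕ) : σ.fil n ≤ G := by
    induction n with
    | zero => rw [σ.fil_zero]; exact bot_le
    | succ n ih =>
      intro x hx
      obtain ⟨z, hz, hzx⟩ := h1 (n + 1) ⟨x, hx, rfl⟩
      have h3 : x - z ∈ σ.fil n :=
        σ.mem_of_symb (sub_mem hx hz.2) (by rw [map_sub, hzx, sub_self])
      have := add_mem (ih h3) hz.1
      rwa [sub_add_cancel] at this
  rw [eq_top_iff]
  intro x _
  obtain ⟨n, hn⟩ := σ.exhaustive x
  exact h2 n hn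

theorem image_le_span_symbol : σ.image ≤
    (Submodule.span (TensorAlgebra F V)ᵐᵒᵖ (Set.range γ.symbol)).restrictScalars F := by
  have h := γ.map_symb_le (fun _ => (tensorLie g).lieSpan (Set.range γ.symbol))
    (fun i => subset_lieSpan _ _ ⟨i, rfl⟩)
    (fun hs ht => (lieSpan_isSubalgebra _ _).bracket_mem _ hs _ ht)
  refine (iSup_le h).trans (lieSpan_le_span_mulOpposite (tensorGrading g) (tensorDim_mul g) ?_)
  rintro _ ⟨i, rfl⟩
  exact γ.symbol_mem_dim i

theorem linearIndependent_gen : LinearIndependent F γ.gen := by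
  classical
  rw [linearIndependent_iff']
  intro s c hc
  by_contra! hne
  obtain ⟨i₀, hi₀, hci₀⟩ := hne
  obtain ⟨i, hi, hmax⟩ := (s.filter (c · ≠ 0)).exists_max_image γ.weight
    ⟨i₀, Finset.mem_filter.2 ⟨hi₀, hci₀⟩⟩
  obtain ⟨his, hci⟩ := Finset.mem_filter.1 hi
  -- Apply the symbol map of the largest weight that occurs.
  set n := γ.weight i with hn
  have h1 : ∑ j ∈ s, (if γ.weight j = n then c j else 0) • γ.symbol j = 0 := by
    rw [← map_zero (σ.symb n), ← hc, map_sum]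
    refine Finset.sum_congr rfl fun j hj => ?_
    rw [map_smul]
    by_cases hcj : c j = 0
    · simp [hcj]
    · have hjn := hmax j (Finset.mem_filter.2 ⟨hj, hcj⟩)
      split_ifs with h
      · rw [← h]
        rfl
      · rw [σ.symb_of_lt (lt_of_le_of_ne hjn h) (γ.mem_fil j), zero_smul, smul_zero]
  have h2 := linearIndependent_iff'.1 γ.linearIndependent_symbol s _ h1 i his
  rw [if_pos rfl] at h2
  exact hci h2

end Generators

end FreeSymbol

end GradedLieAlg

/-! ### The graph of the isomorphism with a free Lie algebra -/

namespace GradedLieAlg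

open TensorAlgebra (ι)

section

variable {F : Type u} [Field F] {L : Type v} [AddCommGroup L] [Module F L]
  {M : Type w} [AddCommGroup M] [Module F M]

/-- The trivial action. -/
noncomputable def trivialAction (A : GradedLieAlg F L) (B : GradedLieAlg F M) : Action A B where
  act := 0
  act_mem _ _ := Submodule.zero_mem _
  act_act _ _ _ := by simp
  act_bracket _ _ _ := by simp

/-- The product of two graded Lie algebras. -/
noncomputable def prodLie (A : GradedLieAlg F L) (B : GradedLieAlg F M) : GradedLieAlg F (L × M) :=
  sdp (trivialAction A B)

theorem prodLie_bracket (A : GradedLieAlg F L) (B : GradedLieAlg F M) (p q : L × M) :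
    (prodLie A B).bracket p q = (A.bracket p.1 q.1, B.bracket p.2 q.2) := by
  have h0 : A.koszulFlip B.toDimGrading (trivialAction A B).act = 0 := by
    ext y x
    refine B.le_of_dim_le (p := LinearMap.ker
      ((A.koszulFlip B.toDimGrading (trivialAction A B).act).flip x)) (fun j y hy => ?_) y
    refine A.le_of_dim_le (p := LinearMap.ker
      (A.koszulFlip B.toDimGrading (trivialAction A B).act y)) (fun i x hx => ?_) x
    rw [LinearMap.mem_ker, A.koszulFlip_of_mem _ _ hx hy]
    simp [trivialAction]
  rw [show (trivialAction A B).act = 0 from rfl] at h0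
  change sdpBracket (trivialAction A B) p q = _
  simp [sdpBracket, h0, trivialAction]

theorem prodLie_proj (A : GradedLieAlg F L) (B : GradedLieAlg F M) (d : ℤ) (p : L × M) :
    (prodLie A B).proj d p = (A.proj d p.1, B.proj d p.2) := by
  refine Prod.ext ?_ ?_
  · exact (DimGrading.proj_map_of_map_dim (prodLie A B).toDimGrading A.toDimGrading
      (LinearMap.fst F L M) (fun i x hx => hx.1) d p).symm
  · exact (DimGrading.proj_map_of_map_dim (prodLie A B).toDimGrading B.toDimGrading
      (LinearMap.snd F L M) (fun i x hx => hx.2) d p).symm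

variable {A : GradedLieAlg F L} {u : L} {d : ℤ}

theorem bracket_self_of_even (h2 : (2 : F) ≠ 0) (hu : u ∈ A.dim d) (hd : Even d) :
    A.bracket u u = 0 := by
  have h := A.bracket_skew hu hu
  rw [Int.negOnePow_even _ (hd.mul_right d), one_smul, eq_neg_iff_add_eq_zero, ← two_smul F] at h
  exact (smul_eq_zero.1 h).resolve_left h2

theorem bracket_self_bracket_self (h2 : (2 : F) ≠ 0) (h3 : (3 : F) ≠ 0) (hu : u ∈ A.dim d) :
    A.bracket u (A.bracket u u) = 0 := by
  rcases Int.even_or_odd d with hd | hd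
  · rw [bracket_self_of_even h2 hu hd, map_zero]
  · have hj := A.jacobi hu hu hu
    have hs := A.bracket_skew (A.bracket_mem hu hu) hu
    rw [Int.negOnePow_even _ ((Even.add_self d).mul_right d), one_smul] at hs
    rw [Int.negOnePow_odd _ (hd.mul hd), hs, Units.neg_smul, one_smul] at hj
    have h : (3 : F) • A.bracket u (A.bracket u u) = 0 := by
      rw [show (3 : F) = 1 + 1 + 1 by norm_num, add_smul, add_smul, one_smul]
      nth_rewrite 1 [hj]
      abel
    exact (smul_eq_zero.1 h).resolve_left h3

/-- Since `[u, [u, u]] = 0` for all homogeneous `u`, one element generates a Lie algebra of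
dimension at most two. -/
theorem lieSpan_singleton_le (h2 : (2 : F) ≠ 0) (h3 : (3 : F) ≠ 0) (hu : u ∈ A.dim d) :
    A.lieSpan {u} ≤ Submodule.span F {u, A.bracket u u} := by
  have huu := A.bracket_mem hu hu
  have h1 := bracket_self_bracket_self h2 h3 hu
  have h4 : A.bracket (A.bracket u u) u = 0 := by
    rw [A.bracket_skew huu hu, h1, smul_zero, neg_zero]
  have h5 := bracket_self_of_even h2 huu (Even.add_self d)
  refine A.lieSpan_le_of_homogeneous (by rintro x rfl; exact ⟨d, hu⟩)
    (Set.singleton_subset_iff.2 (Submodule.subset_span (by simp))) ?_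
  intro i j x y _ _ hx hy
  obtain ⟨a, b, rfl⟩ := Submodule.mem_span_pair.1 hx
  obtain ⟨a', b', rfl⟩ := Submodule.mem_span_pair.1 hy
  simp only [map_add, map_smul, LinearMap.add_apply, LinearMap.smul_apply, h1, h4, h5, smul_zero,
    add_zero]
  exact Submodule.smul_mem _ _ (Submodule.smul_mem _ _ (Submodule.subset_span (by simp)))

end

namespace FreeSymbol.Generators

variable {F : Type u} [Field F] {L : Type v} [AddCommGroup L] [Module F L]
  {V : Type w} [AddCommGroup V] [Module F V]
  {A : GradedLieAlg F L} {g : DimGrading F V} {σ : FreeSymbol A g} {κ : Type*}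
  (γ : σ.Generators κ)

/-- The graded vector space spanned by the generators. -/
noncomputable def genSpan : Submodule F L := Submodule.span F (Set.range γ.gen)

/-- The grading by dimension of the span of the generators. -/
noncomputable def genGrading : DimGrading F γ.genSpan :=
  A.restrict γ.genSpan (A.isHomogeneous_span (by rintro _ ⟨i, rfl⟩; exact γ.mem_dim i))

/-- The generators, as a basis of their span. -/
noncomputable def basis : Module.Basis κ F γ.genSpan := Module.Basis.span γ.linearIndependent_gen

theorem coe_basis (i : κ) : (γ.basis i : L) = γ.gen i :=
  congrArg Subtype.val (Module.Basis.span_apply γ.linearIndependent_gen i)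

/-- The graph of the isomorphism to be constructed: the Lie subalgebra of the product of `A` and
the tensor algebra on the generators that is generated by the pairs `(w, w)`. -/
noncomputable def graph : Submodule F (L × TensorAlgebra F γ.genSpan) :=
  (prodLie A (tensorLie γ.genGrading)).lieSpan (Set.range fun i => (γ.gen i, ι F (γ.basis i)))

theorem pair_mem_dim (i : κ) : ∃ d, (γ.gen i, ι F (γ.basis i)) ∈
    (prodLie A (tensorLie γ.genGrading)).dim d := by
  obtain ⟨d, hd⟩ := γ.mem_dim i
  refine ⟨d, hd, ι_mem_tensorDim γ.genGrading ?_⟩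
  change (γ.basis i : L) ∈ A.dim d
  rw [coe_basis]
  exact hd

theorem graph_isSubalgebra : (prodLie A (tensorLie γ.genGrading)).IsSubalgebra γ.graph :=
  lieSpan_isSubalgebra _ _

/-- The algebra map from the tensor algebra on the generators to `T V` given by the symbols of
the generators. -/
noncomputable def symbolHom : TensorAlgebra F γ.genSpan →ₐ[F] TensorAlgebra F V :=
  TensorAlgebra.lift F (γ.basis.constr F γ.symbol)

theorem symbolHom_ι (i : κ) : γ.symbolHom (ι F (γ.basis i)) = γ.symbol i := by
  rw [symbolHom, TensorAlgebra.lift_ι_apply, Module.Basis.constr_basis]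

theorem symbolHom_injective (h2 : (2 : F) ≠ 0) : Function.Injective γ.symbolHom :=
  injective_of_linearIndependent_mulOpposite γ.basis (γ.linearIndependent_mulOpposite_symbol h2)
    γ.symbol_mem_augIdeal _ γ.symbolHom_ι

/-- The elements of weight `n` of the graph: pairs `(z, a)` such that the image of `a` in `T V` is
the symbol of `z`. -/
noncomputable def graphWeight (n : ℕ) : Submodule F (L × TensorAlgebra F γ.genSpan) :=
  γ.graph ⊓ ((σ.fil n).comap (LinearMap.fst F _ _) ⊓
    LinearMap.eqLocus (γ.symbolHom.toLinearMap ∘ₗ LinearMap.snd F _ _)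
      (σ.symb n ∘ₗ LinearMap.fst F _ _))

theorem mem_graphWeight {n : ℕ} {p : L × TensorAlgebra F γ.genSpan} : p ∈ γ.graphWeight n ↔
    p ∈ γ.graph ∧ p.1 ∈ σ.fil n ∧ γ.symbolHom p.2 = σ.symb n p.1 := Iff.rfl

theorem graph_le_iSup : γ.graph ≤ ⨆ n, γ.graphWeight n := by
  set P := prodLie A (tensorLie γ.genGrading) with hP
  set s : Set (L × TensorAlgebra F γ.genSpan) :=
    {p | (∃ n, p ∈ γ.graphWeight n) ∧ ∃ d, p ∈ P.dim d} with hs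
  refine le_trans (b := Submodule.span F s) ?_ (Submodule.span_le.2 fun p hp =>
    hp.1.elim fun n hn => Submodule.mem_iSup_of_mem n hn)
  refine lieSpan_le_of_homogeneous _ ?_ ?_ ?_
  · rintro _ ⟨i, rfl⟩
    exact γ.pair_mem_dim i
  · rintro _ ⟨i, rfl⟩
    refine Submodule.subset_span ⟨⟨γ.weight i, ?_⟩, γ.pair_mem_dim i⟩
    exact γ.mem_graphWeight.2 ⟨subset_lieSpan _ _ ⟨i, rfl⟩, γ.mem_fil i, γ.symbolHom_ι i⟩
  · intro i j p q _ _ hp hq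
    have h := Submodule.apply_mem_map₂ P.bracket hp hq
    rw [Submodule.map₂_span_span] at h
    refine Submodule.span_mono ?_ h
    rintro _ ⟨p, ⟨⟨m, hm⟩, d, hd⟩, q, ⟨⟨n, hn⟩, e, he⟩, rfl⟩
    refine ⟨⟨m + n, ?_⟩, d + e, P.bracket_mem hd he⟩
    rw [mem_graphWeight] at hm hn ⊢
    refine ⟨γ.graph_isSubalgebra.bracket_mem _ hm.1 _ hn.1, ?_⟩
    dsimp only
    rw [hP, prodLie_bracket]
    refine ⟨σ.bracket_mem hm.2.1 hn.2.1, ?_⟩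
    rw [σ.symb_bracket hm.2.1 hn.2.1,
      tensorLie_bracket g (σ.symb_mem_dim hm.2.1 hd.1) (σ.symb_mem_dim hn.2.1 he.1)]
    change γ.symbolHom ((tensorLie γ.genGrading).bracket p.2 q.2) = _
    rw [tensorLie_bracket γ.genGrading hd.2 he.2, map_sub, map_mul, hm.2.2, hn.2.2,
      ← hm.2.2, ← hn.2.2, ← map_mul, ← map_mul]
    congr 1
    exact map_sign_smul γ.symbolHom.toLinearMap _ _

/-- The Lie algebra `A` acts on itself by the adjoint representation, and so does the tensor
algebra on the generators; the two actions agree on the graph. -/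
theorem bracket_eq_zero_of_mem_graph {z : L} (hz : (z, 0) ∈ γ.graph) : A.bracket z = 0 := by
  let Ψ : TensorAlgebra F γ.genSpan →ₐ[F] Module.End F L :=
    TensorAlgebra.lift F (A.bracket ∘ₗ γ.genSpan.subtype)
  have hle : γ.graph ≤ LinearMap.eqLocus (A.bracket ∘ₗ LinearMap.fst F _ _)
      (Ψ.toLinearMap ∘ₗ LinearMap.snd F _ _) := by
    refine lieSpan_le_of_homogeneous _ ?_ ?_ ?_
    · rintro _ ⟨i, rfl⟩
      exact γ.pair_mem_dim i
    · rintro _ ⟨i, rfl⟩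
      change A.bracket (γ.gen i) = Ψ (ι F (γ.basis i))
      rw [TensorAlgebra.lift_ι_apply, LinearMap.comp_apply, Submodule.subtype_apply, coe_basis]
    · intro i j p q hp hq hpK hqK
      have hp' : A.bracket p.1 = Ψ p.2 := hpK
      have hq' : A.bracket q.1 = Ψ q.2 := hqK
      rw [prodLie_bracket]
      change A.bracket (A.bracket p.1 q.1) = Ψ ((tensorLie γ.genGrading).bracket p.2 q.2)
      have e : Ψ ((i * j).negOnePow • (q.2 * p.2)) = (i * j).negOnePow • Ψ (q.2 * p.2) :=
        map_sign_smul Ψ.toLinearMap _ _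
      rw [tensorLie_bracket γ.genGrading hp.2 hq.2, map_sub, e, map_mul, map_mul, ← hp', ← hq']
      refine A.ext_of_mem_dim fun k y hy => ?_
      have hj := A.jacobi hp.1 hq.1 hy
      exact (sub_eq_of_eq_add hj).symm
  have := hle hz
  simpa using this

/-- A Lie algebra with at least two generators has no center, because the tensor algebra `T V` is
a domain and the symbols of the generators are right-independent. -/
theorem eq_zero_of_bracket_eq_zero (γ : σ.Generators κ) (h2 : (2 : F) ≠ 0) {z : L} {d : ℤ}
    (hz : z ∈ A.dim d) (hz0 : A.bracket z = 0) {i j : κ} (hij : i ≠ j) : z = 0 := by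
  classical
  by_contra hne
  obtain ⟨n, hn, hmin⟩ : ∃ n, z ∈ σ.fil n ∧ ∀ m < n, z ∉ σ.fil m :=
    ⟨Nat.find (σ.exhaustive z), Nat.find_spec (σ.exhaustive z),
      fun m hm => Nat.find_min (σ.exhaustive z) hm⟩
  cases n with
  | zero => rw [σ.fil_zero] at hn; exact hne hn
  | succ n =>
    set t := σ.symb (n + 1) z with ht
    have ht0 : t ≠ 0 := fun h => hmin n (Nat.lt_succ_self n) (σ.mem_of_symb hn h)
    obtain ⟨l, hl⟩ := Finsupp.mem_span_range_iff_exists_finsupp.1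
      (γ.image_le_span_symbol (σ.symb_mem_image hn))
    have hind := γ.linearIndependent_mulOpposite_symbol h2
    have key (i : κ) : ∀ k ≠ i, l k = 0 := by
      intro k hk
      obtain ⟨e, he⟩ := γ.mem_dim i
      have h1 : t * γ.symbol i - (d * e).negOnePow • (γ.symbol i * t) = 0 := by
        refine (tensorLie_bracket g (σ.symb_mem_dim hn hz)
          (σ.symb_mem_dim (γ.mem_fil i) he)).symm.trans ?_
        have := σ.symb_bracket hn (γ.mem_fil i)
        rw [hz0, LinearMap.zero_apply, map_zero] at this
        exact this.symm
      have h3 : Finsupp.linearCombination _ γ.symbol (MulOpposite.op (γ.symbol i) • l) =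
          Finsupp.linearCombination _ γ.symbol
            (Finsupp.single i (MulOpposite.op ((d * e).negOnePow • t))) := by
        rw [map_smul, op_smul_eq_mul, Finsupp.linearCombination_single, op_smul_eq_mul,
          Units.smul_def, mul_smul_comm, ← Units.smul_def, ← sub_eq_zero, ← h1]
        exact congrArg (fun s => s * γ.symbol i - (d * e).negOnePow • (γ.symbol i * t)) hl
      have h4 := DFunLike.congr_fun (hind h3) k
      rw [Finsupp.smul_apply, smul_eq_mul, Finsupp.single_eq_of_ne hk] at h4
      refine (mul_eq_zero.1 h4).resolve_left fun h => ?_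
      exact hind.ne_zero i (MulOpposite.op_injective h)
    have hl0 : l = 0 := by
      ext k
      by_cases hk : k = i
      · rw [key j k (hk ▸ hij)]
        rfl
      · rw [key i k hk]
        rfl
    rw [hl0, Finsupp.sum_zero_index] at hl
    exact ht0 hl.symm

theorem eq_zero_of_mem_graph_of_subsingleton (h2 : (2 : F) ≠ 0) (h3 : (3 : F) ≠ 0)
    [Subsingleton κ] {z : L} (hz : (z, 0) ∈ γ.graph) : z = 0 := by
  rcases isEmpty_or_nonempty κ with hκ | ⟨⟨i⟩⟩
  · have : γ.graph ≤ ⊥ :=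
      lieSpan_le_of_homogeneous _ (by rintro _ ⟨i, rfl⟩; exact hκ.elim i)
        (by rintro _ ⟨i, rfl⟩; exact hκ.elim i) (by
          intro i j x y _ _ hx _
          rw [(Submodule.mem_bot F).1 hx, map_zero]
          exact Submodule.zero_mem _)
    exact congrArg Prod.fst ((Submodule.mem_bot F).1 (this hz))
  · obtain ⟨d, hd⟩ := γ.pair_mem_dim i
    have hrange : (Set.range fun i => (γ.gen i, ι F (γ.basis i))) =
        {(γ.gen i, ι F (γ.basis i))} := by
      ext p
      constructor
      · rintro ⟨j, rfl⟩
        rw [Subsingleton.elim j i]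
        rfl
      · rintro rfl
        exact ⟨i, rfl⟩
    rw [graph, hrange] at hz
    obtain ⟨α, β, hαβ⟩ := Submodule.mem_span_pair.1 (lieSpan_singleton_le h2 h3 hd hz)
    set x := ι F (γ.basis i) with hx
    have hx0 : x ≠ 0 := fun h =>
      γ.basis.ne_zero i ((TensorAlgebra.ι_eq_zero_iff F _).1 h)
    have hx1 : x ∈ wordSpan F γ.genSpan 1 := by
      rw [wordSpan, pow_one]
      exact ⟨_, rfl⟩
    have hsnd : α • x + β • (tensorLie γ.genGrading).bracket x x = 0 := by
      have := congrArg Prod.snd hαβ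
      rw [prodLie_bracket] at this
      exact this
    have hα : α = 0 := by
      have h := congrArg (lengthProj F γ.genSpan 1) hsnd
      rw [map_add, map_smul, map_smul, lengthProj_of_mem hx1,
        lengthProj_of_mem_ne (bracket_mem_wordSpan γ.genGrading hx1 hx1) (by norm_num), smul_zero,
        add_zero, map_zero] at h
      exact (smul_eq_zero.1 h).resolve_right hx0
    rw [hα, zero_smul, zero_add] at hαβ hsnd
    rcases Int.even_or_odd d with he | ho
    · rw [bracket_self_of_even h2 hd he, smul_zero] at hαβ
      exact (congrArg Prod.fst hαβ).symm
    · rw [tensorLie_bracket γ.genGrading hd.2 hd.2, Int.negOnePow_odd _ (ho.mul ho),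
        Units.neg_smul, one_smul, sub_neg_eq_add, ← two_smul F, smul_smul] at hsnd
      have hβ : β = 0 :=
        (mul_eq_zero.1 ((smul_eq_zero.1 hsnd).resolve_right (mul_ne_zero hx0 hx0))).resolve_right h2
      rw [hβ, zero_smul] at hαβ
      exact (congrArg Prod.fst hαβ).symm

/-- The graph is single-valued over the tensor algebra. -/
theorem eq_zero_of_mem_graph (h2 : (2 : F) ≠ 0) (h3 : (3 : F) ≠ 0) {z : L}
    (hz : (z, 0) ∈ γ.graph) : z = 0 := by
  rcases subsingleton_or_nontrivial κ with _ | ⟨i, j, hij⟩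
  · exact γ.eq_zero_of_mem_graph_of_subsingleton h2 h3 hz
  · refine (Submodule.mem_bot F).1 (A.mem_of_proj_mem fun d => ?_)
    have h := γ.graph_isSubalgebra.homogeneous _ hz d
    rw [prodLie_proj, map_zero] at h
    exact γ.eq_zero_of_bracket_eq_zero h2 (A.proj_mem d z) (γ.bracket_eq_zero_of_mem_graph h) hij

theorem eq_zero_of_mem_iSup_graphWeight (h2 : (2 : F) ≠ 0) (h3 : (3 : F) ≠ 0) (N : ℕ)
    (p : L × TensorAlgebra F γ.genSpan) (hp : p ∈ ⨆ n < N, γ.graphWeight n) (h0 : p.1 = 0) :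
    p = 0 := by
  induction N generalizing p with
  | zero => simpa using hp
  | succ N ih =>
    rw [Nat.iSup_lt_succ] at hp
    obtain ⟨r, hr, r', hr', rfl⟩ := Submodule.mem_sup.1 hp
    obtain ⟨hr'Γ, hr'N, hr's⟩ := γ.mem_graphWeight.1 hr'
    have hrr' : r'.1 = -r.1 := eq_neg_of_add_eq_zero_right h0
    have hs : σ.symb N r'.1 = 0 := by
      cases N with
      | zero =>
        rw [σ.fil_zero] at hr'N
        rw [(Submodule.mem_bot F).1 hr'N, map_zero]
      | succ M =>
        refine σ.symb_of_mem ?_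
        have hle : (⨆ n < M + 1, γ.graphWeight n) ≤ (σ.fil M).comap (LinearMap.fst F _ _) :=
          iSup₂_le fun n hn q hq =>
            σ.mono (Nat.lt_succ_iff.1 hn) (γ.mem_graphWeight.1 hq).2.1
        rw [hrr']
        exact neg_mem (hle hr)
    have h2' : r'.2 = 0 := γ.symbolHom_injective h2 (by rw [hr's, hs, map_zero])
    have h1' : r'.1 = 0 := by
      refine γ.eq_zero_of_mem_graph h2 h3 ?_
      rw [← h2']
      exact hr'Γ
    have hr0 : r = 0 := ih r hr (by rw [h1'] at hrr'; exact neg_eq_zero.1 hrr'.symm)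
    rw [hr0, zero_add]
    exact Prod.ext h1' h2'

/-- The graph is single-valued over `A`. -/
theorem eq_zero_of_mem_graph_of_fst (h2 : (2 : F) ≠ 0) (h3 : (3 : F) ≠ 0)
    {p : L × TensorAlgebra F γ.genSpan} (hp : p ∈ γ.graph) (h0 : p.1 = 0) : p = 0 := by
  have hmono : Monotone fun N : ℕ => ⨆ n < N, γ.graphWeight n := fun M N hMN =>
    iSup₂_le fun n hn => le_iSup₂_of_le n (hn.trans_le hMN) le_rfl
  have hle : (⨆ n, γ.graphWeight n) ≤ ⨆ N : ℕ, ⨆ n < N, γ.graphWeight n :=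
    iSup_le fun n => le_iSup_of_le (n + 1) (le_iSup₂_of_le n (Nat.lt_succ_self n) le_rfl)
  obtain ⟨N, hN⟩ := (Submodule.mem_iSup_of_directed _ hmono.directed_le).1
    (hle (γ.graph_le_iSup hp))
  exact γ.eq_zero_of_mem_iSup_graphWeight h2 h3 N p hN h0

theorem map_fst_graph : γ.graph.map (LinearMap.fst F _ _) = ⊤ := by
  rw [eq_top_iff, ← γ.lieSpan_gen_eq_top]
  refine lieSpan_le _ ⟨DimGrading.IsHomogeneous.map
    (g := (prodLie A (tensorLie γ.genGrading)).toDimGrading) (fun _ _ hx => hx.1)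
    γ.graph_isSubalgebra.homogeneous, ?_⟩ ?_
  · rintro _ ⟨p, hp, rfl⟩ _ ⟨q, hq, rfl⟩
    exact ⟨_, γ.graph_isSubalgebra.bracket_mem _ hp _ hq, by rw [prodLie_bracket]; rfl⟩
  · rintro _ ⟨i, rfl⟩
    exact ⟨_, subset_lieSpan _ _ ⟨i, rfl⟩, rfl⟩

theorem map_snd_graph :
    γ.graph.map (LinearMap.snd F _ _) = freeLieSubmodule γ.genGrading := by
  have hpair (i : κ) : (γ.gen i, ι F (γ.basis i)) ∈ γ.graph := subset_lieSpan _ _ ⟨i, rfl⟩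
  refine le_antisymm (Submodule.map_le_iff_le_comap.2 ?_) ?_
  · refine lieSpan_le_of_homogeneous _ ?_ ?_ ?_
    · rintro _ ⟨i, rfl⟩
      exact γ.pair_mem_dim i
    · rintro _ ⟨i, rfl⟩
      exact subset_lieSpan _ _ ⟨_, rfl⟩
    · intro i j p q _ _ hp hq
      rw [prodLie_bracket]
      exact (lieSpan_isSubalgebra _ _).bracket_mem _ hp _ hq
  · rw [freeLieSubmodule_eq _ γ.basis.span_eq]
    refine lieSpan_le _ ⟨DimGrading.IsHomogeneous.map
      (g := (prodLie A (tensorLie γ.genGrading)).toDimGrading) (fun _ _ hx => hx.2)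
      γ.graph_isSubalgebra.homogeneous, ?_⟩ ?_
    · rintro _ ⟨p, hp, rfl⟩ _ ⟨q, hq, rfl⟩
      exact ⟨_, γ.graph_isSubalgebra.bracket_mem _ hp _ hq, by rw [prodLie_bracket]; rfl⟩
    · rintro _ ⟨i, rfl⟩
      exact ⟨_, hpair i, rfl⟩

end FreeSymbol.Generators

/-- A graded Lie algebra with a filtration whose associated graded Lie algebra embeds in a free
Lie algebra is free. -/
theorem FreeSymbol.isFree {F : Type u} [Field F] {L : Type v} [AddCommGroup L] [Module F L]
    {V : Type w} [AddCommGroup V] [Module F V] {A : GradedLieAlg F L} {g : DimGrading F V}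
    (σ : FreeSymbol A g) (h2 : (2 : F) ≠ 0) (h3 : (3 : F) ≠ 0) : A.IsFree := by
  obtain ⟨κ, ⟨γ⟩⟩ := σ.exists_generators
  have hsnd (p : γ.graph) : (p : L × TensorAlgebra F γ.genSpan).2 ∈
      freeLieSubmodule γ.genGrading := by
    rw [← γ.map_snd_graph]
    exact ⟨p, p.2, rfl⟩
  let π₁ : γ.graph →ₗ[F] L := LinearMap.fst F _ _ ∘ₗ γ.graph.subtype
  let π₂ : γ.graph →ₗ[F] freeLieSubmodule γ.genGrading :=
    (LinearMap.snd F _ _ ∘ₗ γ.graph.subtype).codRestrict _ hsnd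
  have h₁ : Function.Bijective π₁ := by
    refine ⟨(injective_iff_map_eq_zero _).2 fun p hp =>
      Subtype.ext (γ.eq_zero_of_mem_graph_of_fst h2 h3 p.2 hp), fun x => ?_⟩
    obtain ⟨p, hp, rfl⟩ : x ∈ γ.graph.map (LinearMap.fst F _ _) := by
      rw [γ.map_fst_graph]
      trivial
    exact ⟨⟨p, hp⟩, rfl⟩
  have h₂ : Function.Bijective π₂ := by
    refine ⟨(injective_iff_map_eq_zero _).2 fun p hp => ?_, fun a => ?_⟩
    · have hp2 : (p : L × TensorAlgebra F γ.genSpan).2 = 0 := congrArg Subtype.val hp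
      have hp1 := γ.eq_zero_of_mem_graph h2 h3 (z := (p : L × TensorAlgebra F γ.genSpan).1) (by
        rw [← hp2]
        exact p.2)
      exact Subtype.ext (Prod.ext hp1 hp2)
    · obtain ⟨p, hp, hpa⟩ : (a : TensorAlgebra F γ.genSpan) ∈
          γ.graph.map (LinearMap.snd F _ _) := by
        rw [γ.map_snd_graph]
        exact a.2
      exact ⟨⟨p, hp⟩, Subtype.ext hpa⟩
  let e₁ := LinearEquiv.ofBijective π₁ h₁
  let e₂ := LinearEquiv.ofBijective π₂ h₂
  have he (p : γ.graph) : (e₁.symm.trans e₂) (π₁ p) = π₂ p := by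
    rw [LinearEquiv.trans_apply]
    exact congrArg e₂ (e₁.symm_apply_apply p)
  refine ⟨γ.genSpan, inferInstance, inferInstance, γ.genGrading,
    ⟨⟨e₁.symm.trans e₂, fun x y => ?_, fun d x hx => ?_⟩⟩⟩
  · obtain ⟨p, rfl⟩ := h₁.surjective x
    obtain ⟨q, rfl⟩ := h₁.surjective y
    have hpq := γ.graph_isSubalgebra.bracket_mem _ p.2 _ q.2
    have e : A.bracket (π₁ p) (π₁ q) = π₁ ⟨_, hpq⟩ := by
      change _ = ((prodLie A (tensorLie γ.genGrading)).bracket p q).1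
      rw [prodLie_bracket]
      rfl
    rw [e, he, he, he]
    refine Subtype.ext ?_
    change ((prodLie A (tensorLie γ.genGrading)).bracket p q).2 = _
    rw [prodLie_bracket]
    rfl
  · obtain ⟨p, rfl⟩ := h₁.surjective x
    rw [he]
    -- The component of dimension `d` of `p` has the same image in `A` as `p`.
    have hpd := γ.graph_isSubalgebra.homogeneous _ p.2 d
    have e : p = ⟨_, hpd⟩ := by
      refine h₁.injective ?_
      change π₁ p = ((prodLie A (tensorLie γ.genGrading)).proj d p).1
      rw [prodLie_proj]
      exact (A.proj_of_mem hx).symm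
    have h := (prodLie A (tensorLie γ.genGrading)).proj_mem d (p : L × TensorAlgebra F γ.genSpan)
    have h' : (p : L × TensorAlgebra F γ.genSpan) =
      (prodLie A (tensorLie γ.genGrading)).proj d p := congrArg Subtype.val e
    rw [← h'] at h
    exact h.2

end GradedLieAlg

/-! ### Subalgebras of a filtered Lie algebra with `gr(L) ≅ L₀ ⋊ 𝕃V₁` -/

namespace GradedLieAlg

open TensorAlgebra (ι)

variable {F : Type u} [Field F] {L : Type v} [AddCommGroup L] [Module F L]

theorem sdp_bracket_of_fst_eq_zero {M : Type w} [AddCommGroup M] [Module F M]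
    {A : GradedLieAlg F L} {B : GradedLieAlg F M} (ρ : Action A B) {p q : L × M}
    (hp : p.1 = 0) (hq : q.1 = 0) : ((sdp ρ).bracket p q).2 = B.bracket p.2 q.2 := by
  change (sdpBracket ρ p q).2 = _
  simp [sdpBracket, hp, hq]

namespace Filtration

variable {A : GradedLieAlg F L} (Φ : Filtration A)

theorem symb_eq_zero_iff {k : ℤ} (x : Φ.fil k) : Φ.symb k x = 0 ↔ (x : L) ∈ Φ.fil (k - 1) := by
  have hinj : Function.Injective (Φ.ofPiece k) := DirectSum.of_injective (β := Φ.Piece) k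
  rw [symb, LinearMap.comp_apply, map_eq_zero_iff _ hinj, Submodule.mkQ_apply,
    Submodule.Quotient.mk_eq_zero]
  rfl

/-- The symbols of the elements of a subalgebra `J` that meets `F_0 L` trivially. They have
positive degree, hence no component in `L₀`. -/
theorem exists_freeSymbol_sub (ρ : Φ.zeroLie.Action (freeLie (Φ.pieceGrading 1)))
    (e : Φ.gr.Iso (sdp ρ))
    (he : ∀ k : ℤ, ∀ z ∈ Φ.grDegree k, e.toLinearEquiv z ∈ sdpDegree ρ k)
    (J : Submodule F L) (hJ : A.IsSubalgebra J) (hJ0 : J ⊓ Φ.fil 0 = ⊥) :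
    Nonempty (FreeSymbol (A.sub J hJ) (Φ.pieceGrading 1)) := by
  set E : Φ.Gr →ₗ[F] Φ.fil 0 × freeLieSubmodule (Φ.pieceGrading 1) :=
    e.toLinearEquiv.toLinearMap with hE
  have hdeg {k : ℤ} (x : Φ.fil k) : E (Φ.symb k x) ∈ sdpDegree ρ k := he k _ ⟨_, rfl⟩
  have hfst {k : ℤ} (hk : k ≠ 0) (x : Φ.fil k) : (E (Φ.symb k x)).1 = 0 := by
    have h := (hdeg x).1
    rw [if_neg hk] at h
    exact h
  -- The symbol maps, extended arbitrarily outside of `F_n L`.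
  have hext (n : ℕ) : ∃ f : L →ₗ[F] TensorAlgebra F (Φ.Piece 1), ∀ (x : L) (hx : x ∈ Φ.fil n),
      f x = ((E (Φ.symb n ⟨x, hx⟩)).2 : TensorAlgebra F (Φ.Piece 1)) := by
    obtain ⟨f, hf⟩ := LinearMap.exists_extend ((freeLieSubmodule (Φ.pieceGrading 1)).subtype ∘ₗ
      LinearMap.snd F _ _ ∘ₗ E ∘ₗ Φ.symb n)
    exact ⟨f, fun x hx => LinearMap.congr_fun hf ⟨x, hx⟩⟩
  choose f hf using hext
  have hzero {x : J} (hx : (x : L) ∈ Φ.fil (0 : ℕ)) : x = 0 := by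
    have h : (x : L) ∈ J ⊓ Φ.fil 0 := ⟨x.2, hx⟩
    rw [hJ0, Submodule.mem_bot] at h
    exact Subtype.ext h
  have hbr {p q : ℕ} {x y : J} (hx : (x : L) ∈ Φ.fil p) (hy : (y : L) ∈ Φ.fil q) :
      A.bracket x y ∈ Φ.fil (p + q : ℕ) := by
    rw [Nat.cast_add]
    exact Φ.bracket_mem hx hy
  refine ⟨{
    fil n := (Φ.fil n).comap J.subtype
    mono m n h := Submodule.comap_mono (Φ.mono (Nat.cast_le.2 h))
    fil_zero := (Submodule.eq_bot_iff _).2 fun x hx => hzero hx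
    exhaustive x := ?_
    homogeneous n := DimGrading.IsHomogeneous.comap (fun _ _ hx => hx) (Φ.homogeneous n)
    bracket_mem hx hy := hbr hx hy
    symb n := f n ∘ₗ J.subtype
    symb_mem_wordSpan := ?_
    symb_mem_freeLie := ?_
    symb_mem_dim := ?_
    symb_bracket := ?_
    symb_of_mem := ?_
    mem_of_symb := ?_ }⟩
  · obtain ⟨k, hk⟩ := Φ.exhaustive (x : L)
    exact ⟨k.toNat, Φ.mono (Int.self_le_toNat k) hk⟩
  · intro n x hx
    change f n x ∈ _
    rw [hf n x hx]
    exact (hdeg ⟨(x : L), hx⟩).2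
  · intro n x hx
    change f n x ∈ _
    rw [hf n x hx]
    exact Subtype.prop _
  · intro n x d hx hd
    change f n x ∈ _
    rw [hf n x hx]
    exact (e.map_dim d _ (Φ.symb_mem_grDim hx hd)).2
  · intro p q x y hx hy
    change f (p + q) (A.bracket x y) = (tensorLie _).bracket (f p x) (f q y)
    rcases Nat.eq_zero_or_pos p with rfl | hp
    · rw [hzero hx, ZeroMemClass.coe_zero, map_zero, map_zero, LinearMap.zero_apply, map_zero,
        map_zero, LinearMap.zero_apply]
    rcases Nat.eq_zero_or_pos q with rfl | hq
    · rw [hzero hy, ZeroMemClass.coe_zero, map_zero, map_zero, map_zero, map_zero]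
    have hx' : (x : L) ∈ Φ.fil (p : ℤ) := hx
    have hy' : (y : L) ∈ Φ.fil (q : ℤ) := hy
    rw [hf p x hx', hf q y hy', hf (p + q) _ (hbr hx' hy'),
      Φ.symb_congr (Nat.cast_add p q) rfl (hbr hx' hy') (Φ.bracket_mem hx' hy'),
      ← Φ.grBracket_symb hx' hy']
    have h1 : E (Φ.grBracket (Φ.symb p ⟨x, hx'⟩) (Φ.symb q ⟨y, hy'⟩)) =
        (sdp ρ).bracket (E (Φ.symb p ⟨x, hx'⟩)) (E (Φ.symb q ⟨y, hy'⟩)) := e.map_bracket _ _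
    rw [h1, sdp_bracket_of_fst_eq_zero ρ (hfst (by omega) _) (hfst (by omega) _)]
    rfl
  · intro n x hx
    change f (n + 1) x = 0
    have hx' : (x : L) ∈ Φ.fil (n + 1 : ℕ) := Φ.mono (by simp) hx
    rw [hf (n + 1) x hx', (Φ.symb_eq_zero_iff _).2, map_zero]
    · rfl
    · have hk : ((n + 1 : ℕ) : ℤ) - 1 = n := by push_cast; ring
      change (x : L) ∈ Φ.fil _
      rw [hk]
      exact hx
  · intro n x hx h0
    have h0' : f (n + 1) x = 0 := h0
    rw [hf (n + 1) x hx] at h0'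
    have h1 : E (Φ.symb (n + 1 : ℕ) ⟨x, hx⟩) = 0 :=
      Prod.ext (hfst (by omega) _) (Subtype.ext h0')
    have h2 : (x : L) ∈ Φ.fil (((n + 1 : ℕ) : ℤ) - 1) :=
      (Φ.symb_eq_zero_iff _).1 ((map_eq_zero_iff _ e.toLinearEquiv.injective).1 h1)
    have hk : ((n + 1 : ℕ) : ℤ) - 1 = n := by push_cast; ring
    rw [hk] at h2
    exact h2

end Filtration

end GradedLieAlg

theorem mainTheorem7 {F : Type u} [Field F] (h2 : (2 : F) ≠ 0) (h3 : (3 : F) ≠ 0)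
    {L : Type v} [AddCommGroup L] [Module F L] (A : GradedLieAlg F L) (hfin : A.IsFiniteType)
    (Φ : A.Filtration)
    (hgr : ∃ (ρ : Φ.zeroLie.Action (GradedLieAlg.freeLie (Φ.pieceGrading 1)))
      (e : Φ.gr.Iso (GradedLieAlg.sdp ρ)),
      ∀ k : ℤ, ∀ z ∈ Φ.grDegree k, e.toLinearEquiv z ∈ GradedLieAlg.sdpDegree ρ k)
    (J : Submodule F L) (hJ : A.IsSubalgebra J) (hJ0 : J ⊓ Φ.fil 0 = ⊥) :
    (A.sub J hJ).IsFree := by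
  obtain ⟨ρ, e, he⟩ := hgr
  obtain ⟨σ⟩ := Φ.exists_freeSymbol_sub ρ e he J hJ hJ0
  exact σ.isFree h2 h3
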